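/- Let $n\ge 2$, let $I\subset\mathbb R$ be open, and let $\omega_2:I\to\{\operatorname{Im} w>0\}$ be continuous. For $t\in I$ let $\Lambda(t)=\mathbb Z+\mathbb Z\,\omega_2(t)$ (periods $\omega_1\equiv 1$, $\omega_2(t)$), and let $\sigma,\zeta,\wp$ be the Weierstrass functions of $\Lambda(t)$, $\eta_1=2\zeta(\omega_1/2)$, $g_2=60\sum_{0\ne\omega\in\Lambda(t)}\omega^{-4}$. Let $f(z,t)$ be continuously differentiable in $(z,t)$ for $t\in I$, $z\notin\Lambda(t)$ and, for each $t\in I$, elliptic in $z$ with period lattice $\Lambda(t)$, having modulo $\Lambda(t)$ its only pole at $z=0$, of order $n$. Write $f'=\partial f/\partial z$ and let a dot denote $d/dt$. Assume that all critical points of $f(\cdot,t)$ (zeros of $f'(\cdot,t)$) are simple, and that continuous functions $a_0(t),\dots,a_n(t)$ on $I$ represent them, each exactly once modulo $\Lambda(t)$, with $\sum_{k=0}^n a_k(t)=0$. Let $A_k(t)=f(a_k(t),t)$ and assume $A_0\equiv 0$. Then for $t\in I$ there is $c(t)\neq 0$ such that $$f'(z,t)=c(t)\,\frac{\prod_{k=0}^n\sigma(z-a_k(t))}{\sigma^{n+1}(z)}\qquad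 (z\notin\Lambda(t)),$$ the functions $a_k, A_k, c,\omega_2$ are differentiable on $I$, and, with $$D_k(t)=f''(a_k(t),t)=c(t)\,\frac{\prod_{j\ne k}\sigma(a_k(t)-a_j(t))}{\sigma^{n+1}(a_k(t))},\qquad \gamma_k(t)=\frac{\dot A_k(t)}{D_k(t)},$$ the following system of differential equations holds on $I$: $$\dot a_l=\sum_{1\le k\le n,\ k\ne l}\gamma_k\bigl[\zeta(a_k-a_l)-\zeta(a_k)+\eta_1a_l\bigr]+\gamma_l\Bigl(\sum_{0\le s\le n,\ s\neq l}\zeta(a_s-a_l)+\eta_1a_l+n\zeta(a_l)\Bigr),\quad 1\le l\le n,$$ $$\frac{\dot c}{c}=-\sum_{j=0}^n\Bigl[\zeta(a_j)\,\dot a_j+\dot\omega_2\,\frac{\partial\ln\sigma(a_j)}{\partial\omega_2}\Bigr]+n\sum_{k=1}^n\gamma_k\bigl(\wp(a_k)+\eta_1\bigr),$$ $$\dot\omega_2=2\pi i\sum_{k=1}^n\gamma_k ,$$ where the logarithmic derivative of $\sigma(z)=\sigma(z;\omega_1,\omega_2)$ with respect to the period $\omega_2$ at $z=a_j(t)$ is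 given by $$\frac{\partial\ln\sigma(z)}{\partial\omega_2}=-\frac1{2\pi i}\Bigl[\tfrac12\,\omega_1\bigl(\wp(z)-\zeta(z)^2\bigr)+\eta_1\bigl(z\zeta(z)-1\bigr)-\omega_1\frac{g_2}{24}z^2\Bigr].$$ -/

import Mathlib

open scoped UpperHalfPlane

noncomputable section

namespace PeriodPair

/-- The pair of periods `ω₁ = 1`, `ω₂ = τ`, where `τ` lies in the upper half-plane. -/
def ofTau (τ : ℍ) : PeriodPair where
  ω₁ := 1
  ω₂ := (τ : ℂ)
  indep := by
    rw [LinearIndependent.pair_iff]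
    intro s t h
    have him := congrArg Complex.im h
    have hre := congrArg Complex.re h
    simp only [Complex.real_smul, Complex.add_im, Complex.mul_im, Complex.ofReal_re,
      Complex.ofReal_im, Complex.one_im, Complex.one_re, mul_zero, zero_mul, add_zero,
      zero_add, Complex.zero_im, UpperHalfPlane.coe_im, mul_eq_zero] at him
    have ht : t = 0 := him.resolve_right τ.im_ne_zero
    subst ht
    simp at hre
    exact ⟨hre, rfl⟩

/-- The Weierstrass `ζ`-function,
`ζ(z) = 1/z + ∑' (1/(z-ω) + 1/ω + z/ω²)`, the sum being over the non-zero periods `ω`. -/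
def weierstrassZeta (L : PeriodPair) (z : ℂ) : ℂ :=
  1 / z + ∑' l : {l : L.lattice // l ≠ 0},
    (1 / (z - (l.1 : ℂ)) + 1 / (l.1 : ℂ) + z / (l.1 : ℂ) ^ 2)

/-- The Weierstrass `σ`-function,
`σ(z) = z ∏' (1 - z/ω) exp(z/ω + z²/(2ω²))`, the product being over the non-zero periods `ω`. -/
def weierstrassSigma (L : PeriodPair) (z : ℂ) : ℂ :=
  z * ∏' l : {l : L.lattice // l ≠ 0},
    ((1 - z / (l.1 : ℂ)) * Complex.exp (z / (l.1 : ℂ) + z ^ 2 / (2 * (l.1 : ℂ) ^ 2)))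

/-- The quasi-period `η₁ = 2 ζ(ω₁/2)`. -/
def eta₁ (L : PeriodPair) : ℂ := 2 * L.weierstrassZeta (L.ω₁ / 2)

/-- The expression through `℘`, `ζ`, `η₁` and `g₂` by which `∂ ln σ(z) / ∂ω₂` is computed. That it
is the logarithmic derivative of `σ(z; ω₁, ω₂)` in `ω₂` is part of the theorem. -/
def dLnSigma₂ (L : PeriodPair) (z : ℂ) : ℂ :=
  -(1 / (2 * Real.pi * Complex.I)) *
    ((1 / 2) * L.ω₁ * (L.weierstrassP z - L.weierstrassZeta z ^ 2)
      + L.eta₁ * (z * L.weierstrassZeta z - 1) - L.ω₁ * (L.g₂ / 24) * z ^ 2)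

end PeriodPair

/-- `f` (off the lattice) is an elliptic function for the lattice of `L` whose only pole, modulo the
lattice, is at the origin and has order `n`; so `f` is elliptic of order `n`. The values of `f` at
the lattice points are irrelevant. -/
structure IsEllipticPoleAtZero (L : PeriodPair) (n : ℕ) (f : ℂ → ℂ) : Prop where
  differentiableOn : DifferentiableOn ℂ f {z | z ∉ L.lattice}
  periodic : ∀ l ∈ L.lattice, ∀ z ∉ L.lattice, f (z + l) = f z
  order_eq : meromorphicOrderAt f 0 = ((-(n : ℤ) : ℤ) : WithTop ℤ)

/-- `a 0, …, a n` represent, each exactly once modulo the lattice, all critical points of `f`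
(the zeros of `f'` off the lattice), all of them are simple, and the representatives are chosen
with `∑ a k = 0`. -/
structure IsSimpleCriticalSystem (L : PeriodPair) (f : ℂ → ℂ) {n : ℕ}
    (a : Fin (n + 1) → ℂ) : Prop where
  notMem : ∀ k, a k ∉ L.lattice
  deriv_eq_zero_iff : ∀ z ∉ L.lattice, deriv f z = 0 ↔ ∃ k, z - a k ∈ L.lattice
  incongruent : ∀ j k, j ≠ k → a j - a k ∉ L.lattice
  simple : ∀ k, deriv (deriv f) (a k) ≠ 0
  sum_eq_zero : ∑ k, a k = 0

/-- `D_k = c ∏_{j ≠ k} σ(a_k - a_j) / σ(a_k)^{n+1}`. -/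
def critD (L : PeriodPair) {n : ℕ} (c : ℂ) (a : Fin (n + 1) → ℂ) (k : Fin (n + 1)) : ℂ :=
  c * (∏ j ∈ Finset.univ.erase k, L.weierstrassSigma (a k - a j)) /
    L.weierstrassSigma (a k) ^ (n + 1)

/-- `γ_k(t) = A_k'(t) / D_k(t)`, where `A_k(t) = f(a_k(t), t)`. -/
def critGamma (L : ℝ → PeriodPair) {n : ℕ} (f : ℂ → ℝ → ℂ) (c : ℝ → ℂ)
    (a : Fin (n + 1) → ℝ → ℂ) (k : Fin (n + 1)) (t : ℝ) : ℂ :=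
  deriv (fun s => f (a k s) s) t / critD (L t) (c t) (fun j => a j t) k

end

section

open Complex Filter Topology Set

/-! ### Series of functions that are dominated up to finitely many terms -/

/-! Write `h = ∂f/∂t` at fixed `z`. Differentiating `f(z + 1, t) = f(z, t)` and `f(z + ω₂(t), t) =
f(z, t)` in `t` gives `h(z + 1) = h(z)` and `h(z + ω₂) = h(z) - ω₂' f'(z)`. Hence `h / f'` has
increments `0` and `-ω₂'` along the periods. At `a_k` it has at most a simple pole with residue
`h(a_k) / f''(a_k)`, which is `γ_k`, because `f'(a_k) = 0` makes `A_k' = h(a_k)`. At the origin `h`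
has a pole of order at most `n` and `f'` one of order `n + 1`, so the quotient vanishes there.

The function `S(z) = ∑ γ_k (ζ(z - a_k) + ζ(a_k)) - η₁ z ∑ γ_k` (`zetSum`) has the same polar parts,
vanishes at the origin and has period `1`. The difference `h / f' - S` extends to an entire function
with constant increments, which is affine; vanishing at `0` and having period `1`, it is zero. The
whole system is read off from `h = f' S` (`eq_deriv_mul_zetSum`). Legendre's relation (`legendre`)
turns the increment along `ω₂` into the equation for `ω₂'`. Differentiating `f'(a_l(t), t) = 0`
gives `a_l' = -h'(a_l) / f''(a_l)`, and `h'(a_l)` comes from expanding `f' S` at `a_l`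
(`deriv_variation_eq`). The leading coefficient of `f' S` at the origin (`leading_coeff_eq`) is the
`t`-derivative of the leading coefficient of `f`; up to the factor `-n / ∏ σ(-a_k)` the latter is
`c`, and logarithmic differentiation gives the equation for `c`.

Three further ingredients are needed. The product formula for `f'` (`deriv_eq_prod_sig`) is
Liouville's theorem for the quotient of its two sides. The formula for `∂ ln σ / ∂ω₂`
(`dtau_eq_dLnSigma₂`) is proved in the same spirit: adding a suitable combination of `℘`, `ζ²`, `η₁
z ζ` cancels all poles and leaves an entire function with affine increments, hence a quadratic
polynomial, fixed by its Taylor expansion at `0`. Finally `f` is only `C¹` and `ω₂`, `a_k` only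
continuous; Cauchy integrals make `h` holomorphic in `z` and `f'` differentiable in `(z, t)`, and a
continuous simple root of a differentiable function is differentiable
(`hasDerivAt_of_hasFDerivAt_root`). -/

theorem hasSum_ite_mem_finset {ι E : Type*} [DecidableEq ι] [AddCommMonoid E]
    [TopologicalSpace E] (F : Finset ι) (f : ι → E) :
    HasSum (fun i => if i ∈ F then f i else 0) (∑ i ∈ F, f i) := by
  have h : HasSum (fun i => if i ∈ F then f i else 0) (∑ i ∈ F, if i ∈ F then f i else 0) :=
    hasSum_sum_of_ne_finset_zero fun i hi => by simp [hi]
  rwa [Finset.sum_congr rfl fun i hi => if_pos hi] at h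

/-- The terms in `F` may be singular on `U` and only have to be differentiable at `z`; the others
satisfy the Weierstrass M-test on `U`, so their sum may be differentiated termwise. -/
theorem Complex.differentiableAt_tsum_of_finset {ι : Type*} {f : ι → ℂ → ℂ} {U : Set ℂ}
    (hU : IsOpen U) (F : Finset ι) {u : ι → ℝ} (hu : Summable u)
    (hb : ∀ i ∉ F, ∀ w ∈ U, ‖f i w‖ ≤ u i) (hd : ∀ i ∉ F, DifferentiableOn ℂ (f i) U)
    {z : ℂ} (hz : z ∈ U) (hF : ∀ i ∈ F, DifferentiableAt ℂ (f i) z) :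
    DifferentiableAt ℂ (fun w => ∑' i, f i w) z ∧
      HasSum (fun i => deriv (f i) z) (deriv (fun w => ∑' i, f i w) z) := by
  classical
  set g : ι → ℂ → ℂ := fun i => if i ∈ F then 0 else f i with hg
  have hu0 : ∀ i ∉ F, 0 ≤ u i := fun i hi => (norm_nonneg _).trans (hb i hi z hz)
  set v : ι → ℝ := fun i => if i ∈ F then 0 else u i with hv
  have hvs : Summable v := by
    refine (summable_congr_cofinite ?_).mpr hu
    filter_upwards [F.finite_toSet.compl_mem_cofinite] with i hi
    have : i ∉ F := by simpa using hi
    simp [hv, this]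
  have hgb : ∀ i, ∀ w ∈ U, ‖g i w‖ ≤ v i := by
    intro i w hw
    by_cases hi : i ∈ F
    · simp [hg, hv, hi]
    · simpa [hg, hv, hi] using hb i hi w hw
  have hgd : ∀ i, DifferentiableOn ℂ (g i) U := by
    intro i
    by_cases hi : i ∈ F
    · simp [hg, hi]
    · simpa [hg, hi] using hd i hi
  have hsum : ∀ w ∈ U, ∑' i, f i w = ∑ i ∈ F, f i w + ∑' i, g i w := by
    intro w hw
    have h1 : HasSum (fun i => g i w) (∑' i, g i w) :=
      (Summable.of_norm_bounded hvs fun i => hgb i w hw).hasSum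
    have h2 := hasSum_ite_mem_finset F fun i => f i w
    refine ((h2.add h1).congr_fun ?_).tsum_eq
    intro i
    by_cases hi : i ∈ F <;> simp [hg, hi]
  have hev : (fun w => ∑' i, f i w) =ᶠ[𝓝 z] fun w => ∑ i ∈ F, f i w + ∑' i, g i w :=
    Filter.eventually_of_mem (hU.mem_nhds hz) hsum
  have hdF : DifferentiableAt ℂ (fun w => ∑ i ∈ F, f i w) z :=
    DifferentiableAt.fun_sum fun i hi => hF i hi
  have hdg : DifferentiableAt ℂ (fun w => ∑' i, g i w) z :=
    (differentiableOn_tsum_of_summable_norm hvs hgd hU hgb).differentiableAt (hU.mem_nhds hz)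
  refine ⟨(hdF.add hdg).congr_of_eventuallyEq hev, ?_⟩
  rw [hev.deriv_eq, deriv_fun_add hdF hdg, deriv_fun_sum fun i hi => hF i hi]
  have h1 := hasSum_deriv_of_summable_norm hvs hgd hU hgb hz
  have h2 := hasSum_ite_mem_finset F fun i => deriv (f i) z
  refine (h2.add h1).congr_fun ?_
  intro i
  by_cases hi : i ∈ F <;> simp [hg, hi]

/-! ### Logarithmic derivatives of products -/

/-- Writing a differential as `f x • L` makes `L` a logarithmic differential without dividing by `f
x`, so additivity under products needs no nonvanishing. -/
theorem HasFDerivAt.mul_smul_self {E : Type*} [NormedAddCommGroup E] [NormedSpace ℂ E]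
    {f g : E → ℂ} {L M : E →L[ℂ] ℂ} {x : E} (hf : HasFDerivAt f (f x • L) x)
    (hg : HasFDerivAt g (g x • M) x) :
    HasFDerivAt (fun y => f y * g y) ((f x * g x) • (L + M)) x := by
  refine (hf.mul hg).congr_fderiv ?_
  ext v
  simp
  ring

theorem HasFDerivAt.prod_smul_self {E ι : Type*} [NormedAddCommGroup E] [NormedSpace ℂ E]
    {f : ι → E → ℂ} {L : ι → E →L[ℂ] ℂ} {x : E} (F : Finset ι)
    (hf : ∀ i ∈ F, HasFDerivAt (f i) (f i x • L i) x) :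
    HasFDerivAt (fun y => ∏ i ∈ F, f i y) ((∏ i ∈ F, f i x) • ∑ i ∈ F, L i) x := by
  classical
  induction F using Finset.induction_on with
  | empty => simpa using hasFDerivAt_const (1 : ℂ) x
  | insert a s ha ih =>
    simp only [Finset.prod_insert ha, Finset.sum_insert ha]
    exact (hf a (by simp)).mul_smul_self (ih fun i hi => hf i (by simp [hi]))

/-! ### Series and products over `ℤ + ℤ τ`, indexed by `ℤ × ℤ`. -/

namespace WeierstrassTau

/-- The period `m + n τ`. -/
noncomputable def per (τ : ℂ) (p : ℤ × ℤ) : ℂ := p.1 + p.2 * τ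

/-- The term of the series of `ζ`. -/
noncomputable def zetTerm (z τ : ℂ) (p : ℤ × ℤ) : ℂ :=
  1 / (z - per τ p) + 1 / per τ p + z / per τ p ^ 2

/-- The term of the series of `∂ ln σ / ∂ τ`. -/
noncomputable def dtauTerm (z τ : ℂ) (p : ℤ × ℤ) : ℂ :=
  p.2 * z ^ 3 / (per τ p ^ 3 * (per τ p - z))

/-- The factor of the product of `σ`. -/
noncomputable def sigFactor (z τ : ℂ) (p : ℤ × ℤ) : ℂ :=
  (1 - z / per τ p) * exp (z / per τ p + z ^ 2 / (2 * per τ p ^ 2))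

/-- The product in the definition of `σ`, that is, `σ(z) / z`. -/
noncomputable def sigDiv (z τ : ℂ) : ℂ := ∏' p, sigFactor z τ p

/-- The Weierstrass `σ`-function of `ℤ + ℤ τ`. -/
noncomputable def sig (z τ : ℂ) : ℂ := z * sigDiv z τ

/-- The Weierstrass `ζ`-function of `ℤ + ℤ τ`. -/
noncomputable def zet (z τ : ℂ) : ℂ := ∑' p, zetTerm z τ p

/-- The logarithmic derivative of `σ` in `τ`. -/
noncomputable def dtau (z τ : ℂ) : ℂ := ∑' p, dtauTerm z τ p

/-- A logarithm of the factor of `σ`. -/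
noncomputable def logTerm (z τ : ℂ) (p : ℤ × ℤ) : ℂ :=
  log (1 - z / per τ p) + z / per τ p + (z / per τ p) ^ 2 / 2

@[simp] theorem per_zero (τ : ℂ) : per τ 0 = 0 := by simp [per]

theorem per_add (τ : ℂ) (p q : ℤ × ℤ) : per τ (p + q) = per τ p + per τ q := by
  simp [per]; ring

theorem per_neg (τ : ℂ) (p : ℤ × ℤ) : per τ (-p) = -per τ p := by
  simp [per]; ring

theorem abs_snd_mul_im_le {τ : ℂ} (hτ : 0 < τ.im) (p : ℤ × ℤ) : ‖(p.2 : ℂ)‖ * τ.im ≤ ‖per τ p‖ := by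
  have h := abs_im_le_norm (per τ p)
  have : (per τ p).im = p.2 * τ.im := by simp [per]
  rw [this, abs_mul, abs_of_pos hτ] at h
  simpa using h

/-- As `|n| Im τ₀ ≤ |m + n τ₀|`, moving `τ₀` by less than half its imaginary part moves a period by
at most half its length. This makes all estimates locally uniform in `τ`. -/
theorem norm_per_le {τ τ₀ : ℂ} (hτ₀ : 0 < τ₀.im) (h : ‖τ - τ₀‖ < τ₀.im / 2) (p : ℤ × ℤ) :
    ‖per τ₀ p‖ ≤ 2 * ‖per τ p‖ := by
  have h1 := abs_snd_mul_im_le hτ₀ p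
  have h2 : per τ₀ p = per τ p - p.2 * (τ - τ₀) := by simp [per]; ring
  have h3 : ‖per τ₀ p‖ ≤ ‖per τ p‖ + ‖(p.2 : ℂ)‖ * ‖τ - τ₀‖ := by
    rw [h2]
    exact (norm_sub_le _ _).trans (by rw [norm_mul])
  nlinarith [norm_nonneg (p.2 : ℂ), norm_nonneg (τ - τ₀)]

theorem im_pos_of_norm_sub_lt {τ τ₀ : ℂ} (h : ‖τ - τ₀‖ < τ₀.im / 2) : 0 < τ.im := by
  have h1 := abs_im_le_norm (τ - τ₀)
  have h2 := norm_nonneg (τ - τ₀)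
  rw [sub_im, abs_le] at h1
  linarith [h1.1]

theorem half_im_le {τ τ₀ : ℂ} (h : ‖τ - τ₀‖ < τ₀.im / 2) : τ₀.im / 2 ≤ τ.im := by
  have h1 := abs_im_le_norm (τ - τ₀)
  rw [sub_im, abs_le] at h1
  linarith [h1.1]

theorem mem_lattice_iff (τ : ℍ) (z : ℂ) :
    z ∈ (PeriodPair.ofTau τ).lattice ↔ ∃ p, per τ p = z := by
  rw [PeriodPair.mem_lattice]
  constructor
  · rintro ⟨m, n, h⟩
    exact ⟨(m, n), by simpa [PeriodPair.ofTau, per] using h⟩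
  · rintro ⟨p, h⟩
    exact ⟨p.1, p.2, by simpa [PeriodPair.ofTau, per] using h⟩

theorem coe_latticeEquivProd_symm (τ : ℍ) (p : ℤ × ℤ) :
    (((PeriodPair.ofTau τ).latticeEquivProd.symm p : (PeriodPair.ofTau τ).lattice) : ℂ) =
      per τ p := by
  rw [PeriodPair.latticeEquiv_symm_apply]
  simp [PeriodPair.ofTau, per]

theorem per_eq_zero_iff {τ : ℂ} (hτ : 0 < τ.im) (p : ℤ × ℤ) : per τ p = 0 ↔ p = 0 := by
  have := coe_latticeEquivProd_symm ⟨τ, hτ⟩ p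
  change _ = per τ p at this
  rw [← this]
  simp

theorem summable_norm_per {τ : ℂ} (hτ : 0 < τ.im) : Summable fun p => (‖per τ p‖ ^ 3)⁻¹ := by
  have h := ZLattice.summable_norm_pow_inv (PeriodPair.ofTau ⟨τ, hτ⟩).lattice 3 (by simp)
  rw [← (PeriodPair.ofTau ⟨τ, hτ⟩).latticeEquivProd.symm.toEquiv.summable_iff] at h
  refine h.congr fun p => ?_
  have := coe_latticeEquivProd_symm ⟨τ, hτ⟩ p
  change _ = per τ p at this
  simp [← this]

/-- Summability of `|ω|⁻³` leaves only finitely many periods of `τ₀` of length at most `4R`; the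
factor lost to `2R` pays for varying `τ`. The index `0` is put into `F` because its terms are
degenerate. -/
theorem exists_finset_norm_per {τ₀ : ℂ} (hτ₀ : 0 < τ₀.im) (R : ℝ) (hR : 0 < R) :
    ∃ F : Finset (ℤ × ℤ), 0 ∈ F ∧ ∀ p ∉ F, ∀ τ, ‖τ - τ₀‖ < τ₀.im / 2 → 2 * R ≤ ‖per τ p‖ := by
  have h := (summable_norm_per hτ₀).tendsto_cofinite_zero
  have h2 : ∀ᶠ p in cofinite, (‖per τ₀ p‖ ^ 3)⁻¹ < ((4 * R) ^ 3)⁻¹ :=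
    h.eventually (gt_mem_nhds (by positivity))
  have hf : {p | ¬ (‖per τ₀ p‖ ^ 3)⁻¹ < ((4 * R) ^ 3)⁻¹}.Finite := h2
  refine ⟨insert 0 hf.toFinset, by simp, fun p hp τ hτ => ?_⟩
  simp only [Finset.mem_insert, Set.Finite.mem_toFinset, mem_ofPred_eq, not_or, not_not] at hp
  have hp0 : 0 < ‖per τ₀ p‖ := by
    rw [norm_pos_iff, Ne, per_eq_zero_iff hτ₀]; exact hp.1
  have h3 : (4 * R) ^ 3 < ‖per τ₀ p‖ ^ 3 := (inv_lt_inv₀ (by positivity) (by positivity)).mp hp.2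
  have h4 : 4 * R < ‖per τ₀ p‖ := lt_of_pow_lt_pow_left₀ 3 hp0.le h3
  linarith [norm_per_le hτ₀ hτ p]

/-! ### Bounds for the terms -/

theorem zetTerm_eq {z τ : ℂ} {p : ℤ × ℤ} (h0 : per τ p ≠ 0) (h : z ≠ per τ p) :
    zetTerm z τ p = z ^ 2 / (per τ p ^ 2 * (z - per τ p)) := by
  have : z - per τ p ≠ 0 := sub_ne_zero.mpr h
  unfold zetTerm
  field_simp
  ring

theorem norm_zetTerm_le {z τ : ℂ} {p : ℤ × ℤ} {R : ℝ} (hz : ‖z‖ ≤ R) (hR : 0 < R)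
    (h : 2 * R ≤ ‖per τ p‖) : ‖zetTerm z τ p‖ ≤ 2 * R ^ 2 * (‖per τ p‖ ^ 3)⁻¹ := by
  have hp : 0 < ‖per τ p‖ := by linarith
  have h0 : per τ p ≠ 0 := norm_pos_iff.mp hp
  have h1 : ‖per τ p‖ / 2 ≤ ‖z - per τ p‖ := by
    rw [norm_sub_rev]
    linarith [norm_sub_norm_le (per τ p) z]
  have hne : z ≠ per τ p := by
    rintro rfl; linarith
  rw [zetTerm_eq h0 hne, norm_div, norm_mul, norm_pow, norm_pow]
  calc ‖z‖ ^ 2 / (‖per τ p‖ ^ 2 * ‖z - per τ p‖)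
      ≤ R ^ 2 / (‖per τ p‖ ^ 2 * (‖per τ p‖ / 2)) := by gcongr
    _ = _ := by field_simp

/-- The numerator `p.2` costs one power of the period by `abs_snd_mul_im_le`; against the
fourth-order denominator this still leaves the summable `|ω|⁻³`. -/
theorem norm_dtauTerm_le {z τ : ℂ} (hτ : 0 < τ.im) {p : ℤ × ℤ} {R : ℝ} (hz : ‖z‖ ≤ R) (hR : 0 < R)
    (h : 2 * R ≤ ‖per τ p‖) : ‖dtauTerm z τ p‖ ≤ 2 * R ^ 3 / τ.im * (‖per τ p‖ ^ 3)⁻¹ := by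
  have hp : 0 < ‖per τ p‖ := by linarith
  have h0 : per τ p ≠ 0 := norm_pos_iff.mp hp
  have h1 : ‖per τ p‖ / 2 ≤ ‖per τ p - z‖ := by
    linarith [norm_sub_norm_le (per τ p) z]
  have h2 : ‖(p.2 : ℂ)‖ ≤ ‖per τ p‖ / τ.im := by
    rw [le_div_iff₀ hτ]; exact abs_snd_mul_im_le hτ p
  rw [dtauTerm, norm_div, norm_mul, norm_mul, norm_pow, norm_pow]
  calc ‖(p.2 : ℂ)‖ * ‖z‖ ^ 3 / (‖per τ p‖ ^ 3 * ‖per τ p - z‖)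
      ≤ (‖per τ p‖ / τ.im) * R ^ 3 / (‖per τ p‖ ^ 3 * (‖per τ p‖ / 2)) := by gcongr
    _ = _ := by field_simp

end WeierstrassTau

/-! ### Joint differentiability of `σ` in `(z, τ)`, and its zeros. -/

namespace WeierstrassTau

/-- The differential of the logarithm of a factor of `σ` in `(z, τ)`. -/
noncomputable def dTerm (q : ℂ × ℂ) (p : ℤ × ℤ) : ℂ × ℂ →L[ℂ] ℂ :=
  zetTerm q.1 q.2 p • ContinuousLinearMap.fst ℂ ℂ ℂ +
    dtauTerm q.1 q.2 p • ContinuousLinearMap.snd ℂ ℂ ℂ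

theorem hasFDerivAt_per (p : ℤ × ℤ) (q : ℂ × ℂ) :
    HasFDerivAt (fun q : ℂ × ℂ => per q.2 p) ((p.2 : ℂ) • ContinuousLinearMap.snd ℂ ℂ ℂ) q := by
  unfold per
  exact (hasFDerivAt_snd.const_mul _).const_add _

theorem hasFDerivAt_div_per (p : ℤ × ℤ) (q : ℂ × ℂ) (h0 : per q.2 p ≠ 0) :
    HasFDerivAt (fun q : ℂ × ℂ => q.1 / per q.2 p)
      ((1 / per q.2 p) • ContinuousLinearMap.fst ℂ ℂ ℂ -
        (q.1 * p.2 / per q.2 p ^ 2) • ContinuousLinearMap.snd ℂ ℂ ℂ) q := by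
  have h1 := (hasDerivAt_inv h0).comp_hasFDerivAt q (hasFDerivAt_per p q)
  simp only [div_eq_mul_inv]
  refine ((hasFDerivAt_fst (p := q)).mul h1).congr_fderiv ?_
  ext
  · simp
  · simp
    field_simp

theorem dTerm_eq (q : ℂ × ℂ) (p : ℤ × ℤ) (h0 : per q.2 p ≠ 0) (h : q.1 ≠ per q.2 p) :
    dTerm q p = (-((q.1 / per q.2 p) ^ 2 / (1 - q.1 / per q.2 p))) •
      ((1 / per q.2 p) • ContinuousLinearMap.fst ℂ ℂ ℂ -
        (q.1 * p.2 / per q.2 p ^ 2) • ContinuousLinearMap.snd ℂ ℂ ℂ) := by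
  have h1 : per q.2 p - q.1 ≠ 0 := sub_ne_zero.mpr h.symm
  have h2 : q.1 - per q.2 p ≠ 0 := sub_ne_zero.mpr h
  have h3 : 1 - q.1 / per q.2 p ≠ 0 := by
    rw [one_sub_div h0]; exact div_ne_zero h1 h0
  have h4 : q.1 - per q.2 p = -(per q.2 p - q.1) := by ring
  ext
  · simp [dTerm, zetTerm_eq h0 h]
    rw [one_sub_div h0, h4]
    field_simp
  · simp [dTerm, dtauTerm]
    rw [one_sub_div h0]
    field_simp

/-- Each factor is the primary factor `E(u) = (1 - u) exp(u + u²/2)` at `u = z/ω`, with `E'/E =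
-u²/(1 - u)`; the chain rule does the rest. -/
theorem hasFDerivAt_sigFactor (p : ℤ × ℤ) (q : ℂ × ℂ) (h0 : per q.2 p ≠ 0) (h : q.1 ≠ per q.2 p) :
    HasFDerivAt (fun q : ℂ × ℂ => sigFactor q.1 q.2 p) (sigFactor q.1 q.2 p • dTerm q p) q := by
  have h1 : per q.2 p - q.1 ≠ 0 := sub_ne_zero.mpr h.symm
  have h3 : 1 - q.1 / per q.2 p ≠ 0 := by
    rw [one_sub_div h0]; exact div_ne_zero h1 h0
  set u := q.1 / per q.2 p with hu
  have hE : HasDerivAt (fun u : ℂ => (1 - u) * exp (u + u ^ 2 / 2))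
      ((1 - u) * exp (u + u ^ 2 / 2) * -(u ^ 2 / (1 - u))) u := by
    have h1 : HasDerivAt (fun u : ℂ => u + u ^ 2 / 2) (1 + u) u := by
      convert! (hasDerivAt_id u).add ((hasDerivAt_pow 2 u).div_const 2) using 1
      simp
    convert! ((hasDerivAt_id u).const_sub 1).mul h1.cexp using 1
    simp
    field_simp
    ring
  have := hE.comp_hasFDerivAt q (hasFDerivAt_div_per p q h0)
  rw [dTerm_eq q p h0 h, smul_smul]
  refine (this.congr_of_eventuallyEq ?_).congr_fderiv ?_
  · refine .of_forall fun y => ?_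
    simp only [sigFactor, Function.comp_apply]
    ring_nf
  · simp only [sigFactor, ← hu]
    congr 3
    rw [hu]; ring_nf

theorem differentiableAt_sigFactor (p : ℤ × ℤ) (q : ℂ × ℂ) (h0 : p ≠ 0 → per q.2 p ≠ 0) :
    DifferentiableAt ℂ (fun q : ℂ × ℂ => sigFactor q.1 q.2 p) q := by
  by_cases hp : p = 0
  · subst hp; simp [sigFactor]
  have h1 := (hasFDerivAt_div_per p q (h0 hp)).differentiableAt
  have : (fun q : ℂ × ℂ => sigFactor q.1 q.2 p) =
      fun q => (1 - q.1 / per q.2 p) * exp (q.1 / per q.2 p + (q.1 / per q.2 p) ^ 2 / 2) := by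
    ext y; simp only [sigFactor]; ring_nf
  rw [this]
  fun_prop

theorem hasFDerivAt_logTerm (p : ℤ × ℤ) (q : ℂ × ℂ) (h0 : per q.2 p ≠ 0)
    (h : ‖q.1 / per q.2 p‖ < 1) :
    HasFDerivAt (fun q : ℂ × ℂ => logTerm q.1 q.2 p) (dTerm q p) q := by
  set u := q.1 / per q.2 p with hu
  have h3 : 1 - u ≠ 0 := by
    rw [sub_ne_zero]; rintro h'; rw [← h'] at h; simp at h
  have hne : q.1 ≠ per q.2 p := by
    intro h'; apply h3; rw [hu, h', div_self h0, sub_self]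
  have hs : 1 - u ∈ slitPlane := by
    rw [sub_eq_add_neg]
    exact mem_slitPlane_of_norm_lt_one (by simpa using h)
  have hE : HasDerivAt (fun u : ℂ => log (1 - u) + u + u ^ 2 / 2) (-(u ^ 2 / (1 - u))) u := by
    convert! ((((hasDerivAt_id u).const_sub 1).clog hs).add (hasDerivAt_id u)).add
      ((hasDerivAt_pow 2 u).div_const 2) using 1
    simp
    field_simp
    ring
  rw [dTerm_eq q p h0 hne]
  exact hE.comp_hasFDerivAt q (hasFDerivAt_div_per p q h0)

theorem exp_logTerm (p : ℤ × ℤ) (z τ : ℂ) (h : ‖z / per τ p‖ < 1) :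
    exp (logTerm z τ p) = sigFactor z τ p := by
  have h3 : 1 - z / per τ p ≠ 0 := by
    rw [sub_ne_zero]; rintro h'; rw [← h'] at h; simp at h
  rw [logTerm, add_assoc, exp_add, exp_log h3, sigFactor]
  ring_nf

theorem norm_dTerm_le {q : ℂ × ℂ} {τ₀ : ℂ} (hτ₀ : 0 < τ₀.im) {p : ℤ × ℤ} {R : ℝ}
    (hz : ‖q.1‖ ≤ R) (hR : 0 < R) (hτ : ‖q.2 - τ₀‖ < τ₀.im / 2) (h : 2 * R ≤ ‖per q.2 p‖)
    (hp : p ≠ 0) :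
    ‖dTerm q p‖ ≤ (2 * R ^ 2 + 2 * R ^ 3 / (τ₀.im / 2)) * 8 * (‖per τ₀ p‖ ^ 3)⁻¹ := by
  have hi := im_pos_of_norm_sub_lt hτ
  have h1 := norm_zetTerm_le hz hR h
  have h2 := norm_dtauTerm_le hi hz hR h
  have h3 : (‖per q.2 p‖ ^ 3)⁻¹ ≤ 8 * (‖per τ₀ p‖ ^ 3)⁻¹ := by
    have h4 := norm_per_le hτ₀ hτ p
    have h5 : 0 < ‖per τ₀ p‖ := by
      rw [norm_pos_iff, Ne, per_eq_zero_iff hτ₀]; exact hp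
    calc (‖per q.2 p‖ ^ 3)⁻¹ ≤ ((‖per τ₀ p‖ / 2) ^ 3)⁻¹ := by
          gcongr; linarith
      _ = _ := by field_simp; norm_num
  have h6 : 2 * R ^ 3 / q.2.im ≤ 2 * R ^ 3 / (τ₀.im / 2) := by
    gcongr; exact half_im_le hτ
  have hfst : ‖ContinuousLinearMap.fst ℂ ℂ ℂ‖ ≤ 1 := ContinuousLinearMap.norm_fst_le ..
  have hsnd : ‖ContinuousLinearMap.snd ℂ ℂ ℂ‖ ≤ 1 := ContinuousLinearMap.norm_snd_le ..
  calc ‖dTerm q p‖ ≤ ‖zetTerm q.1 q.2 p‖ * 1 + ‖dtauTerm q.1 q.2 p‖ * 1 := by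
        refine (norm_add_le _ _).trans ?_
        rw [norm_smul, norm_smul]
        gcongr
    _ ≤ 2 * R ^ 2 * (‖per q.2 p‖ ^ 3)⁻¹ + 2 * R ^ 3 / (τ₀.im / 2) * (‖per q.2 p‖ ^ 3)⁻¹ := by
        rw [mul_one, mul_one]
        refine add_le_add h1 (h2.trans ?_)
        gcongr
    _ = (2 * R ^ 2 + 2 * R ^ 3 / (τ₀.im / 2)) * (‖per q.2 p‖ ^ 3)⁻¹ := by ring
    _ ≤ (2 * R ^ 2 + 2 * R ^ 3 / (τ₀.im / 2)) * (8 * (‖per τ₀ p‖ ^ 3)⁻¹) := by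
        gcongr
    _ = _ := by ring

/-- Near a point, `σ` is a finite product times the exponential of a holomorphic function. -/
theorem exists_sig_eq {τ₀ : ℂ} (hτ₀ : 0 < τ₀.im) {R : ℝ} (hR : 0 < R) :
    ∃ F : Finset (ℤ × ℤ), ∃ T : ℂ × ℂ → ℂ, ∃ T' : ℂ × ℂ → (ℂ × ℂ →L[ℂ] ℂ), 0 ∈ F ∧
      (∀ p ∉ F, ∀ τ, ‖τ - τ₀‖ < τ₀.im / 2 → 2 * R ≤ ‖per τ p‖) ∧
      ∀ q : ℂ × ℂ, ‖q.1‖ < R → ‖q.2 - τ₀‖ < τ₀.im / 2 →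
        HasFDerivAt T (T' q) q ∧ HasSum (fun p => if p ∈ F then 0 else dTerm q p) (T' q) ∧
        sigDiv q.1 q.2 = (∏ p ∈ F, sigFactor q.1 q.2 p) * exp (T q) := by
  obtain ⟨F, h0F, hF⟩ := exists_finset_norm_per hτ₀ R hR
  set U : Set (ℂ × ℂ) := Metric.ball 0 R ×ˢ Metric.ball τ₀ (τ₀.im / 2) with hU
  have hmem : ∀ q : ℂ × ℂ, q ∈ U ↔ ‖q.1‖ < R ∧ ‖q.2 - τ₀‖ < τ₀.im / 2 := by
    intro q; simp [hU, dist_eq_norm]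
  have hUo : IsOpen U := Metric.isOpen_ball.prod Metric.isOpen_ball
  have hUc : IsPreconnected U :=
    ((convex_ball _ _).prod (convex_ball _ _)).isPreconnected
  set f : ℤ × ℤ → ℂ × ℂ → ℂ := fun p q => if p ∈ F then 0 else logTerm q.1 q.2 p with hf
  set f' : ℤ × ℤ → ℂ × ℂ → (ℂ × ℂ →L[ℂ] ℂ) := fun p q => if p ∈ F then 0 else dTerm q p with hf'
  have hdiv : ∀ p ∉ F, ∀ q ∈ U, per q.2 p ≠ 0 ∧ ‖q.1 / per q.2 p‖ < 1 := by
    intro p hp q hq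
    rw [hmem] at hq
    have h1 := hF p hp q.2 hq.2
    have h2 : 0 < ‖per q.2 p‖ := by linarith
    refine ⟨norm_pos_iff.mp h2, ?_⟩
    rw [norm_div, div_lt_one h2]
    linarith
  have hd : ∀ p, ∀ q ∈ U, HasFDerivAt (f p) (f' p q) q := by
    intro p q hq
    by_cases hp : p ∈ F
    · simpa [hf, hf', hp] using! hasFDerivAt_const (0 : ℂ) q
    · simpa [hf, hf', hp] using! hasFDerivAt_logTerm p q (hdiv p hp q hq).1 (hdiv p hp q hq).2
  set u : ℤ × ℤ → ℝ :=
    fun p => (2 * R ^ 2 + 2 * R ^ 3 / (τ₀.im / 2)) * 8 * (‖per τ₀ p‖ ^ 3)⁻¹ with hu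
  have hus : Summable u := (summable_norm_per hτ₀).mul_left _
  have hb : ∀ p, ∀ q ∈ U, ‖f' p q‖ ≤ u p := by
    intro p q hq
    by_cases hp : p ∈ F
    · simp only [hf', hp, if_true, norm_zero, hu]; positivity
    · simp only [hf', hp, if_false]
      rw [hmem] at hq
      exact norm_dTerm_le hτ₀ hq.1.le hR hq.2 (hF p hp q.2 hq.2) (by rintro rfl; exact hp h0F)
  -- The differentials are summably bounded on the connected set `U`, so convergence of the
  -- logarithms at one point suffices; at `z = 0` they all vanish.
  have hbase : ((0, τ₀) : ℂ × ℂ) ∈ U := by rw [hmem]; simp [hR, hτ₀]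
  have hs0 : Summable fun p => f p (0, τ₀) := by
    refine summable_zero.congr fun p => ?_
    simp [hf, logTerm]
  refine ⟨F, fun q => ∑' p, f p q, fun q => ∑' p, f' p q, h0F, hF, fun q hq1 hq2 => ?_⟩
  have hq : q ∈ U := (hmem q).mpr ⟨hq1, hq2⟩
  refine ⟨hasFDerivAt_tsum_of_isPreconnected hus hUo hUc hd hb hbase hs0 hq, ?_, ?_⟩
  · exact (Summable.of_norm_bounded hus fun p => hb p q hq).hasSum
  · have h1 : Summable fun p => f p q :=
      summable_of_summable_hasFDerivAt_of_isPreconnected hus hUo hUc hd hb hbase hs0 hq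
    have h2 := h1.hasSum.cexp
    have h3 : HasProd (fun p => if p ∈ F then sigFactor q.1 q.2 p else 1)
        (∏ p ∈ F, if p ∈ F then sigFactor q.1 q.2 p else 1) :=
      hasProd_prod_of_ne_finset_one fun p hp => by simp [hp]
    rw [Finset.prod_congr rfl fun p hp => if_pos hp] at h3
    rw [sigDiv, ((h3.mul h2).congr_fun fun p => ?_).tprod_eq]
    by_cases hp : p ∈ F
    · simp [hf, hp]
    · simp [hf, hp, exp_logTerm p q.1 q.2 (hdiv p hp q hq).2]

theorem exists_radius (z : ℂ) : ∃ R : ℝ, 0 < R ∧ ‖z‖ < R :=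
  ⟨‖z‖ + 1, by positivity, by linarith⟩

theorem differentiableAt_sigDiv {q : ℂ × ℂ} (hq : 0 < q.2.im) :
    DifferentiableAt ℂ (fun q : ℂ × ℂ => sigDiv q.1 q.2) q := by
  obtain ⟨R, hR, hzR⟩ := exists_radius q.1
  obtain ⟨F, T, T', h0F, hF, h⟩ := exists_sig_eq hq hR
  have hev : (fun q : ℂ × ℂ => sigDiv q.1 q.2) =ᶠ[𝓝 q]
      fun q => (∏ p ∈ F, sigFactor q.1 q.2 p) * exp (T q) := by
    have h1 : ∀ᶠ y : ℂ × ℂ in 𝓝 q, ‖y.1‖ < R :=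
      (continuous_fst.norm.continuousAt (x := q)).eventually (gt_mem_nhds hzR)
    have h2 : ∀ᶠ y : ℂ × ℂ in 𝓝 q, ‖y.2 - q.2‖ < q.2.im / 2 :=
      ((continuous_snd.sub continuous_const).norm.continuousAt (x := q)).eventually
        (gt_mem_nhds (by simpa using hq))
    filter_upwards [h1, h2] with y hy1 hy2 using (h y hy1 hy2).2.2
  refine DifferentiableAt.congr_of_eventuallyEq ?_ hev
  have hT := (h q hzR (by simpa using hq)).1.differentiableAt
  have hP : DifferentiableAt ℂ (fun q : ℂ × ℂ => ∏ p ∈ F, sigFactor q.1 q.2 p) q := by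
    classical
    exact
    (HasFDerivAt.finsetProd fun p _ => (differentiableAt_sigFactor p q
      (by rw [Ne, Ne, per_eq_zero_iff hq]; exact id)).hasFDerivAt).differentiableAt
  fun_prop

theorem differentiableAt_sig {q : ℂ × ℂ} (hq : 0 < q.2.im) :
    DifferentiableAt ℂ (fun q : ℂ × ℂ => sig q.1 q.2) q :=
  differentiableAt_fst.mul (differentiableAt_sigDiv hq)

/-- In the local factorisation the exponential never vanishes, so zeros come from `z` and the finite
product. A nonzero period equal to `z` has its index in `F`, since those outside have length at
least `2R`. -/
theorem sig_eq_zero_iff {z τ : ℂ} (hτ : 0 < τ.im) : sig z τ = 0 ↔ ∃ p, per τ p = z := by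
  obtain ⟨R, hR, hzR⟩ := exists_radius z
  obtain ⟨F, T, T', h0F, hF, h⟩ := exists_sig_eq hτ hR
  have h1 := (h (z, τ) hzR (by simpa using hτ)).2.2
  simp only at h1
  rw [sig, h1, ← mul_assoc]
  simp only [mul_eq_zero, exp_ne_zero, or_false, Finset.prod_eq_zero_iff, sigFactor]
  constructor
  · rintro (h | ⟨p, hp, h⟩)
    · exact ⟨0, by simp [h]⟩
    · refine ⟨p, ?_⟩
      have h0 : per τ p ≠ 0 := by
        intro h0; simp [h0] at h
      rw [sub_eq_zero, eq_div_iff h0] at h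
      simpa using h
  · rintro ⟨p, rfl⟩
    by_cases hp : p = 0
    · left; simp [hp]
    · right
      have h0 : per τ p ≠ 0 := by rwa [Ne, per_eq_zero_iff hτ]
      refine ⟨p, ?_, by rw [div_self h0, sub_self]⟩
      by_contra hpF
      have := hF p hpF τ (by simpa using hτ)
      linarith

theorem hasSum_dTerm_and_hasFDerivAt_sig {q : ℂ × ℂ} (hq : 0 < q.2.im)
    (hz : ∀ p, per q.2 p ≠ q.1) :
    ∃ D, HasSum (dTerm q) D ∧ HasFDerivAt (fun q : ℂ × ℂ => sig q.1 q.2) (sig q.1 q.2 • D) q := by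
  obtain ⟨R, hR, hzR⟩ := exists_radius q.1
  obtain ⟨F, T, T', h0F, hF, h⟩ := exists_sig_eq hq hR
  have hev : (fun q : ℂ × ℂ => sig q.1 q.2) =ᶠ[𝓝 q]
      fun q => q.1 * (∏ p ∈ F, sigFactor q.1 q.2 p) * exp (T q) := by
    have h1 : ∀ᶠ y : ℂ × ℂ in 𝓝 q, ‖y.1‖ < R :=
      (continuous_fst.norm.continuousAt (x := q)).eventually (gt_mem_nhds hzR)
    have h2 : ∀ᶠ y : ℂ × ℂ in 𝓝 q, ‖y.2 - q.2‖ < q.2.im / 2 :=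
      ((continuous_snd.sub continuous_const).norm.continuousAt (x := q)).eventually
        (gt_mem_nhds (by simpa using hq))
    filter_upwards [h1, h2] with y hy1 hy2 using (by rw [sig, (h y hy1 hy2).2.2, mul_assoc])
  obtain ⟨hT, hTs, hval⟩ := h q hzR (by simpa using hq)
  have hz0 : q.1 ≠ 0 := by
    have := hz 0
    simpa [eq_comm] using this
  -- For `p = 0`, division by zero leaves `zetTerm = 1/z` and `dtauTerm = 0`, which is the
  -- logarithmic differential of the factor `z` of `σ`. The factor `sigFactor` at `p = 0` is the
  -- constant `1`, so nothing is counted twice.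
  have hfst : HasFDerivAt (fun q : ℂ × ℂ => q.1) (q.1 • dTerm q 0) q := by
    refine (hasFDerivAt_fst (p := q)).congr_fderiv ?_
    ext
    · simp [dTerm, zetTerm, hz0]
    · simp [dTerm, dtauTerm]
  have hprod : HasFDerivAt (fun q : ℂ × ℂ => ∏ p ∈ F, sigFactor q.1 q.2 p)
      ((∏ p ∈ F, sigFactor q.1 q.2 p) • ∑ p ∈ F, if p = 0 then 0 else dTerm q p) q := by
    refine HasFDerivAt.prod_smul_self (f := fun (p : ℤ × ℤ) (q : ℂ × ℂ) => sigFactor q.1 q.2 p)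
      (L := fun p => if p = 0 then 0 else dTerm q p) (x := q) F fun p _ => ?_
    by_cases hp : p = 0
    · subst hp
      simpa [sigFactor] using! hasFDerivAt_const (1 : ℂ) q
    · simp only [hp, if_false]
      exact hasFDerivAt_sigFactor p q (by rwa [Ne, per_eq_zero_iff hq]) (hz p).symm
  refine ⟨dTerm q 0 + (∑ p ∈ F, if p = 0 then 0 else dTerm q p) + T' q, ?_, ?_⟩
  · have h3 : ∑ p ∈ F, dTerm q p = dTerm q 0 + (∑ p ∈ F, if p = 0 then 0 else dTerm q p) := by
      rw [← Finset.add_sum_erase F _ h0F,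
        ← Finset.add_sum_erase F (fun p => if p = 0 then (0 : ℂ × ℂ →L[ℂ] ℂ) else dTerm q p) h0F,
        if_pos rfl, zero_add]
      congr 1
      refine Finset.sum_congr rfl fun p hp => ?_
      rw [if_neg (Finset.ne_of_mem_erase hp)]
    rw [← h3]
    refine ((hasSum_ite_mem_finset F (dTerm q)).add hTs).congr_fun fun p => ?_
    by_cases hp : p ∈ F <;> simp [hp]
  · rw [sig, hval, ← mul_assoc]
    exact ((hfst.mul_smul_self hprod).mul_smul_self hT.cexp).congr_of_eventuallyEq hev

/-- The series of `ζ` is the `z`-component of the summable series of logarithmic differentials. -/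
theorem hasSum_zetTerm {z τ : ℂ} (hτ : 0 < τ.im) (hz : ∀ p, per τ p ≠ z) :
    HasSum (zetTerm z τ) (zet z τ) := by
  obtain ⟨D, hD, -⟩ := hasSum_dTerm_and_hasFDerivAt_sig (q := (z, τ)) hτ hz
  have := hD.mapL (ContinuousLinearMap.apply ℂ ℂ ((1, 0) : ℂ × ℂ))
  have h2 : Summable (zetTerm z τ) := this.summable.congr fun p => by simp [dTerm]
  exact h2.hasSum

theorem hasSum_dtauTerm {z τ : ℂ} (hτ : 0 < τ.im) (hz : ∀ p, per τ p ≠ z) :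
    HasSum (dtauTerm z τ) (dtau z τ) := by
  obtain ⟨D, hD, -⟩ := hasSum_dTerm_and_hasFDerivAt_sig (q := (z, τ)) hτ hz
  have := hD.mapL (ContinuousLinearMap.apply ℂ ℂ ((0, 1) : ℂ × ℂ))
  have h2 : Summable (dtauTerm z τ) := this.summable.congr fun p => by simp [dTerm]
  exact h2.hasSum

theorem hasFDerivAt_sig {q : ℂ × ℂ} (hq : 0 < q.2.im) (hz : ∀ p, per q.2 p ≠ q.1) :
    HasFDerivAt (fun q : ℂ × ℂ => sig q.1 q.2)
      (sig q.1 q.2 • (zet q.1 q.2 • ContinuousLinearMap.fst ℂ ℂ ℂ +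
        dtau q.1 q.2 • ContinuousLinearMap.snd ℂ ℂ ℂ)) q := by
  obtain ⟨D, hD, h⟩ := hasSum_dTerm_and_hasFDerivAt_sig hq hz
  have h1 := (hasSum_zetTerm hq hz).smul_const (ContinuousLinearMap.fst ℂ ℂ ℂ)
  have h2 := (hasSum_dtauTerm hq hz).smul_const (ContinuousLinearMap.snd ℂ ℂ ℂ)
  rw [← hD.unique (h1.add h2)]
  exact h

end WeierstrassTau

/-! ### The lattice as zero set of `σ`, parity, and the link with `PeriodPair`. -/

namespace WeierstrassTau

/-- The lattice `ℤ + ℤ τ`, as a set. -/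
def latt (τ : ℂ) : Set ℂ := Set.range (per τ)

variable {τ z : ℂ}

theorem notMem_latt_iff : z ∉ latt τ ↔ ∀ p, per τ p ≠ z := by
  simp [latt]

theorem zero_mem_latt (τ : ℂ) : (0 : ℂ) ∈ latt τ := ⟨0, per_zero τ⟩

theorem one_mem_latt (τ : ℂ) : (1 : ℂ) ∈ latt τ := ⟨(1, 0), by simp [per]⟩

theorem tau_mem_latt (τ : ℂ) : τ ∈ latt τ := ⟨(0, 1), by simp [per]⟩

theorem add_mem_latt {w : ℂ} (hz : z ∈ latt τ) (hw : w ∈ latt τ) : z + w ∈ latt τ := by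
  obtain ⟨p, rfl⟩ := hz
  obtain ⟨q, rfl⟩ := hw
  exact ⟨p + q, per_add τ p q⟩

theorem neg_mem_latt (hz : z ∈ latt τ) : -z ∈ latt τ := by
  obtain ⟨p, rfl⟩ := hz
  exact ⟨-p, per_neg τ p⟩

theorem neg_mem_latt_iff : -z ∈ latt τ ↔ z ∈ latt τ :=
  ⟨fun h => by simpa using neg_mem_latt h, neg_mem_latt⟩

theorem add_mem_latt_iff {w : ℂ} (hw : w ∈ latt τ) : z + w ∈ latt τ ↔ z ∈ latt τ :=
  ⟨fun h => by simpa using add_mem_latt h (neg_mem_latt hw), fun h => add_mem_latt h hw⟩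

theorem mem_lattice (τ : ℍ) (z : ℂ) : z ∈ (PeriodPair.ofTau τ).lattice ↔ z ∈ latt τ :=
  mem_lattice_iff τ z

theorem countable_latt (τ : ℂ) : (latt τ).Countable := Set.countable_range _

theorem sig_eq_zero_iff_mem (hτ : 0 < τ.im) : sig z τ = 0 ↔ z ∈ latt τ := sig_eq_zero_iff hτ

theorem differentiable_sig (hτ : 0 < τ.im) : Differentiable ℂ fun z => sig z τ := fun z =>
  DifferentiableAt.comp (f := fun z : ℂ => (z, τ)) z (differentiableAt_sig (q := (z, τ)) hτ)
    (differentiableAt_id.prodMk (differentiableAt_const τ))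

theorem differentiable_sigDiv (hτ : 0 < τ.im) : Differentiable ℂ fun z => sigDiv z τ := fun z =>
  DifferentiableAt.comp (f := fun z : ℂ => (z, τ)) z (differentiableAt_sigDiv (q := (z, τ)) hτ)
    (differentiableAt_id.prodMk (differentiableAt_const τ))

theorem isClosed_latt (hτ : 0 < τ.im) : IsClosed (latt τ) := by
  have : latt τ = (fun z => sig z τ) ⁻¹' {0} := by
    ext z; exact (sig_eq_zero_iff_mem hτ).symm
  rw [this]
  exact isClosed_singleton.preimage (differentiable_sig hτ).continuous

theorem isOpen_compl_latt (hτ : 0 < τ.im) : IsOpen (latt τ)ᶜ := (isClosed_latt hτ).isOpen_compl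

/-- A countable set does not disconnect the plane; this is what allows "derivative zero implies
constant" off the lattice. -/
theorem isPreconnected_compl_latt (τ : ℂ) : IsPreconnected (latt τ)ᶜ :=
  ((countable_latt τ).isPathConnected_compl_of_one_lt_rank (by simp)).isConnected.isPreconnected

theorem exists_notMem_latt (τ : ℂ) : ∃ z, z ∉ latt τ :=
  ((countable_latt τ).isPathConnected_compl_of_one_lt_rank (by simp)).nonempty

theorem eventually_notMem_latt (hτ : 0 < τ.im) (z : ℂ) : ∀ᶠ w in 𝓝[≠] z, w ∉ latt τ := by
  by_cases hz : z ∈ latt τ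
  · have h : ∀ᶠ w in 𝓝[≠] z, sig w τ ≠ 0 := by
      rcases ((differentiable_sig hτ).analyticAt z).eventually_eq_zero_or_eventually_ne_zero with h | h
      · exfalso
        have hA : AnalyticOnNhd ℂ (fun z => sig z τ) univ := fun w _ =>
          (differentiable_sig hτ).analyticAt w
        have h0 := hA.eqOn_zero_of_preconnected_of_eventuallyEq_zero isPreconnected_univ
          (mem_univ z) h
        obtain ⟨w, hw⟩ := exists_notMem_latt τ
        exact hw ((sig_eq_zero_iff_mem hτ).mp (h0 (mem_univ w)))
      · exact h
    filter_upwards [h] with w hw hw'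
    exact hw ((sig_eq_zero_iff_mem hτ).mpr hw')
  · exact eventually_nhdsWithin_of_eventually_nhds ((isOpen_compl_latt hτ).mem_nhds hz)

theorem hasDerivAt_sig (hτ : 0 < τ.im) (hz : z ∉ latt τ) :
    HasDerivAt (fun z => sig z τ) (sig z τ * zet z τ) z := by
  have h := hasFDerivAt_sig (q := (z, τ)) hτ (notMem_latt_iff.mp hz)
  have h2 : HasDerivAt (fun z : ℂ => (z, τ)) (1, 0) z :=
    (hasDerivAt_id z).prodMk (hasDerivAt_const z τ)
  simpa using! h.comp_hasDerivAt z h2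

theorem hasDerivAt_sig_tau (hτ : 0 < τ.im) (hz : z ∉ latt τ) :
    HasDerivAt (fun w => sig z w) (sig z τ * dtau z τ) τ := by
  have h := hasFDerivAt_sig (q := (z, τ)) hτ (notMem_latt_iff.mp hz)
  have h2 : HasDerivAt (fun w : ℂ => (z, w)) (0, 1) τ :=
    (hasDerivAt_const τ z).prodMk (hasDerivAt_id τ)
  simpa using! h.comp_hasDerivAt τ h2

theorem sigDiv_zero (τ : ℂ) : sigDiv 0 τ = 1 := by simp [sigDiv, sigFactor]

theorem sig_zero (τ : ℂ) : sig 0 τ = 0 := by simp [sig]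

theorem hasDerivAt_sig_zero (hτ : 0 < τ.im) : HasDerivAt (fun z => sig z τ) 1 0 := by
  have := (hasDerivAt_id (0 : ℂ)).mul ((differentiable_sigDiv hτ) 0).hasDerivAt
  simpa [sigDiv_zero] using! this

/-! ### Parity -/

theorem sigFactor_neg (z τ : ℂ) (p : ℤ × ℤ) : sigFactor (-z) τ p = sigFactor z τ (-p) := by
  simp [sigFactor, per_neg, neg_div, div_neg]

theorem sigDiv_neg (z τ : ℂ) : sigDiv (-z) τ = sigDiv z τ := by
  simp only [sigDiv, sigFactor_neg]
  exact (Equiv.neg (ℤ × ℤ)).tprod_eq (sigFactor z τ)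

theorem sig_neg (z τ : ℂ) : sig (-z) τ = -sig z τ := by
  rw [sig, sig, sigDiv_neg, neg_mul]

theorem zetTerm_neg (z τ : ℂ) (p : ℤ × ℤ) : zetTerm (-z) τ p = -zetTerm z τ (-p) := by
  have : -z - per τ p = -(z + per τ p) := by ring
  simp only [zetTerm, per_neg, this, sub_neg_eq_add, div_neg]
  ring

theorem zet_neg (z τ : ℂ) : zet (-z) τ = -zet z τ := by
  simp only [zet, zetTerm_neg, tsum_neg]
  exact congrArg _ ((Equiv.neg (ℤ × ℤ)).tsum_eq (zetTerm z τ))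

/-- `σ` is odd, so `σ''` is odd. -/
theorem deriv_deriv_sig_zero (τ : ℂ) :
    deriv (deriv fun z => sig z τ) 0 = 0 := by
  have h1 : ∀ z, deriv (fun z => sig z τ) (-z) = deriv (fun z => sig z τ) z := by
    intro z
    have h2 := deriv_comp_neg (fun z => sig z τ) z
    simp only [sig_neg, deriv.fun_neg] at h2
    exact (neg_inj.mp h2).symm
  have h3 := deriv_comp_neg (deriv fun z => sig z τ) 0
  simp only [h1, neg_zero] at h3
  exact self_eq_neg.mp h3

/-! ### Comparison with the series over the lattice -/

theorem sigma_eq (τ : ℍ) (z : ℂ) : (PeriodPair.ofTau τ).weierstrassSigma z = sig z τ := by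
  set L := PeriodPair.ofTau τ with hL
  set f : L.lattice → ℂ := fun l => (1 - z / (l : ℂ)) * exp (z / (l : ℂ) + z ^ 2 / (2 * (l : ℂ) ^ 2))
    with hf
  have h1 : ∏' l : {l : L.lattice // l ≠ 0}, f l.1 = ∏' l, f l := by
    refine tprod_subtype_eq_of_mulSupport_subset (s := {l : L.lattice | l ≠ 0}) ?_
    intro l hl h0
    apply hl
    simp [hf, h0]
  have h2 : ∏' l, f l = ∏' p, sigFactor z τ p := by
    rw [← L.latticeEquivProd.symm.toEquiv.tprod_eq]
    refine tprod_congr fun p => ?_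
    have := coe_latticeEquivProd_symm τ p
    simp only [hf, sigFactor, ← this]
    rfl
  rw [sig, sigDiv, ← h2, ← h1]
  rfl

theorem zeta_eq (τ : ℍ) (z : ℂ) (hz : z ∉ latt τ) :
    (PeriodPair.ofTau τ).weierstrassZeta z = zet z τ := by
  set L := PeriodPair.ofTau τ with hL
  set f : L.lattice → ℂ := fun l => 1 / (z - (l : ℂ)) + 1 / (l : ℂ) + z / (l : ℂ) ^ 2 with hf
  have h2 : HasSum f (zet z τ) := by
    rw [← L.latticeEquivProd.symm.toEquiv.hasSum_iff]
    refine (hasSum_zetTerm τ.im_pos (notMem_latt_iff.mp hz)).congr_fun fun p => ?_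
    have := coe_latticeEquivProd_symm τ p
    simp only [hf, zetTerm, ← this]
    rfl
  have h3 := h2.summable.sum_add_tsum_subtype_compl {0}
  rw [Finset.sum_singleton, h2.tsum_eq] at h3
  rw [← h3]
  have h0 : f 0 = 1 / z := by simp [hf]
  rw [h0]
  exact congrArg _ (Equiv.tsum_eq (Equiv.subtypeEquivRight fun l => by simp)
    fun l : {l : L.lattice // l ∉ ({0} : Finset L.lattice)} => f l)

end WeierstrassTau

/-! ### Derivative of `ζ`, regular parts at the origin, quasi-periods. -/

namespace WeierstrassTau

variable {τ z : ℂ}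

theorem hasDerivAt_zetTerm {p : ℤ × ℤ} (h : per τ p ≠ z) :
    HasDerivAt (fun z => zetTerm z τ p) (-(1 / (z - per τ p) ^ 2 - 1 / per τ p ^ 2)) z := by
  have h1 : z - per τ p ≠ 0 := sub_ne_zero.mpr h.symm
  have := ((((hasDerivAt_id z).sub_const (per τ p)).inv h1).add_const (1 / per τ p)).add
    ((hasDerivAt_id z).div_const (per τ p ^ 2))
  refine (this.congr_deriv ?_).congr_of_eventuallyEq (.of_forall fun y => ?_)
  · simp; ring
  · simp [zetTerm]

theorem ne_of_two_mul_le_norm {R : ℝ} {w : ℂ} (hz : z ∈ Metric.ball (0 : ℂ) R)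
    (h : 2 * R ≤ ‖w‖) : w ≠ z := by
  rintro rfl
  have h1 : ‖w‖ < R := by simpa using hz
  linarith [norm_nonneg w]

theorem hasDerivAt_zet (τ : ℍ) (hz : z ∉ latt τ) :
    HasDerivAt (fun z => zet z τ) (-(PeriodPair.ofTau τ).weierstrassP z) z := by
  obtain ⟨R, hR, hzR⟩ := exists_radius z
  obtain ⟨F, h0F, hF⟩ := exists_finset_norm_per τ.im_pos R hR
  replace hF : ∀ p ∉ F, 2 * R ≤ ‖per τ p‖ := fun p hp =>
    hF p hp τ (by simpa using! τ.im_pos)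
  obtain ⟨h1, h2⟩ := Complex.differentiableAt_tsum_of_finset (f := fun p z => zetTerm z τ p)
    (U := Metric.ball 0 R) Metric.isOpen_ball F ((summable_norm_per τ.im_pos).mul_left (2 * R ^ 2))
    (fun p hp w hw => norm_zetTerm_le (by simpa using (Metric.ball_subset_closedBall hw)) hR
      (hF p hp))
    (fun p hp w hw => (hasDerivAt_zetTerm
      (ne_of_two_mul_le_norm hw (hF p hp))).differentiableAt.differentiableWithinAt)
    (by simpa using hzR)
    (fun p _ => (hasDerivAt_zetTerm (notMem_latt_iff.mp hz p)).differentiableAt)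
  have h3 : deriv (fun z => zet z τ) z = -(PeriodPair.ofTau τ).weierstrassP z := by
    refine h2.unique ?_
    have h4 := ((PeriodPair.ofTau τ).latticeEquivProd.symm.toEquiv.hasSum_iff.mpr
      ((PeriodPair.ofTau τ).hasSum_weierstrassP z)).neg
    refine h4.congr_fun fun p => ?_
    rw [(hasDerivAt_zetTerm (notMem_latt_iff.mp hz p)).deriv, ← coe_latticeEquivProd_symm]
    rfl
  rw [← h3]
  exact h1.hasDerivAt

theorem differentiableAt_zet (hτ : 0 < τ.im) (hz : z ∉ latt τ) :
    DifferentiableAt ℂ (fun z => zet z τ) z :=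
  (hasDerivAt_zet ⟨τ, hτ⟩ hz).differentiableAt

theorem norm_pole_term_le {p : ℤ × ℤ} {R A B : ℝ} {k : ℂ} (hk : ‖k‖ ≤ A * ‖per τ p‖ + B)
    (hB : 0 ≤ B) (hz : ‖z‖ ≤ R) (hR : 0 < R) (h : 2 * R ≤ ‖per τ p‖) :
    ‖k / (per τ p ^ 3 * (per τ p - z))‖ ≤ (2 * A + B / R) * (‖per τ p‖ ^ 3)⁻¹ := by
  have hp : 0 < ‖per τ p‖ := by linarith
  have h1 : ‖per τ p‖ / 2 ≤ ‖per τ p - z‖ := by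
    linarith [norm_sub_norm_le (per τ p) z]
  have h2 : 0 ≤ A * ‖per τ p‖ + B := (norm_nonneg _).trans hk
  rw [norm_div, norm_mul, norm_pow]
  calc ‖k‖ / (‖per τ p‖ ^ 3 * ‖per τ p - z‖)
      ≤ (A * ‖per τ p‖ + B) / (‖per τ p‖ ^ 3 * (‖per τ p‖ / 2)) := by gcongr
    _ = 2 * A * (‖per τ p‖ ^ 3)⁻¹ + B / (‖per τ p‖ / 2) * (‖per τ p‖ ^ 3)⁻¹ := by
        field_simp
    _ ≤ 2 * A * (‖per τ p‖ ^ 3)⁻¹ + B / R * (‖per τ p‖ ^ 3)⁻¹ := by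
        gcongr; linarith
    _ = _ := by ring

/-- Numerators of linear growth leave `|ω|⁻³`. The term `p = 0` has denominator zero and hence value
zero, so the origin is a regular point of the sum. -/
theorem differentiableAt_pole_series (hτ : 0 < τ.im) {k : ℤ × ℤ → ℂ} {A B : ℝ}
    (hB : 0 ≤ B) (hk : ∀ p, ‖k p‖ ≤ A * ‖per τ p‖ + B) (hz : ∀ p ≠ 0, per τ p ≠ z) :
    DifferentiableAt ℂ (fun z => ∑' p, k p / (per τ p ^ 3 * (per τ p - z))) z := by
  obtain ⟨R, hR, hzR⟩ := exists_radius z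
  obtain ⟨F, h0F, hF⟩ := exists_finset_norm_per hτ R hR
  replace hF : ∀ p ∉ F, 2 * R ≤ ‖per τ p‖ := fun p hp => hF p hp τ (by simpa using! hτ)
  have hd : ∀ p ≠ 0, ∀ w, per τ p ≠ w →
      DifferentiableAt ℂ (fun z => k p / (per τ p ^ 3 * (per τ p - z))) w := by
    intro p hp w hw
    have h0 : per τ p ^ 3 * (per τ p - w) ≠ 0 :=
      mul_ne_zero (pow_ne_zero _ ((per_eq_zero_iff hτ p).not.mpr hp)) (sub_ne_zero.mpr hw)
    fun_prop (disch := exact h0)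
  refine (Complex.differentiableAt_tsum_of_finset (U := Metric.ball 0 R) Metric.isOpen_ball F
    ((summable_norm_per hτ).mul_left (2 * A + B / R))
    (fun p hp w hw => norm_pole_term_le (hk p) hB
      (by simpa using (Metric.ball_subset_closedBall hw)) hR (hF p hp))
    (fun p hp w hw => (hd p (by rintro rfl; exact hp h0F) w
      (ne_of_two_mul_le_norm hw (hF p hp))).differentiableWithinAt)
    (by simpa using hzR) fun p _ => ?_).1
  by_cases hp : p = 0
  · simp [hp]
  · exact hd p hp z (hz p hp)

/-- `(ζ(z) - 1/z) / z³`. -/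
noncomputable def zetReg (z τ : ℂ) : ℂ := ∑' p, (-1) / (per τ p ^ 3 * (per τ p - z))

/-- `(∂ ln σ(z) / ∂ τ) / z³`. -/
noncomputable def dtauReg (z τ : ℂ) : ℂ := ∑' p, p.2 / (per τ p ^ 3 * (per τ p - z))

theorem differentiableAt_zetReg (hτ : 0 < τ.im) (hz : ∀ p ≠ 0, per τ p ≠ z) :
    DifferentiableAt ℂ (fun z => zetReg z τ) z :=
  differentiableAt_pole_series hτ (k := fun _ => -1) (A := 0) (B := 1) zero_le_one (by simp) hz

theorem differentiableAt_dtauReg (hτ : 0 < τ.im) (hz : ∀ p ≠ 0, per τ p ≠ z) :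
    DifferentiableAt ℂ (fun z => dtauReg z τ) z :=
  differentiableAt_pole_series hτ (A := 1 / τ.im) (B := 0) le_rfl (fun p => by
    rw [add_zero, one_div_mul_eq_div, le_div_iff₀ hτ]
    exact abs_snd_mul_im_le hτ p) hz

theorem dtau_eq (z τ : ℂ) : dtau z τ = z ^ 3 * dtauReg z τ := by
  rw [dtau, dtauReg, ← tsum_mul_left]
  refine tsum_congr fun p => ?_
  rw [dtauTerm]
  ring

theorem differentiableAt_dtau (hτ : 0 < τ.im) (hz : z ∉ latt τ) :
    DifferentiableAt ℂ (fun z => dtau z τ) z := by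
  simp only [dtau_eq]
  exact (differentiableAt_id.pow 3).mul
    (differentiableAt_dtauReg hτ fun p _ => notMem_latt_iff.mp hz p)

theorem tsum_inv_cube (τ : ℂ) : ∑' p, (per τ p ^ 3)⁻¹ = 0 := by
  have h : ∑' p, (per τ p ^ 3)⁻¹ = -∑' p, (per τ p ^ 3)⁻¹ := by
    rw [← tsum_neg, ← (Equiv.neg (ℤ × ℤ)).tsum_eq fun p => (per τ p ^ 3)⁻¹]
    refine tsum_congr fun p => ?_
    simp only [Equiv.neg_apply, per_neg]
    rw [Odd.neg_pow (by decide), inv_neg]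
  exact self_eq_neg.mp h

/-- Adding `z² ∑ ω⁻³ = 0` turns each term `z² / (ω² (z - ω))` into `z³ / (ω³ (z - ω))`, which
exhibits the factor `z³`. -/
theorem zet_eq (hτ : 0 < τ.im) (hz : z ∉ latt τ) : zet z τ = 1 / z + z ^ 3 * zetReg z τ := by
  have hne := notMem_latt_iff.mp hz
  have hz0 : z ≠ 0 := by rintro rfl; exact hz (zero_mem_latt τ)
  have h1 : Summable fun p => (per τ p ^ 3)⁻¹ :=
    Summable.of_norm (by simpa using summable_norm_per hτ)
  have h2 : Summable (zetTerm z τ) := (hasSum_zetTerm hτ hne).summable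
  have h3 := ((h1.hasSum.mul_left (z ^ 2)).add h2.hasSum).sub (hasSum_ite_eq (0 : ℤ × ℤ) (1 / z))
  rw [tsum_inv_cube, mul_zero, zero_add] at h3
  rw [← sub_eq_iff_eq_add']
  rw [zetReg, ← tsum_mul_left]
  refine ((h3.congr_fun fun p => ?_).tsum_eq).symm
  by_cases hp : p = 0
  · subst hp; simp [zetTerm]
  · have hp0 := (per_eq_zero_iff hτ p).not.mpr hp
    have h4 : z - per τ p ≠ 0 := sub_ne_zero.mpr (hne p).symm
    have h5 : per τ p - z ≠ 0 := sub_ne_zero.mpr (hne p)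
    rw [if_neg hp, zetTerm_eq hp0 (hne p).symm]
    have h6 : z - per τ p = -(per τ p - z) := by ring
    rw [h6]
    field_simp
    ring

theorem zetReg_zero (τ : ℍ) : zetReg 0 τ = -(PeriodPair.ofTau τ).G 4 := by
  rw [zetReg, PeriodPair.G, ← (PeriodPair.ofTau τ).latticeEquivProd.symm.toEquiv.tsum_eq,
    ← tsum_neg]
  refine tsum_congr fun p => ?_
  have := coe_latticeEquivProd_symm τ p
  simp only [sub_zero, ← this]
  rw [← pow_succ, neg_div, one_div]
  rfl

/-! ### Quasi-periods -/

theorem half_notMem_latt (hτ : 0 < τ.im) : (1 / 2 : ℂ) ∉ latt τ := by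
  rintro ⟨p, hp⟩
  have him := congrArg Complex.im hp
  have hre := congrArg Complex.re hp
  simp [per] at him hre
  have h2 : p.2 = 0 := by
    rcases him with h | h
    · exact h
    · exact absurd h hτ.ne'
  rw [h2] at hre
  simp at hre
  have h3 : ((2 * p.1 : ℤ) : ℝ) = ((1 : ℤ) : ℝ) := by push_cast; linarith
  have := Int.cast_injective h3
  omega

theorem half_tau_notMem_latt (hτ : 0 < τ.im) : τ / 2 ∉ latt τ := by
  rintro ⟨p, hp⟩
  have him := congrArg Complex.im hp
  simp [per] at him
  have h3 : ((2 * p.2 : ℤ) : ℝ) = ((1 : ℤ) : ℝ) := by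
    push_cast
    field_simp at him
    linarith
  have := Int.cast_injective h3
  omega

/-- The increment of `ζ` has derivative zero since `℘` is periodic; oddness evaluates the constant
at `-ω/2`. This is why `ω/2` must lie off the lattice. -/
theorem zet_add (hτ : 0 < τ.im) {ω : ℂ} (hω : ω ∈ latt τ) (hω2 : ω / 2 ∉ latt τ)
    (hz : z ∉ latt τ) : zet (z + ω) τ = zet z τ + 2 * zet (ω / 2) τ := by
  have hω' : ω ∈ (PeriodPair.ofTau ⟨τ, hτ⟩).lattice := (mem_lattice ⟨τ, hτ⟩ ω).mpr hω
  have hadd : ∀ w ∉ latt τ, w + ω ∉ latt τ := fun w hw => by rwa [add_mem_latt_iff hω]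
  have hd : ∀ w ∈ (latt τ)ᶜ, HasDerivAt (fun z => zet (z + ω) τ - zet z τ) 0 w := by
    intro w hw
    have h1 := (hasDerivAt_zet ⟨τ, hτ⟩ (hadd w hw)).comp_add_const w ω
    have h2 := h1.sub (hasDerivAt_zet ⟨τ, hτ⟩ hw)
    refine h2.congr_deriv ?_
    rw [(PeriodPair.ofTau ⟨τ, hτ⟩).weierstrassP_add_coe w ⟨ω, hω'⟩, sub_self]
  have hm : -(ω / 2) ∈ (latt τ)ᶜ := fun h => hω2 (neg_mem_latt_iff.mp h)
  have h := (isOpen_compl_latt hτ).is_const_of_deriv_eq_zero (isPreconnected_compl_latt τ)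
    (fun w hw => (hd w hw).differentiableAt.differentiableWithinAt)
    (fun w hw => (hd w hw).deriv) (show z ∈ (latt τ)ᶜ from hz) hm
  have h3 : -(ω / 2) + ω = ω / 2 := by ring
  simp only [h3, zet_neg] at h
  linear_combination h

/-- The quotient of the two sides has logarithmic derivative zero by `zet_add`, and its value at
`-ω/2` is `-1` because `σ` is odd. -/
theorem sig_add (hτ : 0 < τ.im) {ω : ℂ} (hω : ω ∈ latt τ) (hω2 : ω / 2 ∉ latt τ) (z : ℂ) :
    sig (z + ω) τ = -exp (2 * zet (ω / 2) τ * (z + ω / 2)) * sig z τ := by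
  by_cases hz : z ∈ latt τ
  · rw [(sig_eq_zero_iff_mem hτ).mpr hz, (sig_eq_zero_iff_mem hτ).mpr (add_mem_latt hz hω), mul_zero]
  have hadd : ∀ w ∉ latt τ, w + ω ∉ latt τ := fun w hw => by rwa [add_mem_latt_iff hω]
  have hne : ∀ w ∉ latt τ, sig w τ ≠ 0 := fun w hw h => hw ((sig_eq_zero_iff_mem hτ).mp h)
  set η := 2 * zet (ω / 2) τ with hη
  have hd : ∀ w ∈ (latt τ)ᶜ,
      HasDerivAt (fun z => sig (z + ω) τ * exp (-(η * (z + ω / 2))) / sig z τ) 0 w := by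
    intro w hw
    have h1 := (hasDerivAt_sig hτ (hadd w hw)).comp_add_const w ω
    have h2 : HasDerivAt (fun z => exp (-(η * (z + ω / 2)))) (exp (-(η * (w + ω / 2))) * -η) w := by
      have := (((hasDerivAt_id w).add_const (ω / 2)).const_mul η).neg.cexp
      simpa using! this
    refine ((h1.mul h2).div (hasDerivAt_sig hτ hw) (hne w hw)).congr_deriv ?_
    rw [zet_add hτ hω hω2 hw, ← hη, div_eq_zero_iff]
    left
    simp
    ring
  have hm : -(ω / 2) ∈ (latt τ)ᶜ := fun h => hω2 (neg_mem_latt_iff.mp h)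
  have h := (isOpen_compl_latt hτ).is_const_of_deriv_eq_zero (isPreconnected_compl_latt τ)
    (fun w hw => (hd w hw).differentiableAt.differentiableWithinAt)
    (fun w hw => (hd w hw).deriv) (show z ∈ (latt τ)ᶜ from hz) hm
  have h3 : -(ω / 2) + ω = ω / 2 := by ring
  have h4 := hne _ hω2
  simp only [h3, sig_neg, neg_add_cancel, mul_zero, neg_zero, exp_zero, mul_one, div_neg,
    div_self h4] at h
  rw [div_eq_iff (hne z hz), exp_neg] at h
  rw [mul_inv_eq_iff_eq_mul₀ (exp_ne_zero _)] at h
  linear_combination h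

end WeierstrassTau

/-- The integral of `1 / z` over the boundary of a rectangle around the origin. -/
theorem Complex.integral_boundary_rect_inv {k : ℝ} (hk : 0 < k) :
    (∫ x : ℝ in (-(1 / 2))..(1 / 2), (1 : ℂ) / (x + (-k : ℝ) * I)) -
      (∫ x : ℝ in (-(1 / 2))..(1 / 2), (1 : ℂ) / (x + k * I)) +
      I * (∫ y : ℝ in (-k)..k, (1 : ℂ) / ((1 / 2 : ℝ) + y * I)) -
      I * (∫ y : ℝ in (-k)..k, (1 : ℂ) / ((-(1 / 2) : ℝ) + y * I)) = 2 * Real.pi * I := by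
  have hne1 : ∀ x : ℝ, (x : ℂ) + (-k : ℝ) * I ≠ 0 := fun x h => by
    have := congrArg Complex.im h; simp at this; linarith
  have hne2 : ∀ x : ℝ, (x : ℂ) + k * I ≠ 0 := fun x h => by
    have := congrArg Complex.im h; simp at this; linarith
  have hne3 : ∀ y : ℝ, ((1 / 2 : ℝ) : ℂ) + y * I ≠ 0 := fun x h => by
    have := congrArg Complex.re h; simp at this
  have hne4 : ∀ y : ℝ, ((-(1 / 2) : ℝ) : ℂ) + y * I ≠ 0 := fun x h => by
    have := congrArg Complex.re h; simp at this
  have hint : ∀ (g : ℝ → ℂ) (_ : Continuous g) (_ : ∀ x, g x ≠ 0) (a b : ℝ),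
      IntervalIntegrable (fun x => 1 / g x) MeasureTheory.volume a b := fun g hg h0 a b =>
    (continuous_const.div hg h0).intervalIntegrable a b
  have hgen : ∀ A B : ℂ, A ≠ 0 → B ≠ 0 → 1 / A - 1 / B = (B - A) * (A * B)⁻¹ := by
    intro A B hA hB
    field_simp
  have h1 : (∫ x : ℝ in (-(1 / 2))..(1 / 2), (1 : ℂ) / (x + (-k : ℝ) * I)) -
      (∫ x : ℝ in (-(1 / 2))..(1 / 2), (1 : ℂ) / (x + k * I)) =
      (2 * k * I) * ((∫ x : ℝ in (-(1 / 2))..(1 / 2), (k ^ 2 + x ^ 2)⁻¹ : ℝ) : ℂ) := by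
    rw [← intervalIntegral.integral_sub (hint _ (by fun_prop) hne1 _ _)
      (hint _ (by fun_prop) hne2 _ _), ← intervalIntegral.integral_ofReal,
      ← intervalIntegral.integral_const_mul]
    refine intervalIntegral.integral_congr fun x _ => ?_
    have h5 := hne1 x
    have h6 := hne2 x
    have h7 : ((k : ℂ) ^ 2 + (x : ℂ) ^ 2) = (x + (-k : ℝ) * I) * (x + k * I) := by
      push_cast; linear_combination ((k : ℂ) ^ 2) * I_sq
    simp only [ofReal_inv, ofReal_add, ofReal_pow]
    rw [h7, hgen _ _ h5 h6]
    push_cast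
    ring
  have h2 : I * (∫ y : ℝ in (-k)..k, (1 : ℂ) / ((1 / 2 : ℝ) + y * I)) -
      I * (∫ y : ℝ in (-k)..k, (1 : ℂ) / ((-(1 / 2) : ℝ) + y * I)) =
      I * ((∫ y : ℝ in (-k)..k, ((1 / 2) ^ 2 + y ^ 2)⁻¹ : ℝ) : ℂ) := by
    rw [← mul_sub, ← intervalIntegral.integral_sub (hint _ (by fun_prop) hne3 _ _)
      (hint _ (by fun_prop) hne4 _ _), ← intervalIntegral.integral_ofReal]
    congr 1
    refine intervalIntegral.integral_congr fun y _ => ?_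
    have h5 := hne3 y
    have h6 := hne4 y
    have h7 : (((1 / 2 : ℝ) : ℂ) ^ 2 + (y : ℂ) ^ 2) =
        -(((1 / 2 : ℝ) + y * I) * ((-(1 / 2) : ℝ) + y * I)) := by
      push_cast; linear_combination ((y : ℂ) ^ 2) * I_sq
    simp only [ofReal_inv, ofReal_add, ofReal_pow]
    rw [h7, hgen _ _ h5 h6, inv_neg]
    push_cast
    ring
  rw [add_sub_assoc, h1, h2, integral_inv_sq_add_sq hk.ne', integral_inv_sq_add_sq (by norm_num)]
  -- The two pairs of sides contribute `4i arctan(1/(2k))` and `4i arctan(2k)`, which add up to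
  -- `2πi`.
  have h3 : Real.arctan (1 / 2 / k) = Real.pi / 2 - Real.arctan (2 * k) := by
    rw [← Real.arctan_inv_of_pos (by positivity)]
    congr 1
    field_simp
  have h4 : k / (1 / 2) = 2 * k := by ring
  have h5 : -k / (1 / 2) = -(2 * k) := by ring
  have h6 : -(1 / 2) / k = -(1 / 2 / k) := by ring
  rw [h4, h5, h6, Real.arctan_neg, Real.arctan_neg, h3]
  push_cast
  have hk' : (k : ℂ) ≠ 0 := by exact_mod_cast hk.ne'
  field_simp
  ring

/-! ### Legendre's relation. -/

namespace WeierstrassTau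

variable {τ z : ℂ}

theorem notMem_latt_of_im (hτ : 0 < τ.im) (h0 : z.im ≠ 0) (h : |z.im| < τ.im) : z ∉ latt τ := by
  rintro ⟨p, rfl⟩
  have : (per τ p).im = p.2 * τ.im := by simp [per]
  rw [this] at h h0
  rw [abs_mul, abs_of_pos hτ] at h
  have h1 : |(p.2 : ℝ)| < 1 := by
    by_contra h2
    push Not at h2
    nlinarith
  have h2 : p.2 = 0 := by
    rw [← Int.abs_lt_one_iff]; exact_mod_cast h1
  simp [h2] at h0

theorem eq_zero_of_mem_latt (hτ : 0 < τ.im) (hre : |z.re| ≤ 1 / 2) (him : |z.im| < τ.im)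
    (h : z ∈ latt τ) : z = 0 := by
  by_cases h0 : z.im = 0
  · obtain ⟨p, rfl⟩ := h
    have h1 : (per τ p).im = p.2 * τ.im := by simp [per]
    rw [h1, mul_eq_zero] at h0
    have h2 : p.2 = 0 := by exact_mod_cast h0.resolve_right hτ.ne'
    have h3 : (per τ p).re = p.1 := by simp [per, h2]
    rw [h3] at hre
    have h4 : |(p.1 : ℝ)| < 1 := by linarith
    have h5 : p.1 = 0 := by
      rw [← Int.abs_lt_one_iff]; exact_mod_cast h4
    simp [per, h2, h5]
  · exact absurd h (notMem_latt_of_im hτ h0 him)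

/-- Legendre's relation. -/
theorem legendre (hτ : 0 < τ.im) :
    2 * zet (1 / 2) τ * τ - 2 * zet (τ / 2) τ = 2 * Real.pi * I := by
  set η₁ := 2 * zet (1 / 2) τ with hη₁
  set η₂ := 2 * zet (τ / 2) τ with hη₂
  -- The contour is a rectangle of width `1` and height `Im τ` instead of a period parallelogram.
  -- The origin is its only lattice point, but the horizontal sides then match only after a shift by
  -- `Re τ`.
  set k : ℝ := τ.im / 2 with hk
  have hk0 : 0 < k := by positivity
  set φ : ℂ → ℂ := fun z => zet z τ with hφ
  have hcont : ∀ (g : ℝ → ℂ), Continuous g → ∀ a b : ℝ,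
      (∀ x ∈ uIcc a b, g x ∉ latt τ) →
      IntervalIntegrable (fun x => φ (g x)) MeasureTheory.volume a b := by
    intro g hg a b h
    refine ContinuousOn.intervalIntegrable fun x hx => ?_
    exact ((differentiableAt_zet hτ (h x hx)).continuousAt.comp hg.continuousAt).continuousWithinAt
  have hper : ∀ z ∉ latt τ, φ (z + 1) = φ z + η₁ := fun z hz =>
    zet_add hτ (one_mem_latt τ) (half_notMem_latt hτ) hz
  have hper2 : ∀ z ∉ latt τ, φ (z + τ) = φ z + η₂ := fun z hz =>
    zet_add hτ (tau_mem_latt τ) (half_tau_notMem_latt hτ) hz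
  have hb : ∀ x : ℝ, (x : ℂ) + (-k : ℝ) * I ∉ latt τ := fun x => by
    refine notMem_latt_of_im hτ (by simp [hk0.ne']) ?_
    simp [abs_of_pos hk0]; linarith
  have ht : ∀ x : ℝ, (x : ℂ) + k * I ∉ latt τ := fun x => by
    refine notMem_latt_of_im hτ (by simp [hk0.ne']) ?_
    simp [abs_of_pos hk0]; linarith
  have hr : ∀ y ∈ uIcc (-k) k, ((1 / 2 : ℝ) : ℂ) + y * I ∉ latt τ := fun y hy h => by
    rw [uIcc_of_le (by linarith)] at hy
    have := eq_zero_of_mem_latt hτ (by simp [abs_of_pos])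
      (by simp [abs_lt]; constructor <;> linarith [hy.1, hy.2]) h
    have := congrArg Complex.re this
    simp at this
  have hl : ∀ y ∈ uIcc (-k) k, ((-(1 / 2) : ℝ) : ℂ) + y * I ∉ latt τ := fun y hy h => by
    rw [uIcc_of_le (by linarith)] at hy
    have := eq_zero_of_mem_latt hτ (by simp [abs_of_pos])
      (by simp [abs_lt]; constructor <;> linarith [hy.1, hy.2]) h
    have := congrArg Complex.re this
    simp at this
  -- the regular part has integral zero
  have hreg := Complex.integral_boundary_rect_eq_zero_of_differentiableOn
    (fun z => z ^ 3 * zetReg z τ) (⟨-(1 / 2), -k⟩ : ℂ) (⟨1 / 2, k⟩ : ℂ) (by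
      intro z hz
      refine ((differentiableAt_id.pow 3).mul (differentiableAt_zetReg hτ
        fun p hp h => ?_)).differentiableWithinAt
      rw [mem_reProdIm, uIcc_of_le (by norm_num), uIcc_of_le (by simp; linarith)] at hz
      have h1 := eq_zero_of_mem_latt hτ (by rw [abs_le]; exact hz.1)
        (lt_of_le_of_lt (by rw [abs_le]; exact hz.2) (by linarith)) ⟨p, h⟩
      rw [h1, per_eq_zero_iff hτ] at h
      exact hp h)
  simp only [smul_eq_mul] at hreg
  have hsplit : ∀ (g : ℝ → ℂ), Continuous g → ∀ a b : ℝ, (∀ x ∈ uIcc a b, g x ∉ latt τ) →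
      ∫ x in a..b, g x ^ 3 * zetReg (g x) τ =
        (∫ x in a..b, φ (g x)) - ∫ x in a..b, (1 : ℂ) / g x := by
    intro g hg a b h
    have hg0 : ∀ x ∈ uIcc a b, g x ≠ 0 := fun x hx h0 => h x hx (h0 ▸ zero_mem_latt τ)
    have hi : IntervalIntegrable (fun x => (1 : ℂ) / g x) MeasureTheory.volume a b :=
      (continuousOn_const.div hg.continuousOn hg0).intervalIntegrable
    rw [← intervalIntegral.integral_sub (hcont g hg a b h) hi]
    refine intervalIntegral.integral_congr fun x hx => ?_
    simp only [hφ, zet_eq hτ (h x hx)]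
    ring
  rw [hsplit (fun x : ℝ => (x : ℂ) + (-k : ℝ) * I) (by fun_prop) _ _ fun x _ => hb x,
    hsplit (fun x : ℝ => (x : ℂ) + k * I) (by fun_prop) _ _ fun x _ => ht x,
    hsplit (fun y : ℝ => ((1 / 2 : ℝ) : ℂ) + y * I) (by fun_prop) _ _ hr,
    hsplit (fun y : ℝ => ((-(1 / 2) : ℝ) : ℂ) + y * I) (by fun_prop) _ _ hl] at hreg
  have hinv := Complex.integral_boundary_rect_inv hk0
  -- the vertical sides
  have hv : (∫ y in (-k)..k, φ (((1 / 2 : ℝ) : ℂ) + y * I)) -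
      ∫ y in (-k)..k, φ (((-(1 / 2) : ℝ) : ℂ) + y * I) = 2 * k * η₁ := by
    rw [← intervalIntegral.integral_sub (hcont _ (by fun_prop) _ _ hr)
      (hcont _ (by fun_prop) _ _ hl)]
    have : ∫ y in (-k)..k, (φ (((1 / 2 : ℝ) : ℂ) + y * I) - φ (((-(1 / 2) : ℝ) : ℂ) + y * I)) =
        ∫ y in (-k)..k, η₁ := by
      refine intervalIntegral.integral_congr fun y hy => ?_
      have h1 := hper _ (hl y hy)
      have h2 : ((-(1 / 2) : ℝ) : ℂ) + y * I + 1 = ((1 / 2 : ℝ) : ℂ) + y * I := by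
        push_cast; ring
      simp only [← h2, h1]
      ring
    rw [this, intervalIntegral.integral_const, real_smul]
    push_cast; ring
  -- the horizontal sides
  have hh : ∫ x in (-(1 / 2))..(1 / 2), φ ((x : ℂ) + k * I) =
      (∫ x in (-(1 / 2))..(1 / 2), φ ((x : ℂ) + (-k : ℝ) * I)) - η₁ * τ.re + η₂ := by
    have h1 : ∀ x : ℝ, φ ((x : ℂ) + k * I) = φ ((x - τ.re : ℝ) + (-k : ℝ) * I) + η₂ := by
      intro x
      rw [← hper2 _ (hb _)]
      congr 1
      apply Complex.ext <;> simp [hk]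
      ring
    -- Subtracting `η₁ x` makes `ζ` periodic along the line, so its integral over a unit interval
    -- does not see the shift by `Re τ`; the linear term contributes `η₁ Re τ`.
    set ψ : ℝ → ℂ := fun x => φ ((x : ℂ) + (-k : ℝ) * I) - η₁ * x with hψ
    have hψp : Function.Periodic ψ 1 := by
      intro x
      have h2 : (((x + 1 : ℝ) : ℂ) + (-k : ℝ) * I) = ((x : ℂ) + (-k : ℝ) * I) + 1 := by
        push_cast; ring
      simp only [hψ, h2, hper _ (hb x)]
      push_cast; ring
    have hI1 : ∀ a b : ℝ, IntervalIntegrable (fun x : ℝ => φ ((x : ℂ) + (-k : ℝ) * I))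
        MeasureTheory.volume a b := fun a b => hcont _ (by fun_prop) a b fun x _ => hb x
    have hI2 : ∀ a b : ℝ, IntervalIntegrable (fun x : ℝ => η₁ * x)
        MeasureTheory.volume a b := fun a b => Continuous.intervalIntegrable (by fun_prop) a b
    have h3 := hψp.intervalIntegral_add_eq (-(1 / 2) - τ.re) (-(1 / 2))
    simp only [hψ] at h3
    rw [intervalIntegral.integral_sub (hI1 _ _) (hI2 _ _),
      intervalIntegral.integral_sub (hI1 _ _) (hI2 _ _), intervalIntegral.integral_const_mul,
      intervalIntegral.integral_const_mul, intervalIntegral.integral_ofReal,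
      intervalIntegral.integral_ofReal, integral_id, integral_id] at h3
    have h4 : (-(1 / 2) + 1 : ℝ) = 1 / 2 := by norm_num
    have h5 : (-(1 / 2) - τ.re + 1 : ℝ) = 1 / 2 - τ.re := by ring
    rw [h4, h5] at h3
    simp only [h1]
    rw [intervalIntegral.integral_add, intervalIntegral.integral_const,
      intervalIntegral.integral_comp_sub_right (fun x : ℝ => φ ((x : ℂ) + (-k : ℝ) * I))]
    · rw [sub_eq_iff_eq_add] at h3
      rw [h3, real_smul]
      push_cast
      ring
    · exact hcont (fun x : ℝ => ((x - τ.re : ℝ) : ℂ) + (-k : ℝ) * I) (by fun_prop) _ _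
        fun x _ => hb _
    · exact intervalIntegrable_const
  rw [hh] at hreg
  have h6 : (τ : ℂ) = τ.re + 2 * k * I := by
    apply Complex.ext <;> simp [hk]
    ring
  rw [h6]
  linear_combination hinv + hreg - I * hv

end WeierstrassTau

/-! ### Functions with removable singularities -/

/-- `q` agrees near `z`, except perhaps at `z`, with a function analytic at `z`. -/
def HasRemovable (q : ℂ → ℂ) (z : ℂ) : Prop :=
  ∃ g : ℂ → ℂ, AnalyticAt ℂ g z ∧ q =ᶠ[𝓝[≠] z] g

theorem AnalyticAt.hasRemovable {q : ℂ → ℂ} {z : ℂ} (h : AnalyticAt ℂ q z) : HasRemovable q z :=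
  ⟨q, h, .rfl⟩

theorem eq_of_eventuallyEq_nhdsNE {f g : ℂ → ℂ} {z : ℂ} (hf : ContinuousAt f z)
    (hg : ContinuousAt g z) (h : f =ᶠ[𝓝[≠] z] g) : f z = g z :=
  tendsto_nhds_unique ((hf.tendsto.mono_left nhdsWithin_le_nhds).congr' h)
    (hg.tendsto.mono_left nhdsWithin_le_nhds)

theorem tendsto_add_const_nhdsNE (z ω : ℂ) : Tendsto (fun w => w + ω) (𝓝[≠] z) (𝓝[≠] (z + ω)) := by
  refine tendsto_nhdsWithin_iff.mpr ⟨?_, ?_⟩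
  · exact ((continuous_id.add continuous_const).tendsto z).mono_left nhdsWithin_le_nhds
  · filter_upwards [self_mem_nhdsWithin] with w hw
    simpa using hw

/-- A function with removable singularities only extends to an entire function. -/
theorem exists_entire_of_hasRemovable {q : ℂ → ℂ} (hq : ∀ z, HasRemovable q z) :
    ∃ Q : ℂ → ℂ, Differentiable ℂ Q ∧ ∀ z, q =ᶠ[𝓝[≠] z] Q := by
  -- The extension is the punctured limit at every point, so the values of `q` at its singularities
  -- are irrelevant.
  have key : ∀ z, ∀ g : ℂ → ℂ, AnalyticAt ℂ g z → q =ᶠ[𝓝[≠] z] g →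
      (fun z => limUnder (𝓝[≠] z) q) =ᶠ[𝓝 z] g := by
    intro z g hg hqg
    have h1 : ∀ᶠ w in 𝓝 z, AnalyticAt ℂ g w := hg.eventually_analyticAt
    have h2 : ∀ᶠ w in 𝓝 z, ∀ᶠ u in 𝓝[≠] w, q u = g u := by
      have h3 : ∀ᶠ w in 𝓝[≠] z, ∀ᶠ u in 𝓝[≠] w, q u = g u := by
        have h4 := eventually_eventually_nhdsWithin.mpr hqg
        filter_upwards [h4, self_mem_nhdsWithin] with w hw hwz
        have h6 : 𝓝[{z}ᶜ] w = 𝓝 w := (isOpen_compl_singleton).nhdsWithin_eq hwz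
        rw [h6] at hw
        exact hw.filter_mono nhdsWithin_le_nhds
      rw [eventually_nhdsWithin_iff] at h3
      filter_upwards [h3] with w hw
      by_cases hwz : w = z
      · rw [hwz]; exact hqg
      · exact hw hwz
    filter_upwards [h1, h2] with w hw1 hw2
    exact ((hw1.continuousAt.tendsto.mono_left nhdsWithin_le_nhds).congr'
      (EventuallyEq.symm hw2)).limUnder_eq
  refine ⟨fun z => limUnder (𝓝[≠] z) q, fun z => ?_, fun z => ?_⟩
  · obtain ⟨g, hg, hqg⟩ := hq z
    exact hg.differentiableAt.congr_of_eventuallyEq (key z g hg hqg)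
  · obtain ⟨g, hg, hqg⟩ := hq z
    exact hqg.trans ((key z g hg hqg).filter_mono nhdsWithin_le_nhds).symm

theorem add_eq_of_eventually {q Q A : ℂ → ℂ} {ω : ℂ} (hQ : Continuous Q) (hA : Continuous A)
    (hqQ : ∀ z, q =ᶠ[𝓝[≠] z] Q) (h : ∀ z, ∀ᶠ w in 𝓝[≠] z, q (w + ω) = q w + A w) (z : ℂ) :
    Q (z + ω) = Q z + A z := by
  refine eq_of_eventuallyEq_nhdsNE (f := fun z => Q (z + ω)) (g := fun z => Q z + A z)
    (hQ.comp (continuous_id.add continuous_const)).continuousAt (hQ.add hA).continuousAt ?_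
  filter_upwards [h z, hqQ z, (tendsto_add_const_nhdsNE z ω).eventually (hqQ (z + ω))]
    with w h1 h2 h3
  rw [← h3, h1, h2]

/-- Removability is transported by translations, and is phrased as periodicity of a predicate so
that one representative in each lattice class suffices. -/
theorem periodic_hasRemovable {q A : ℂ → ℂ} {ω : ℂ} (hA : Differentiable ℂ A)
    (h : ∀ z, ∀ᶠ w in 𝓝[≠] z, q (w + ω) = q w + A w) :
    Function.Periodic (HasRemovable q) ω := by
  intro z
  apply propext
  constructor
  · rintro ⟨g, hg, hqg⟩
    refine ⟨fun w => g (w + ω) - A w, ?_, ?_⟩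
    · exact (AnalyticAt.fun_comp (f := fun w => w + ω) hg (by fun_prop)).sub (hA.analyticAt z)
    · filter_upwards [h z, (tendsto_add_const_nhdsNE z ω).eventually hqg] with w h1 h2
      rw [← h2, h1, add_sub_cancel_right]
  · rintro ⟨g, hg, hqg⟩
    have hs : z + ω + -ω = z := by ring
    refine ⟨fun w => g (w + -ω) + A (w + -ω), ?_, ?_⟩
    · rw [← hs] at hg
      exact (AnalyticAt.fun_comp (f := fun w => w + -ω) hg (by fun_prop)).add
        (AnalyticAt.fun_comp (f := fun w => w + -ω) (hA.analyticAt _) (by fun_prop))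
    · have ht := tendsto_add_const_nhdsNE (z + ω) (-ω)
      rw [hs] at ht
      filter_upwards [ht.eventually (h z), ht.eventually hqg] with w h1 h2
      rw [neg_add_cancel_right] at h1
      rw [h1, h2]

/-! ### Liouville's theorem, and the increments of `∂ ln σ / ∂τ` along the periods. -/

namespace WeierstrassTau

variable {τ z : ℂ}

/-- The codomain is arbitrary so that `f` may be the predicate `HasRemovable q`. -/
theorem periodic_of_mem_latt {α : Type*} {f : ℂ → α} (h1 : Function.Periodic f 1)
    (h2 : Function.Periodic f τ) {ω : ℂ} (hω : ω ∈ latt τ) : Function.Periodic f ω := by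
  obtain ⟨p, rfl⟩ := hω
  have := (h1.int_mul p.1).add_period (h2.int_mul p.2)
  simpa [per] using this

/-- An entire elliptic function is constant. -/
theorem eq_of_periodic (hτ : 0 < τ.im) {Q : ℂ → ℂ} (hQ : Differentiable ℂ Q)
    (h1 : Function.Periodic Q 1) (h2 : Function.Periodic Q τ) (z w : ℂ) : Q z = Q w := by
  refine hQ.apply_eq_apply_of_bounded (IsZLattice.isCompact_range_of_periodic
    (PeriodPair.ofTau ⟨τ, hτ⟩).lattice _ hQ.continuous fun z w hw => ?_).isBounded z w
  exact periodic_of_mem_latt h1 h2 ((mem_lattice ⟨τ, hτ⟩ w).mp hw) z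

/-- An entire function whose increments along the periods are constant is affine, and
so has constant derivative. -/
theorem deriv_eq_of_add (hτ : 0 < τ.im) {Q : ℂ → ℂ} (hQ : Differentiable ℂ Q) {α β : ℂ}
    (h1 : ∀ z, Q (z + 1) = Q z + α) (h2 : ∀ z, Q (z + τ) = Q z + β) (z w : ℂ) :
    deriv Q z = deriv Q w := by
  have hper : ∀ ω c, (∀ z, Q (z + ω) = Q z + c) → Function.Periodic (deriv Q) ω := by
    intro ω c h z
    rw [← deriv_comp_add_const, funext h, deriv_add_const]
  exact eq_of_periodic hτ hQ.deriv (hper 1 α h1) (hper τ β h2) z w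

/-- Only the existence of `dη₁/dτ` matters: its value enters the increments below in affine terms
and drops out at the end. -/
theorem differentiableAt_zet_half (hτ : 0 < τ.im) :
    DifferentiableAt ℂ (fun w => zet (1 / 2) w) τ := by
  obtain ⟨F, h0F, hF⟩ := exists_finset_norm_per hτ 1 one_pos
  have hU : ∀ w ∈ Metric.ball τ (τ.im / 2), ‖w - τ‖ < τ.im / 2 := fun w hw => by
    simpa [dist_eq_norm] using hw
  have hd : ∀ p, ∀ w : ℂ, 0 < w.im → DifferentiableAt ℂ (fun w => zetTerm (1 / 2) w p) w := by
    intro p w hw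
    by_cases hp : p = 0
    · simp [hp, zetTerm]
    · have h0 : per w p ≠ 0 := (per_eq_zero_iff hw p).not.mpr hp
      have h1 : 1 / 2 - per w p ≠ 0 :=
        sub_ne_zero.mpr (notMem_latt_iff.mp (half_notMem_latt hw) p).symm
      have h2 : DifferentiableAt ℂ (fun w => per w p) w := by unfold per; fun_prop
      have h3 : per w p ^ 2 ≠ 0 := pow_ne_zero _ h0
      unfold zetTerm
      exact (((differentiableAt_const _).div (h2.const_sub _) h1).add
        ((differentiableAt_const _).div h2 h0)).add ((differentiableAt_const _).div (h2.pow 2) h3)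
  refine (Complex.differentiableAt_tsum_of_finset (f := fun p w => zetTerm (1 / 2) w p)
    (U := Metric.ball τ (τ.im / 2)) Metric.isOpen_ball F
    ((summable_norm_per hτ).mul_left (2 * 1 ^ 2 * 8)) (fun p hp w hw => ?_)
    (fun p hp w hw => (hd p w (im_pos_of_norm_sub_lt (hU w hw))).differentiableWithinAt)
    (by simpa using hτ) fun p _ => hd p τ hτ).1
  refine (norm_zetTerm_le (R := 1) (by norm_num) one_pos (hF p hp w (hU w hw))).trans ?_
  have h4 := norm_per_le hτ (hU w hw) p
  have h5 : 0 < ‖per τ p‖ := by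
    rw [norm_pos_iff, Ne, per_eq_zero_iff hτ]; rintro rfl; exact hp h0F
  have : (‖per w p‖ ^ 3)⁻¹ ≤ 8 * (‖per τ p‖ ^ 3)⁻¹ := by
    calc (‖per w p‖ ^ 3)⁻¹ ≤ ((‖per τ p‖ / 2) ^ 3)⁻¹ := by
          gcongr; linarith
      _ = _ := by field_simp; norm_num
  linarith

/-- This is the logarithmic `τ`-derivative of `sig_add` for the fixed period `1`. -/
theorem dtau_add_one (hτ : 0 < τ.im) (hz : z ∉ latt τ) :
    dtau (z + 1) τ = dtau z τ + deriv (fun w => 2 * zet (1 / 2) w) τ * (z + 1 / 2) := by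
  have hz1 : z + 1 ∉ latt τ := by rwa [add_mem_latt_iff (one_mem_latt τ)]
  have hη : HasDerivAt (fun w => 2 * zet (1 / 2) w) (deriv (fun w => 2 * zet (1 / 2) w) τ) τ :=
    ((differentiableAt_zet_half hτ).const_mul 2).hasDerivAt
  have h1 := hasDerivAt_sig_tau hτ hz1
  have h2 := (hη.mul_const (z + 1 / 2)).cexp.neg.mul (hasDerivAt_sig_tau hτ hz)
  have hev : (fun w => sig (z + 1) w) =ᶠ[𝓝 τ]
      fun w => -exp (2 * zet (1 / 2) w * (z + 1 / 2)) * sig z w := by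
    filter_upwards [(isOpen_lt continuous_const Complex.continuous_im).mem_nhds hτ] with w hw
    exact sig_add hw (one_mem_latt w) (half_notMem_latt hw) z
  have h3 := h1.unique (h2.congr_of_eventuallyEq hev)
  have h4 := hev.eq_of_nhds
  have h5 : sig (z + 1) τ ≠ 0 := fun h => hz1 ((sig_eq_zero_iff_mem hτ).mp h)
  apply mul_left_cancel₀ h5
  rw [h3]
  simp only [Pi.neg_apply]
  rw [h4]
  ring

/-- Here the period moves with `τ`, so the total derivative of `σ(z + w, w)` also produces a `ζ`
term. Legendre's relation expresses `η₂` through `η₁`, so only `η₁` is differentiated. -/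
theorem dtau_add_tau (hτ : 0 < τ.im) (hz : z ∉ latt τ) :
    dtau (z + τ) τ = dtau z τ - zet z τ - zet (τ / 2) τ +
      (deriv (fun w => 2 * zet (1 / 2) w) τ * τ + 2 * zet (1 / 2) τ) * (z + τ / 2) := by
  have hz1 : z + τ ∉ latt τ := by rwa [add_mem_latt_iff (tau_mem_latt τ)]
  have hη : HasDerivAt (fun w => 2 * zet (1 / 2) w) (deriv (fun w => 2 * zet (1 / 2) w) τ) τ :=
    ((differentiableAt_zet_half hτ).const_mul 2).hasDerivAt
  have h1 : HasDerivAt (fun w => sig (z + w) w)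
      (sig (z + τ) τ * (zet (z + τ) τ + dtau (z + τ) τ)) τ := by
    have h := hasFDerivAt_sig (q := (z + τ, τ)) hτ (notMem_latt_iff.mp hz1)
    have h2 : HasDerivAt (fun w : ℂ => (z + w, w)) (1, 1) τ :=
      ((hasDerivAt_id τ).const_add z).prodMk (hasDerivAt_id τ)
    simpa [mul_add] using! HasFDerivAt.comp_hasDerivAt (f := fun w : ℂ => (z + w, w)) τ h h2
  have h2 := ((((hη.mul (hasDerivAt_id τ)).sub_const (2 * Real.pi * I)).mul
    (((hasDerivAt_id τ).div_const 2).const_add z))).cexp.neg.mul (hasDerivAt_sig_tau hτ hz)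
  have hev : (fun w => sig (z + w) w) =ᶠ[𝓝 τ] fun w =>
      -exp ((2 * zet (1 / 2) w * w - 2 * Real.pi * I) * (z + w / 2)) * sig z w := by
    filter_upwards [(isOpen_lt continuous_const Complex.continuous_im).mem_nhds hτ] with w hw
    rw [sig_add hw (tau_mem_latt w) (half_tau_notMem_latt hw) z, ← legendre hw]
    ring_nf
  have h3 := h1.unique (h2.congr_of_eventuallyEq hev)
  have h4 := hev.eq_of_nhds
  have h5 : sig (z + τ) τ ≠ 0 := fun h => hz1 ((sig_eq_zero_iff_mem hτ).mp h)
  have h6 : zet (z + τ) τ + dtau (z + τ) τ = dtau z τ + zet (τ / 2) τ +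
      (deriv (fun w => 2 * zet (1 / 2) w) τ * τ + 2 * zet (1 / 2) τ) * (z + τ / 2) := by
    apply mul_left_cancel₀ h5
    rw [h3]
    simp only [Pi.neg_apply, Pi.mul_apply, id]
    rw [h4, ← legendre hτ]
    ring
  rw [zet_add hτ (tau_mem_latt τ) (half_tau_notMem_latt hτ) hz] at h6
  linear_combination h6

end WeierstrassTau

/-! ### The closed formula for `∂ ln σ / ∂ω₂`. -/

namespace WeierstrassTau

variable {z : ℂ}

theorem eta₁_eq (τ : ℍ) : (PeriodPair.ofTau τ).eta₁ = 2 * zet (1 / 2) τ := by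
  rw [PeriodPair.eta₁, show (PeriodPair.ofTau τ).ω₁ = 1 from rfl,
    zeta_eq τ _ (half_notMem_latt τ.im_pos)]

theorem weierstrassP_eq (τ : ℍ) (hz : z ∉ latt τ) :
    (PeriodPair.ofTau τ).weierstrassP z =
      1 / z ^ 2 - 3 * z ^ 2 * zetReg z τ - z ^ 3 * deriv (fun z => zetReg z τ) z := by
  have hz0 : z ≠ 0 := by rintro rfl; exact hz (zero_mem_latt τ)
  have h1 := hasDerivAt_zet τ hz
  have h2 : HasDerivAt (fun z => 1 / z + z ^ 3 * zetReg z τ)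
      (-1 / z ^ 2 + (3 * z ^ 2 * zetReg z τ + z ^ 3 * deriv (fun z => zetReg z τ) z)) z := by
    have h3 := (hasDerivAt_inv hz0).add ((hasDerivAt_pow 3 z).mul
      (differentiableAt_zetReg τ.im_pos fun p _ => notMem_latt_iff.mp hz p).hasDerivAt)
    simpa [neg_div] using! h3
  have hev : (fun z => zet z τ) =ᶠ[𝓝 z] fun z => 1 / z + z ^ 3 * zetReg z τ := by
    filter_upwards [(isOpen_compl_latt τ.im_pos).mem_nhds hz] with w hw using zet_eq τ.im_pos hw
  have h4 := h1.unique (h2.congr_of_eventuallyEq hev)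
  linear_combination -h4

theorem analyticAt_of_notMem {f : ℂ → ℂ} {τ : ℂ} (hτ : 0 < τ.im)
    (hf : ∀ z ∉ latt τ, DifferentiableAt ℂ f z) (hz : z ∉ latt τ) : AnalyticAt ℂ f z :=
  DifferentiableOn.analyticAt (s := (latt τ)ᶜ)
    (fun w hw => (hf w hw).differentiableWithinAt) ((isOpen_compl_latt hτ).mem_nhds hz)

theorem eventually_per_ne {τ : ℂ} (hτ : 0 < τ.im) : ∀ᶠ w in 𝓝 (0 : ℂ), ∀ p ≠ 0, per τ p ≠ w := by
  have h := eventually_notMem_latt hτ 0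
  rw [eventually_nhdsWithin_iff] at h
  filter_upwards [h] with w hw p hp h0
  by_cases hw0 : w = 0
  · rw [hw0, per_eq_zero_iff hτ] at h0; exact hp h0
  · exact hw hw0 ⟨p, h0⟩

theorem analyticAt_zetReg_zero {τ : ℂ} (hτ : 0 < τ.im) :
    AnalyticAt ℂ (fun z => zetReg z τ) 0 := by
  rw [Complex.analyticAt_iff_eventually_differentiableAt]
  filter_upwards [eventually_per_ne hτ] with w hw using differentiableAt_zetReg hτ hw

theorem analyticAt_dtauReg_zero {τ : ℂ} (hτ : 0 < τ.im) :
    AnalyticAt ℂ (fun z => dtauReg z τ) 0 := by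
  rw [Complex.analyticAt_iff_eventually_differentiableAt]
  filter_upwards [eventually_per_ne hτ] with w hw using differentiableAt_dtauReg hτ hw

/-- The formula for `∂ ln σ / ∂ ω₂`. -/
theorem dtau_eq_dLnSigma₂ (τ : ℍ) (hz : z ∉ latt τ) :
    dtau z τ = (PeriodPair.ofTau τ).dLnSigma₂ z := by
  have hτ := τ.im_pos
  set L := PeriodPair.ofTau τ with hL
  set η₁ : ℂ := 2 * zet (1 / 2) τ with hη₁
  set η₂ : ℂ := 2 * zet (τ / 2) τ with hη₂
  set κ : ℂ := 1 / (4 * Real.pi * I) with hκ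
  set δ : ℂ := deriv (fun w => 2 * zet (1 / 2) w) τ with hδ
  have hleg : η₁ * τ - η₂ = 2 * Real.pi * I := legendre hτ
  have hpi : (Real.pi : ℂ) ≠ 0 := by exact_mod_cast Real.pi_ne_zero
  have hκ2 : 2 * κ * (η₁ * τ - η₂) = 1 := by
    rw [hleg, hκ]
    have := I_ne_zero
    field_simp
    norm_num
  -- The combination is chosen so that `ζ` disappears from both increments: along `1` the terms
  -- `∓2η₁ζ` cancel, and along `τ` the factor `κ` makes Legendre's relation absorb the `-ζ` coming
  -- from `dtau`.
  set Y : ℂ → ℂ := fun z =>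
    dtau z τ + κ * (L.weierstrassP z - zet z τ ^ 2 + 2 * η₁ * (z * zet z τ - 1)) with hY
  -- increments
  set A₁ : ℂ → ℂ := fun z => δ * (z + 1 / 2) + κ * (2 * η₁ ^ 2 * z + η₁ ^ 2) with hA₁
  set A₂ : ℂ → ℂ := fun z => -(η₂ / 2) + (δ * τ + η₁) * (z + τ / 2) +
    κ * (-η₂ ^ 2 + 2 * η₁ * (z * η₂ + τ * η₂)) with hA₂
  have hinc₁ : ∀ z, ∀ᶠ w in 𝓝[≠] z, Y (w + 1) = Y w + A₁ w := by
    intro z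
    filter_upwards [eventually_notMem_latt hτ z] with w hw
    have h1 := L.weierstrassP_add_coe w ⟨1, (mem_lattice τ 1).mpr (one_mem_latt τ)⟩
    simp only at h1
    simp only [hY, hA₁, dtau_add_one hτ hw, h1,
      zet_add hτ (one_mem_latt τ) (half_notMem_latt hτ) hw, ← hη₁, ← hδ]
    ring
  have hinc₂ : ∀ z, ∀ᶠ w in 𝓝[≠] z, Y (w + τ) = Y w + A₂ w := by
    intro z
    filter_upwards [eventually_notMem_latt hτ z] with w hw
    have h1 := L.weierstrassP_add_coe w ⟨τ, (mem_lattice τ τ).mpr (tau_mem_latt τ)⟩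
    simp only at h1
    simp only [hY, hA₂, dtau_add_tau hτ hw, h1,
      zet_add hτ (tau_mem_latt τ) (half_tau_notMem_latt hτ) hw, ← hη₁, ← hη₂, ← hδ]
    linear_combination zet w τ * hκ2
  have hdA₁ : Differentiable ℂ A₁ := by fun_prop
  have hdA₂ : Differentiable ℂ A₂ := by fun_prop
  -- behaviour at the origin
  set v : ℂ → ℂ := fun z => zetReg z τ with hv
  -- Inserting `ζ = 1/z + z³ v` cancels the double poles of `℘` and `ζ²`, and `zζ - 1 = z⁴ v`; what
  -- remains is divisible by `z²`.
  set W : ℂ → ℂ := fun z => z * dtauReg z τ -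
    κ * (5 * v z + z * deriv v z + z ^ 4 * v z ^ 2) + κ * 2 * η₁ * z ^ 2 * v z with hW
  have hWa : AnalyticAt ℂ W 0 := by
    have h1 := analyticAt_zetReg_zero hτ
    have h2 := analyticAt_dtauReg_zero hτ
    have h3 := h1.deriv
    fun_prop
  have hYW : Y =ᶠ[𝓝[≠] 0] fun z => z ^ 2 * W z := by
    filter_upwards [eventually_notMem_latt hτ 0, self_mem_nhdsWithin] with w hw hw0
    have hw0 : w ≠ 0 := hw0
    simp only [hY, hW, dtau_eq, weierstrassP_eq τ hw, hL, zet_eq hτ hw, hv]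
    field_simp
    ring
  have h0 : HasRemovable Y 0 := ⟨_, (analyticAt_id.pow 2).mul hWa, hYW⟩
  have hrem : ∀ z, HasRemovable Y z := by
    intro z
    by_cases hz : z ∈ latt τ
    · have := periodic_of_mem_latt (periodic_hasRemovable hdA₁ hinc₁)
        (periodic_hasRemovable hdA₂ hinc₂) hz 0
      rw [zero_add] at this
      rw [this]; exact h0
    · refine (analyticAt_of_notMem hτ (fun w hw => ?_) hz).hasRemovable
      have h1 := differentiableAt_dtau hτ hw
      have h2 := differentiableAt_zet hτ hw
      have h3 : DifferentiableAt ℂ L.weierstrassP w := (L.analyticOnNhd_weierstrassP w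
        (fun h => hw ((mem_lattice τ w).mp h))).differentiableAt
      fun_prop
  obtain ⟨Q, hQ, hYQ⟩ := exists_entire_of_hasRemovable hrem
  have hQ₁ := add_eq_of_eventually hQ.continuous hdA₁.continuous hYQ hinc₁
  have hQ₂ := add_eq_of_eventually hQ.continuous hdA₂.continuous hYQ hinc₂
  have hderiv : ∀ (ω : ℂ) (A : ℂ → ℂ) (a : ℂ), (∀ z, HasDerivAt A a z) →
      (∀ z, Q (z + ω) = Q z + A z) → ∀ z, deriv Q (z + ω) = deriv Q z + a := by
    intro ω A a hA h z
    rw [← deriv_comp_add_const, funext h]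
    exact ((hQ z).hasDerivAt.add (hA z)).deriv
  -- Affine increments of `Q` are constant increments of `Q'`, so `Q''` is constant and `Q` is
  -- determined by its 2-jet at the origin.
  have hc := deriv_eq_of_add hτ hQ.deriv
    (hderiv 1 A₁ (δ + κ * (2 * η₁ ^ 2)) (fun z => by
      have := (((hasDerivAt_id z).add_const (1 / 2)).const_mul δ).add
        ((((hasDerivAt_id z).const_mul (2 * η₁ ^ 2)).add_const (η₁ ^ 2)).const_mul κ)
      exact this.congr_deriv (by simp)) hQ₁)
    (hderiv τ A₂ ((δ * τ + η₁) + κ * (2 * η₁ * η₂)) (fun z => by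
      have := ((((hasDerivAt_id z).add_const (τ / 2 : ℂ)).const_mul (δ * τ + η₁)).const_add
        (-(η₂ / 2))).add
        ((((((hasDerivAt_id z).mul_const η₂).add_const (τ * η₂)).const_mul
        (2 * η₁)).const_add (-η₂ ^ 2)).const_mul κ)
      simpa using! this) hQ₂)
  -- the values of `Q` and its derivatives at the origin
  have hQW : Q =ᶠ[𝓝 0] fun z => z ^ 2 * W z := by
    have h1 : Q =ᶠ[𝓝[≠] 0] fun z => z ^ 2 * W z := (hYQ 0).symm.trans hYW
    have h2 := eq_of_eventuallyEq_nhdsNE hQ.continuous.continuousAt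
      ((continuousAt_id.pow 2).mul hWa.continuousAt) h1
    rw [EventuallyEq, eventually_nhdsWithin_iff] at h1
    filter_upwards [h1] with w hw
    by_cases hw0 : w = 0
    · rw [hw0]; exact h2
    · exact hw hw0
  have hQ0 : Q 0 = 0 := by rw [hQW.eq_of_nhds]; simp
  have hQ' : deriv Q =ᶠ[𝓝 0] fun z => z * (2 * W z + z * deriv W z) := by
    filter_upwards [hQW.eventuallyEq_nhds, hWa.eventually_analyticAt] with w hw hw2
    rw [hw.deriv_eq]
    have := ((hasDerivAt_pow 2 w).mul hw2.differentiableAt.hasDerivAt).deriv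
    refine this.trans ?_
    simp
    ring
  have hQ'0 : deriv Q 0 = 0 := by rw [hQ'.eq_of_nhds]; simp
  have hQ'' : deriv (deriv Q) 0 = 2 * W 0 := by
    rw [hQ'.deriv_eq]
    have h3 := hWa.deriv.differentiableAt
    have h4 := hWa.differentiableAt
    have h5 : DifferentiableAt ℂ (fun z => 2 * W z + z * deriv W z) 0 := by fun_prop
    have := ((hasDerivAt_id (0 : ℂ)).mul h5.hasDerivAt).deriv
    refine this.trans ?_
    simp
  have hW0 : W 0 = 5 * κ * L.G 4 := by
    simp only [hW, hv, zetReg_zero]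
    ring
  have hlin : ∀ z, deriv Q z = 2 * W 0 * z := by
    intro z
    have h := is_const_of_deriv_eq_zero (f := fun z => deriv Q z - 2 * W 0 * z)
      (hQ.deriv.sub (differentiable_id.const_mul _)) (fun w => by
        have := ((hQ.deriv w).hasDerivAt.sub ((hasDerivAt_id w).const_mul (2 * W 0))).deriv
        refine this.trans ?_
        rw [hc w 0, hQ'']; ring) z 0
    simp only [hQ'0, mul_zero, sub_zero] at h
    linear_combination h
  have hquad : ∀ z, Q z = W 0 * z ^ 2 := by
    intro z
    have h := is_const_of_deriv_eq_zero (f := fun z => Q z - W 0 * z ^ 2)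
      (hQ.sub ((differentiable_id.pow 2).const_mul _)) (fun w => by
        have := ((hQ w).hasDerivAt.sub ((hasDerivAt_pow 2 w).const_mul (W 0))).deriv
        refine this.trans ?_
        rw [hlin]; simp; ring) z 0
    simp only [hQ0] at h
    linear_combination h
  have hYz : Y z = W 0 * z ^ 2 := by
    rw [← hquad z]
    refine eq_of_eventuallyEq_nhdsNE ?_ hQ.continuous.continuousAt (hYQ z)
    have h1 := differentiableAt_dtau hτ hz
    have h2 := differentiableAt_zet hτ hz
    have h3 : DifferentiableAt ℂ L.weierstrassP z := (L.analyticOnNhd_weierstrassP z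
      (fun h => hz ((mem_lattice τ z).mp h))).differentiableAt
    have : DifferentiableAt ℂ Y z := by fun_prop
    exact this.continuousAt
  have hκ' : 1 / (2 * Real.pi * I) = 2 * κ := by
    rw [hκ]
    have := I_ne_zero
    field_simp
    norm_num
  rw [PeriodPair.dLnSigma₂, hκ', zeta_eq τ z hz, eta₁_eq, ← hη₁, PeriodPair.g₂,
    show L.ω₁ = 1 from rfl]
  rw [hW0] at hYz
  simp only [hY] at hYz
  linear_combination hYz

end WeierstrassTau

/-! ### The product formula for `f'`. -/

theorem AnalyticAt.exists_eq_sub_mul {g : ℂ → ℂ} {z₀ : ℂ} (hg : AnalyticAt ℂ g z₀) (h0 : g z₀ = 0) :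
    ∃ u : ℂ → ℂ, AnalyticAt ℂ u z₀ ∧ ∀ z, g z = (z - z₀) * u z := by
  obtain ⟨p, hp⟩ := hg
  refine ⟨dslope g z₀, (hp.has_fpower_series_dslope_fslope).analyticAt, fun z => ?_⟩
  have := sub_smul_dslope g z₀ z
  rw [smul_eq_mul, h0, sub_zero] at this
  exact this.symm

namespace WeierstrassTau

theorem analyticAt_sig {τ : ℂ} (hτ : 0 < τ.im) (z : ℂ) : AnalyticAt ℂ (fun z => sig z τ) z :=
  (differentiable_sig hτ).analyticAt z

theorem analyticAt_sig_sub {τ : ℂ} (hτ : 0 < τ.im) (a z : ℂ) :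
    AnalyticAt ℂ (fun z => sig (z - a) τ) z :=
  Differentiable.analyticAt (fun z => (differentiable_sig hτ _).comp z (by fun_prop)) z

theorem analyticAt_sigDiv_sub {τ : ℂ} (hτ : 0 < τ.im) (a z : ℂ) :
    AnalyticAt ℂ (fun z => sigDiv (z - a) τ) z :=
  Differentiable.analyticAt (fun z => (differentiable_sigDiv hτ _).comp z (by fun_prop)) z

theorem analyticAt_zet {τ : ℂ} (hτ : 0 < τ.im) {z : ℂ} (hz : z ∉ latt τ) :
    AnalyticAt ℂ (fun z => zet z τ) z :=
  analyticAt_of_notMem hτ (fun _ hw => differentiableAt_zet hτ hw) hz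

theorem analyticAt_zet_sub {τ : ℂ} (hτ : 0 < τ.im) {a z : ℂ} (hz : z - a ∉ latt τ) :
    AnalyticAt ℂ (fun z => zet (z - a) τ) z :=
  AnalyticAt.fun_comp (f := fun z => z - a) (analyticAt_zet hτ hz) (by fun_prop)

section EllipticFunction

variable {τ : ℍ} {n : ℕ} {f : ℂ → ℂ} {a : Fin (n + 1) → ℂ}

theorem analyticAt_of_elliptic (hell : IsEllipticPoleAtZero (PeriodPair.ofTau τ) n f) {z : ℂ}
    (hz : z ∉ latt τ) : AnalyticAt ℂ f z := by
  have h := hell.differentiableOn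
  simp only [mem_lattice] at h
  exact h.analyticAt ((isOpen_compl_latt τ.im_pos).mem_nhds hz)

theorem deriv_add_of_elliptic (hell : IsEllipticPoleAtZero (PeriodPair.ofTau τ) n f) {z ω : ℂ}
    (hz : z ∉ latt τ) (hω : ω ∈ latt τ) : deriv f (z + ω) = deriv f z := by
  rw [← deriv_comp_add_const]
  refine Filter.EventuallyEq.deriv_eq ?_
  filter_upwards [(isOpen_compl_latt τ.im_pos).mem_nhds hz] with w hw
  exact hell.periodic ω ((mem_lattice τ ω).mpr hω) w fun h => hw ((mem_lattice τ w).mp h)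

theorem exists_pole_form (hn : n ≠ 0) (hell : IsEllipticPoleAtZero (PeriodPair.ofTau τ) n f) :
    ∃ G : ℂ → ℂ, AnalyticAt ℂ G 0 ∧ G 0 ≠ 0 ∧ ∀ᶠ z in 𝓝[≠] 0, z ^ n * f z = G z := by
  have hm : MeromorphicAt f 0 := by
    -- A function that is not meromorphic has order `0` by default, so `n ≠ 0` is what makes the
    -- order condition give meromorphy.
    by_contra h
    have := hell.order_eq
    rw [meromorphicOrderAt_of_not_meromorphicAt h] at this
    have h0 : (-(n : ℤ) : ℤ) = 0 := by exact_mod_cast this.symm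
    omega
  obtain ⟨G, hG, hG0, h⟩ := (meromorphicOrderAt_eq_int_iff hm).mp hell.order_eq
  refine ⟨G, hG, hG0, ?_⟩
  filter_upwards [h, self_mem_nhdsWithin] with z hz hz0
  have hz0 : z ≠ 0 := hz0
  rw [hz, sub_zero, zpow_neg, zpow_natCast, smul_eq_mul]
  field_simp


/-- The leading term of the derivative at the pole. -/
theorem exists_deriv_pole_form {G : ℂ → ℂ} (hell : IsEllipticPoleAtZero (PeriodPair.ofTau τ) n f)
    (hG : AnalyticAt ℂ G 0) (h : ∀ᶠ z in 𝓝[≠] 0, z ^ n * f z = G z) :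
    ∃ P : ℂ → ℂ, AnalyticAt ℂ P 0 ∧ P 0 = -(n * G 0) ∧
      ∀ᶠ z in 𝓝[≠] 0, z ^ (n + 1) * deriv f z = P z := by
  refine ⟨fun z => z * deriv G z - n * G z, ?_, by simp, ?_⟩
  · have := hG.deriv
    fun_prop
  · filter_upwards [eventually_eventually_nhdsWithin.mpr h, self_mem_nhdsWithin,
      eventually_notMem_latt τ.im_pos 0, eventually_nhdsWithin_of_eventually_nhds
        hG.eventually_analyticAt] with z hz hz0 hzl hGz
    have hz0 : z ≠ 0 := hz0
    rw [isOpen_compl_singleton.nhdsWithin_eq hz0] at hz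
    have h1 := (hasDerivAt_pow n z).mul
      (analyticAt_of_elliptic hell hzl).differentiableAt.hasDerivAt
    have h2 := h1.unique (hGz.differentiableAt.hasDerivAt.congr_of_eventuallyEq hz)
    rw [← h2, ← hz.self_of_nhds]
    rcases n with _ | m
    · simp
    · simp
      ring

/-- The factors `exp(-η a_k)` multiply to `1` because `∑ a_k = 0`; the remaining multiplier is that
of `σ^(n+1)`. -/
theorem prod_sig_add {η ω z : ℂ} (hsum : ∑ k, a k = 0)
    (h : ∀ z, sig (z + ω) τ = -exp (η * (z + ω / 2)) * sig z τ) :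
    ∏ k, sig (z + ω - a k) τ =
      (-exp (η * (z + ω / 2))) ^ (n + 1) * ∏ k, sig (z - a k) τ := by
  have h1 : ∀ k, sig (z + ω - a k) τ = (-exp (η * (z + ω / 2))) * exp (-η * a k) *
      sig (z - a k) τ := by
    intro k
    rw [show z + ω - a k = z - a k + ω by ring, h, neg_mul (exp _) (exp _), ← exp_add]
    ring_nf
  simp only [h1, Finset.prod_mul_distrib]
  rw [← exp_sum, ← Finset.mul_sum, hsum]
  simp

theorem sig_sub_ne_zero (hcrit : IsSimpleCriticalSystem (PeriodPair.ofTau τ) f a) {j k : Fin (n + 1)}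
    (hjk : j ≠ k) : sig (a j - a k) τ ≠ 0 := by
  rw [Ne, sig_eq_zero_iff_mem τ.im_pos, ← mem_lattice]
  exact hcrit.incongruent j k hjk

theorem notMem_of_crit (hcrit : IsSimpleCriticalSystem (PeriodPair.ofTau τ) f a) (k : Fin (n + 1)) :
    a k ∉ latt τ := fun h => hcrit.notMem k ((mem_lattice τ _).mpr h)

theorem sig_crit_ne_zero (hcrit : IsSimpleCriticalSystem (PeriodPair.ofTau τ) f a)
    (k : Fin (n + 1)) : sig (a k) τ ≠ 0 := by
  rw [Ne, sig_eq_zero_iff_mem τ.im_pos]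
  exact notMem_of_crit hcrit k

/-- The product formula for the derivative of `f`. -/
theorem deriv_eq_prod_sig {G : ℂ → ℂ} (hell : IsEllipticPoleAtZero (PeriodPair.ofTau τ) n f)
    (hcrit : IsSimpleCriticalSystem (PeriodPair.ofTau τ) f a)
    (hG : AnalyticAt ℂ G 0) (h : ∀ᶠ z in 𝓝[≠] 0, z ^ n * f z = G z) {z : ℂ} (hz : z ∉ latt τ) :
    deriv f z = -(n * G 0) / (∏ k, sig (-a k) τ) * (∏ k, sig (z - a k) τ) / sig z τ ^ (n + 1) := by
  have hτ := τ.im_pos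
  obtain ⟨P, hP, hP0, hPf⟩ := exists_deriv_pole_form hell hG h
  set q : ℂ → ℂ := fun z => deriv f z * sig z τ ^ (n + 1) / ∏ k, sig (z - a k) τ with hq
  have hprod0 : ∏ k, sig (-a k) τ ≠ 0 := Finset.prod_ne_zero_iff.mpr fun k _ => by
    rw [sig_neg, neg_ne_zero]; exact sig_crit_ne_zero hcrit k
  have hprodA : ∀ z, AnalyticAt ℂ (fun z => ∏ k, sig (z - a k) τ) z := fun z =>
    Finset.analyticAt_fun_prod _ fun k _ => analyticAt_sig_sub hτ (a k) z
  have hinc : ∀ ω ∈ latt τ, ω / 2 ∉ latt τ → ∀ z, ∀ᶠ w in 𝓝[≠] z, q (w + ω) = q w + 0 := by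
    intro ω hω hω2 z
    filter_upwards [eventually_notMem_latt hτ z] with w hw
    simp only [hq]
    rw [deriv_add_of_elliptic hell hw hω, prod_sig_add hcrit.sum_eq_zero (sig_add hτ hω hω2),
      sig_add hτ hω hω2, mul_pow, add_zero, mul_left_comm, mul_div_mul_left]
    exact pow_ne_zero _ (neg_ne_zero.mpr (exp_ne_zero _))
  have hinc₁ := hinc 1 (one_mem_latt τ) (half_notMem_latt hτ)
  have hinc₂ := hinc τ (tau_mem_latt τ) (half_tau_notMem_latt hτ)
  have hper : ∀ {ω}, ω ∈ latt τ → Function.Periodic (HasRemovable q) ω := fun hω =>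
    periodic_of_mem_latt (periodic_hasRemovable (differentiable_const 0) hinc₁)
      (periodic_hasRemovable (differentiable_const 0) hinc₂) hω
  set g₀ : ℂ → ℂ := fun z => P z * sigDiv z τ ^ (n + 1) / ∏ k, sig (z - a k) τ with hg₀
  have hg₀A : AnalyticAt ℂ g₀ 0 :=
    (hP.mul (((differentiable_sigDiv hτ).analyticAt 0).pow _)).div (hprodA 0)
      (by simpa using hprod0)
  have hqg₀ : q =ᶠ[𝓝[≠] 0] g₀ := by
    filter_upwards [hPf] with w hw
    simp only [hq, hg₀, sig, ← hw]
    ring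
  have h0 : HasRemovable q 0 := ⟨g₀, hg₀A, hqg₀⟩
  -- Vanishing of `f'` cancels the simple zero of `σ(z - a_l)`. No count of zeros is needed, since
  -- the resulting constant is identified at the origin.
  have hcr : ∀ l, HasRemovable q (a l) := by
    intro l
    have hal := notMem_of_crit hcrit l
    have hfl : deriv f (a l) = 0 := (hcrit.deriv_eq_zero_iff _ (hcrit.notMem l)).mpr
      ⟨l, by simp⟩
    obtain ⟨u, hu, hfu⟩ := (analyticAt_of_elliptic hell hal).deriv.exists_eq_sub_mul hfl
    refine ⟨fun z => u z * sig z τ ^ (n + 1) /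
      (sigDiv (z - a l) τ * ∏ k ∈ Finset.univ.erase l, sig (z - a k) τ), ?_, ?_⟩
    · refine (hu.mul ((analyticAt_sig hτ _).pow _)).div ((analyticAt_sigDiv_sub hτ _ _).mul
        (Finset.analyticAt_fun_prod _ fun k _ => analyticAt_sig_sub hτ (a k) _)) ?_
      refine mul_ne_zero (by simp [sigDiv_zero]) (Finset.prod_ne_zero_iff.mpr fun k hk => ?_)
      exact sig_sub_ne_zero hcrit (Finset.ne_of_mem_erase hk).symm
    · filter_upwards [self_mem_nhdsWithin] with w hw
      have hw : w - a l ≠ 0 := sub_ne_zero.mpr hw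
      simp only [hq]
      rw [hfu, ← Finset.mul_prod_erase _ _ (Finset.mem_univ l), sig.eq_1 (w - a l), mul_assoc,
        mul_assoc, mul_div_mul_left _ _ hw]
  have hrem : ∀ z, HasRemovable q z := by
    intro z
    by_cases hz : z ∈ latt τ
    · have := hper hz 0
      rw [zero_add] at this
      rw [this]; exact h0
    by_cases hk : ∃ k, z - a k ∈ latt τ
    · obtain ⟨k, hk⟩ := hk
      have := hper hk (a k)
      rw [add_sub_cancel] at this
      rw [this]; exact hcr k
    · push Not at hk
      refine AnalyticAt.hasRemovable (((analyticAt_of_elliptic hell hz).deriv.mul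
        ((analyticAt_sig hτ _).pow _)).div (hprodA z) (Finset.prod_ne_zero_iff.mpr fun k _ => ?_))
      rw [Ne, sig_eq_zero_iff_mem hτ]
      exact hk k
  obtain ⟨Q, hQ, hqQ⟩ := exists_entire_of_hasRemovable hrem
  have hQ₁ := add_eq_of_eventually hQ.continuous continuous_const hqQ hinc₁
  have hQ₂ := add_eq_of_eventually hQ.continuous continuous_const hqQ hinc₂
  simp only [add_zero] at hQ₁ hQ₂
  have hQc : Q z = g₀ 0 := by
    rw [eq_of_periodic hτ hQ hQ₁ hQ₂ z 0]
    exact eq_of_eventuallyEq_nhdsNE hQ.continuous.continuousAt hg₀A.continuousAt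
      ((hqQ 0).symm.trans hqg₀)
  have hg₀0 : g₀ 0 = -(n * G 0) / ∏ k, sig (-a k) τ := by
    simp [hg₀, hP0, sigDiv_zero]
  rw [← hg₀0, ← hQc]
  have hsz : sig z τ ≠ 0 := by rwa [Ne, sig_eq_zero_iff_mem hτ]
  by_cases hk : ∃ k, z - a k ∈ latt τ
  · rw [(hcrit.deriv_eq_zero_iff z fun h => hz ((mem_lattice τ z).mp h)).mpr
      (by simpa only [mem_lattice] using hk)]
    obtain ⟨k, hk⟩ := hk
    rw [Finset.prod_eq_zero (Finset.mem_univ k) ((sig_eq_zero_iff_mem hτ).mpr hk)]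
    simp
  · push Not at hk
    have hpz : ∏ k, sig (z - a k) τ ≠ 0 := Finset.prod_ne_zero_iff.mpr fun k _ => by
      rw [Ne, sig_eq_zero_iff_mem hτ]
      exact hk k
    have hqz : q z = Q z := eq_of_eventuallyEq_nhdsNE
      (((analyticAt_of_elliptic hell hz).deriv.mul ((analyticAt_sig hτ _).pow _)).div
        (hprodA z) hpz).continuousAt hQ.continuous.continuousAt (hqQ z)
    rw [← hqz]
    simp only [hq]
    field_simp

/-- The derivative of `f` divided by `σ(z - a_k)`. -/
noncomputable def cofactor (τ : ℂ) (c : ℂ) (a : Fin (n + 1) → ℂ) (k : Fin (n + 1)) (z : ℂ) : ℂ :=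
  c * (∏ j ∈ Finset.univ.erase k, sig (z - a j) τ) / sig z τ ^ (n + 1)

theorem cofactor_self (c : ℂ) (k : Fin (n + 1)) :
    cofactor τ c a k (a k) = critD (PeriodPair.ofTau τ) c a k := by
  simp [cofactor, critD, sigma_eq]

theorem sig_mul_cofactor (c : ℂ) (k : Fin (n + 1)) (z : ℂ) :
    c * (∏ k, sig (z - a k) τ) / sig z τ ^ (n + 1) = sig (z - a k) τ * cofactor τ c a k z := by
  rw [cofactor, ← Finset.mul_prod_erase _ _ (Finset.mem_univ k)]
  ring

theorem analyticAt_cofactor (c : ℂ) (k : Fin (n + 1)) {z : ℂ} (hz : z ∉ latt τ) :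
    AnalyticAt ℂ (cofactor τ c a k) z := by
  have hτ := τ.im_pos
  unfold cofactor
  exact (analyticAt_const.mul (Finset.analyticAt_fun_prod _ fun k _ =>
    analyticAt_sig_sub hτ (a k) _)).div ((analyticAt_sig hτ _).pow _)
    (pow_ne_zero _ (by rwa [Ne, sig_eq_zero_iff_mem hτ]))

theorem cofactor_self_ne_zero (hcrit : IsSimpleCriticalSystem (PeriodPair.ofTau τ) f a) {c : ℂ}
    (hc : c ≠ 0) (k : Fin (n + 1)) : cofactor τ c a k (a k) ≠ 0 := by
  refine div_ne_zero (mul_ne_zero hc (Finset.prod_ne_zero_iff.mpr fun j hj => ?_))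
    (pow_ne_zero _ (sig_crit_ne_zero hcrit k))
  exact sig_sub_ne_zero hcrit (Finset.ne_of_mem_erase hj).symm

theorem hasDerivAt_sig_sub_self {τ : ℂ} (hτ : 0 < τ.im) (w : ℂ) :
    HasDerivAt (fun z => sig (z - w) τ) 1 w := by
  have h := hasDerivAt_sig_zero hτ
  rw [← sub_self w] at h
  simpa using! h.comp_sub_const w w

/-- `f'` is `σ(z - a_k)` times the cofactor, and `σ(0) = 0`, `σ'(0) = 1`. -/
theorem deriv_deriv_eq_critD (hcrit : IsSimpleCriticalSystem (PeriodPair.ofTau τ) f a) {c : ℂ}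
    (hf : ∀ z ∉ latt τ, deriv f z = c * (∏ k, sig (z - a k) τ) / sig z τ ^ (n + 1))
    (k : Fin (n + 1)) :
    deriv (deriv f) (a k) = critD (PeriodPair.ofTau τ) c a k := by
  have hak := notMem_of_crit hcrit k
  have hev : deriv f =ᶠ[𝓝 (a k)] fun z => sig (z - a k) τ * cofactor τ c a k z := by
    filter_upwards [(isOpen_compl_latt τ.im_pos).mem_nhds hak] with w hw
    rw [hf w hw, sig_mul_cofactor c k]
  rw [hev.deriv_eq, ← cofactor_self]
  have := ((hasDerivAt_sig_sub_self τ.im_pos (a k)).mul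
    (analyticAt_cofactor (a := a) c k hak).differentiableAt.hasDerivAt).deriv
  refine this.trans ?_
  simp [sig_zero]

theorem deriv_cofactor (hcrit : IsSimpleCriticalSystem (PeriodPair.ofTau τ) f a) {c : ℂ}
    (hc : c ≠ 0) (k : Fin (n + 1)) :
    deriv (cofactor τ c a k) (a k) = cofactor τ c a k (a k) *
      ((∑ j ∈ Finset.univ.erase k, zet (a k - a j) τ) - (n + 1) * zet (a k) τ) := by
  have hτ := τ.im_pos
  have hak := notMem_of_crit hcrit k
  have hR := cofactor_self_ne_zero hcrit hc k
  have hD : ∀ j ∈ Finset.univ.erase k, sig (a k - a j) τ ≠ 0 := fun j hj =>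
    sig_sub_ne_zero hcrit (Finset.ne_of_mem_erase hj).symm
  have hs := sig_crit_ne_zero hcrit k
  have h1 : logDeriv (cofactor τ c a k) (a k) =
      (∑ j ∈ Finset.univ.erase k, zet (a k - a j) τ) - (n + 1) * zet (a k) τ := by
    unfold cofactor
    rw [logDeriv_div (f := fun z => c * ∏ j ∈ Finset.univ.erase k, sig (z - a j) τ)
      (g := fun z => sig z τ ^ (n + 1)) _ (mul_ne_zero hc (Finset.prod_ne_zero_iff.mpr hD))
      (pow_ne_zero _ hs) (analyticAt_const.mul (Finset.analyticAt_fun_prod _ fun j _ =>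
        analyticAt_sig_sub hτ (a j) _)).differentiableAt
      ((analyticAt_sig hτ _).pow _).differentiableAt,
      logDeriv_mul (f := fun _ => c) (g := fun z => ∏ j ∈ Finset.univ.erase k, sig (z - a j) τ) _ hc (Finset.prod_ne_zero_iff.mpr hD) (differentiableAt_const c)
      (Finset.analyticAt_fun_prod _ fun j _ => analyticAt_sig_sub hτ (a j) _).differentiableAt,
      logDeriv_prod (f := fun j z => sig (z - a j) τ) hD
        (fun j _ => (analyticAt_sig_sub hτ (a j) _).differentiableAt),
      logDeriv_fun_pow (f := fun z => sig z τ) (analyticAt_sig hτ _).differentiableAt]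
    have h2 : logDeriv (fun z => sig z τ) (a k) = zet (a k) τ := by
      rw [logDeriv_apply, (hasDerivAt_sig hτ hak).deriv, mul_div_cancel_left₀ _ hs]
    have h3 : ∀ j ∈ Finset.univ.erase k,
        logDeriv (fun z => sig (z - a j) τ) (a k) = zet (a k - a j) τ := by
      intro j hj
      have hm : a k - a j ∉ latt τ := fun h => hD j hj ((sig_eq_zero_iff_mem hτ).mpr h)
      rw [logDeriv_apply, ((hasDerivAt_sig hτ hm).comp_sub_const (a k) (a j)).deriv,
        mul_div_cancel_left₀ _ (hD j hj)]
    rw [h2, Finset.sum_congr rfl h3, logDeriv_const]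
    simp
  rw [← h1, logDeriv_apply, mul_div_cancel₀ _ hR]

end EllipticFunction

end WeierstrassTau

/-! ### The variation of `f` as `f'` times a sum of `ζ`-functions. -/

namespace WeierstrassTau

section Variation

variable {τ : ℍ} {n : ℕ} {f h M P : ℂ → ℂ} {a : Fin (n + 1) → ℂ} {c ω' : ℂ}

/-- The combination of `ζ`-functions with simple poles at the `a_k` with residues `γ_k`, that
vanishes at the origin and has period `1`. -/
noncomputable def zetSum (τ : ℂ) (γ a : Fin (n + 1) → ℂ) (z : ℂ) : ℂ :=
  ∑ k, γ k * (zet (z - a k) τ + zet (a k) τ) - 2 * zet (1 / 2) τ * z * ∑ k, γ k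

theorem zetSum_zero (τ : ℂ) (γ a : Fin (n + 1) → ℂ) : zetSum τ γ a 0 = 0 := by
  simp [zetSum, zet_neg]

/-- For `ω = 1` the linear term cancels the increment entirely; for `ω = τ` Legendre's relation
makes it `-2πi ∑ γ_k`. -/
theorem zetSum_add {τ : ℂ} (hτ : 0 < τ.im) (γ a : Fin (n + 1) → ℂ) {ω z : ℂ} (hω : ω ∈ latt τ)
    (hω2 : ω / 2 ∉ latt τ) (hz : ∀ k, z - a k ∉ latt τ) :
    zetSum τ γ a (z + ω) = zetSum τ γ a z +
      (2 * zet (ω / 2) τ - 2 * zet (1 / 2) τ * ω) * ∑ k, γ k := by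
  have h1 : ∀ k, γ k * (zet (z + ω - a k) τ + zet (a k) τ) =
      γ k * (zet (z - a k) τ + zet (a k) τ) + 2 * zet (ω / 2) τ * γ k := by
    intro k
    rw [show z + ω - a k = z - a k + ω by ring, zet_add hτ hω hω2 (hz k)]
    ring
  simp only [zetSum, h1, Finset.sum_add_distrib, ← Finset.mul_sum]
  ring

theorem analyticAt_zetSum {τ : ℂ} (hτ : 0 < τ.im) (γ a : Fin (n + 1) → ℂ) {z : ℂ}
    (hz : ∀ k, z - a k ∉ latt τ) : AnalyticAt ℂ (zetSum τ γ a) z := by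
  unfold zetSum
  refine AnalyticAt.sub (Finset.analyticAt_fun_sum _ fun k _ => analyticAt_const.mul
    ((analyticAt_zet_sub hτ (hz k)).add analyticAt_const)) ?_
  fun_prop

/-- `zetSum` without its polar term at `a_l`. -/
noncomputable def zetSumExcept (τ : ℂ) (γ a : Fin (n + 1) → ℂ) (l : Fin (n + 1)) (z : ℂ) : ℂ :=
  ∑ k ∈ Finset.univ.erase l, γ k * (zet (z - a k) τ + zet (a k) τ) + γ l * zet (a l) τ -
    2 * zet (1 / 2) τ * z * ∑ k, γ k

theorem zetSum_eq (τ : ℂ) (γ a : Fin (n + 1) → ℂ) (l : Fin (n + 1)) (z : ℂ) :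
    zetSum τ γ a z = γ l * zet (z - a l) τ + zetSumExcept τ γ a l z := by
  rw [zetSum, zetSumExcept, ← Finset.add_sum_erase _ _ (Finset.mem_univ l)]
  ring

theorem analyticAt_zetSumExcept (hcrit : IsSimpleCriticalSystem (PeriodPair.ofTau τ) f a)
    (γ : Fin (n + 1) → ℂ) (l : Fin (n + 1)) : AnalyticAt ℂ (zetSumExcept τ γ a l) (a l) := by
  unfold zetSumExcept
  refine AnalyticAt.sub ((Finset.analyticAt_fun_sum _ fun k hk => analyticAt_const.mul
    ((analyticAt_zet_sub τ.im_pos ?_).add analyticAt_const)).add analyticAt_const) ?_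
  · rw [← mem_lattice]
    exact hcrit.incongruent l k (Finset.ne_of_mem_erase hk).symm
  · fun_prop

/-- If `h / f'` has increments `0` and `-ω'` along the periods and vanishes at the pole of `f`, then
it is the combination of `ζ`-functions with the same polar parts, and `ω' = 2πi ∑ γ_k`. -/
theorem eq_deriv_mul_zetSum (hell : IsEllipticPoleAtZero (PeriodPair.ofTau τ) n f)
    (hcrit : IsSimpleCriticalSystem (PeriodPair.ofTau τ) f a) (hc : c ≠ 0)
    (hf : ∀ z ∉ latt τ, deriv f z = c * (∏ k, sig (z - a k) τ) / sig z τ ^ (n + 1))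
    (hh : ∀ z ∉ latt τ, AnalyticAt ℂ h z)
    (h1 : ∀ z ∉ latt τ, deriv f z ≠ 0 → h (z + 1) = h z)
    (h2 : ∀ z ∉ latt τ, deriv f z ≠ 0 → h (z + τ) = h z - ω' * deriv f z)
    (hM : AnalyticAt ℂ M 0) (hMh : ∀ᶠ z in 𝓝[≠] 0, z ^ n * h z = M z)
    (hP : AnalyticAt ℂ P 0) (hP0 : P 0 ≠ 0)
    (hPf : ∀ᶠ z in 𝓝[≠] 0, z ^ (n + 1) * deriv f z = P z)
    {γ : Fin (n + 1) → ℂ} (hγ : ∀ k, γ k = h (a k) / critD (PeriodPair.ofTau τ) c a k) :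
    (∀ z ∉ latt τ, (∀ k, z - a k ∉ latt τ) → h z = deriv f z * zetSum τ γ a z) ∧
      ω' = 2 * Real.pi * I * ∑ k, γ k := by
  have hτ := τ.im_pos
  have hf0 : ∀ z ∉ latt τ, (∀ k, z - a k ∉ latt τ) → deriv f z ≠ 0 := by
    intro z hz hk h0
    rw [hcrit.deriv_eq_zero_iff z fun h => hz ((mem_lattice τ z).mp h)] at h0
    obtain ⟨k, hk'⟩ := h0
    exact hk k ((mem_lattice τ _).mp hk')
  have hgen : ∀ z, ∀ᶠ w in 𝓝[≠] z, w ∉ latt τ ∧ ∀ k, w - a k ∉ latt τ := by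
    intro z
    refine (eventually_notMem_latt hτ z).and (eventually_all.mpr fun k => ?_)
    have ht := tendsto_add_const_nhdsNE z (-a k)
    filter_upwards [ht.eventually (eventually_notMem_latt hτ (z + -a k))] with w hw
    rwa [sub_eq_add_neg]
  set q : ℂ → ℂ := fun z => h z / deriv f z - zetSum τ γ a z with hq
  set β : ℂ := -ω' + 2 * Real.pi * I * ∑ k, γ k with hβ
  have hinc₁ : ∀ z, ∀ᶠ w in 𝓝[≠] z, q (w + 1) = q w + 0 := by
    intro z
    filter_upwards [hgen z] with w hw
    simp only [hq]
    rw [h1 w hw.1 (hf0 w hw.1 hw.2), deriv_add_of_elliptic hell hw.1 (one_mem_latt τ),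
      zetSum_add hτ γ a (one_mem_latt τ) (half_notMem_latt hτ) hw.2]
    ring
  have hinc₂ : ∀ z, ∀ᶠ w in 𝓝[≠] z, q (w + τ) = q w + β := by
    intro z
    filter_upwards [hgen z] with w hw
    have h0 := hf0 w hw.1 hw.2
    have hleg := legendre hτ
    simp only [hq]
    rw [h2 w hw.1 h0, deriv_add_of_elliptic hell hw.1 (tau_mem_latt τ),
      zetSum_add hτ γ a (tau_mem_latt τ) (half_tau_notMem_latt hτ) hw.2, sub_div,
      mul_div_cancel_right₀ _ h0, hβ]
    linear_combination (∑ k, γ k) * hleg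
  have hper : ∀ {ω}, ω ∈ latt τ → Function.Periodic (HasRemovable q) ω := fun hω =>
    periodic_of_mem_latt (periodic_hasRemovable (differentiable_const 0) hinc₁)
      (periodic_hasRemovable (differentiable_const β) hinc₂) hω
  have hzs0 : AnalyticAt ℂ (zetSum τ γ a) 0 := analyticAt_zetSum hτ γ a fun k hk => by
    rw [zero_sub, neg_mem_latt_iff] at hk
    exact notMem_of_crit hcrit k hk
  -- The pole of `f'` has order one more than that allowed for `h`, which leaves the factor `z`.
  set g₀ : ℂ → ℂ := fun z => z * M z / P z - zetSum τ γ a z with hg₀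
  have hg₀A : AnalyticAt ℂ g₀ 0 := ((analyticAt_id.mul hM).div hP hP0).sub hzs0
  have hqg₀ : q =ᶠ[𝓝[≠] 0] g₀ := by
    filter_upwards [hMh, hPf, self_mem_nhdsWithin] with w hw hw2 hw0
    have hw0 : w ≠ 0 := hw0
    simp only [hq, hg₀]
    rw [← hw, ← hw2, ← mul_assoc, ← pow_succ', mul_div_mul_left _ _ (pow_ne_zero _ hw0)]
  have hcr : ∀ l, HasRemovable q (a l) := by
    intro l
    have hal := notMem_of_crit hcrit l
    have hRA := analyticAt_cofactor (a := a) c l hal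
    have hR0 := cofactor_self_ne_zero hcrit hc l
    have hσ' : AnalyticAt ℂ (fun z => deriv (fun z => sig z τ) (z - a l)) (a l) :=
      AnalyticAt.fun_comp (f := fun z => z - a l) (analyticAt_sig hτ _).deriv (by fun_prop)
    -- Since `ζ = σ'/σ`, this is `h/f' - γ_l ζ(z - a_l)` multiplied by `σ(z - a_l)`. It vanishes at
    -- `a_l` by the choice of `γ_l`, which cancels the simple zero of `σ`.
    have hN : AnalyticAt ℂ (fun z => h z / cofactor τ c a l z -
        γ l * deriv (fun z => sig z τ) (z - a l)) (a l) :=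
      ((hh _ hal).div hRA hR0).sub (analyticAt_const.mul hσ')
    obtain ⟨u, hu, hNu⟩ := hN.exists_eq_sub_mul (by
      simp only [sub_self, (hasDerivAt_sig_zero hτ).deriv]
      rw [hγ, cofactor_self]
      ring)
    refine ⟨fun z => u z / sigDiv (z - a l) τ - zetSumExcept τ γ a l z,
      (hu.div (analyticAt_sigDiv_sub hτ _ _) (by simp [sigDiv_zero])).sub
        (analyticAt_zetSumExcept hcrit γ l), ?_⟩
    filter_upwards [hgen (a l), self_mem_nhdsWithin] with w hw hwl
    have hwl : w - a l ≠ 0 := sub_ne_zero.mpr hwl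
    have hs : sig (w - a l) τ ≠ 0 := by
      rw [Ne, sig_eq_zero_iff_mem hτ]; exact hw.2 l
    have hs2 : sigDiv (w - a l) τ ≠ 0 := right_ne_zero_of_mul hs
    have hfw : deriv f w = sig (w - a l) τ * cofactor τ c a l w := by
      rw [hf w hw.1, sig_mul_cofactor c l]
    have hRw : cofactor τ c a l w ≠ 0 := by
      intro h0; exact hf0 w hw.1 hw.2 (by rw [hfw, h0, mul_zero])
    have hN2 := hNu w
    rw [(hasDerivAt_sig hτ (hw.2 l)).deriv] at hN2
    have hu2 : u w / sigDiv (w - a l) τ =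
        (h w / cofactor τ c a l w - γ l * (sig (w - a l) τ * zet (w - a l) τ)) /
          sig (w - a l) τ := by
      rw [hN2, sig, mul_div_mul_left _ _ hwl]
    simp only [hq]
    rw [hu2, zetSum_eq τ γ a l, hfw]
    field_simp
    ring
  have hrem : ∀ z, HasRemovable q z := by
    intro z
    by_cases hz : z ∈ latt τ
    · have := hper hz 0
      rw [zero_add] at this
      rw [this]; exact ⟨g₀, hg₀A, hqg₀⟩
    by_cases hk : ∃ k, z - a k ∈ latt τ
    · obtain ⟨k, hk⟩ := hk
      have := hper hk (a k)
      rw [add_sub_cancel] at this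
      rw [this]; exact hcr k
    · push Not at hk
      exact (((hh z hz).div (analyticAt_of_elliptic hell hz).deriv (hf0 z hz hk)).sub
        (analyticAt_zetSum hτ γ a hk)).hasRemovable
  obtain ⟨Q, hQ, hqQ⟩ := exists_entire_of_hasRemovable hrem
  have hQ₁ := add_eq_of_eventually hQ.continuous continuous_const hqQ hinc₁
  have hQ₂ := add_eq_of_eventually hQ.continuous continuous_const hqQ hinc₂
  have hQd := deriv_eq_of_add hτ hQ hQ₁ hQ₂
  have hQ0 : Q 0 = 0 := by
    have : Q 0 = g₀ 0 := eq_of_eventuallyEq_nhdsNE hQ.continuous.continuousAt hg₀A.continuousAt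
      ((hqQ 0).symm.trans hqg₀)
    rw [this]
    simp [hg₀, zetSum_zero]
  have hlin : ∀ z, Q z = deriv Q 0 * z := by
    intro z
    have h := is_const_of_deriv_eq_zero (f := fun z => Q z - deriv Q 0 * z)
      (hQ.sub (differentiable_id.const_mul _)) (fun w => by
        have := ((hQ w).hasDerivAt.sub ((hasDerivAt_id w).const_mul (deriv Q 0))).deriv
        refine this.trans ?_
        rw [hQd w 0]; ring) z 0
    simp only [hQ0, mul_zero, sub_zero] at h
    linear_combination h
  have hd0 : deriv Q 0 = 0 := by
    have h3 := hQ₁ 0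
    rw [hlin (0 + 1), hQ0] at h3
    simpa using h3
  have hQz : ∀ z, Q z = 0 := fun z => by rw [hlin z, hd0, zero_mul]
  refine ⟨fun z hz hk => ?_, ?_⟩
  · have hqz : q z = Q z := eq_of_eventuallyEq_nhdsNE
      ((((hh z hz).div (analyticAt_of_elliptic hell hz).deriv (hf0 z hz hk)).sub
        (analyticAt_zetSum hτ γ a hk))).continuousAt hQ.continuous.continuousAt (hqQ z)
    rw [hQz] at hqz
    simp only [hq, sub_eq_zero] at hqz
    rw [← hqz, mul_div_cancel₀ _ (hf0 z hz hk)]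
  · have h3 := hQ₂ 0
    rw [hQz, hQz, zero_add] at h3
    rw [hβ] at h3
    linear_combination h3

/-- The leading coefficient at the pole of the variation of `f`. -/
theorem leading_coeff_eq (hcrit : IsSimpleCriticalSystem (PeriodPair.ofTau τ) f a)
    {γ : Fin (n + 1) → ℂ}
    (hS : ∀ z ∉ latt τ, (∀ k, z - a k ∉ latt τ) → h z = deriv f z * zetSum τ γ a z)
    (hM : AnalyticAt ℂ M 0) (hMh : ∀ᶠ z in 𝓝[≠] 0, z ^ n * h z = M z)
    (hP : AnalyticAt ℂ P 0) (hPf : ∀ᶠ z in 𝓝[≠] 0, z ^ (n + 1) * deriv f z = P z) :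
    M 0 = -(P 0 * ∑ k, γ k * ((PeriodPair.ofTau τ).weierstrassP (a k) + 2 * zet (1 / 2) τ)) := by
  have hτ := τ.im_pos
  have hak : ∀ k, -a k ∉ latt τ := fun k hk => notMem_of_crit hcrit k (neg_mem_latt_iff.mp hk)
  have hzs : HasDerivAt (zetSum τ γ a)
      (-∑ k, γ k * ((PeriodPair.ofTau τ).weierstrassP (a k) + 2 * zet (1 / 2) τ)) 0 := by
    have h1 : ∀ k ∈ Finset.univ, HasDerivAt (fun z => γ k * (zet (z - a k) τ + zet (a k) τ))
        (γ k * -(PeriodPair.ofTau τ).weierstrassP (a k)) 0 := by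
      intro k _
      have h2 : HasDerivAt (fun z => zet z τ) (-(PeriodPair.ofTau τ).weierstrassP (a k))
          (0 - a k) := by
        rw [zero_sub, ← PeriodPair.weierstrassP_neg]
        exact hasDerivAt_zet τ (hak k)
      exact ((h2.comp_sub_const 0 (a k)).add_const _).const_mul _
    have h3 := (HasDerivAt.fun_sum h1).sub
      (((hasDerivAt_id (0 : ℂ)).const_mul (2 * zet (1 / 2) τ)).mul_const (∑ k, γ k))
    refine HasDerivAt.congr_deriv (f := zetSum τ γ a) h3 ?_
    simp only [mul_neg, mul_add, Finset.sum_add_distrib, Finset.sum_neg_distrib, mul_one,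
      ← Finset.sum_mul]
    ring
  have hgen : ∀ᶠ w in 𝓝[≠] (0 : ℂ), ∀ k, w - a k ∉ latt τ := by
    refine eventually_all.mpr fun k => ?_
    have ht := tendsto_add_const_nhdsNE 0 (-a k)
    filter_upwards [ht.eventually (eventually_notMem_latt hτ (0 + -a k))] with w hw
    rwa [sub_eq_add_neg]
  -- Both sides vanish at the origin; their first derivatives there give the claim.
  have hev : (fun z => z * M z) =ᶠ[𝓝 0] fun z => P z * zetSum τ γ a z := by
    have h1 : (fun z => z * M z) =ᶠ[𝓝[≠] 0] fun z => P z * zetSum τ γ a z := by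
      filter_upwards [hMh, hPf, hgen, eventually_notMem_latt hτ 0] with w h1 h2 h3 h4
      rw [← h1, ← h2, hS w h4 h3]
      ring
    rw [EventuallyEq, eventually_nhdsWithin_iff] at h1
    filter_upwards [h1] with w hw
    by_cases hw0 : w = 0
    · rw [hw0, zetSum_zero]; simp
    · exact hw hw0
  have h1 := (hasDerivAt_id (0 : ℂ)).mul hM.differentiableAt.hasDerivAt
  have h2 := h1.unique ((hP.differentiableAt.hasDerivAt.mul hzs).congr_of_eventuallyEq hev)
  simp only [zetSum_zero, id] at h2
  linear_combination h2

/-- The derivative of the variation of `f` at a critical point. -/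
theorem deriv_variation_eq (hcrit : IsSimpleCriticalSystem (PeriodPair.ofTau τ) f a) (hc : c ≠ 0)
    (hf : ∀ z ∉ latt τ, deriv f z = c * (∏ k, sig (z - a k) τ) / sig z τ ^ (n + 1))
    (hh : ∀ z ∉ latt τ, AnalyticAt ℂ h z) {γ : Fin (n + 1) → ℂ}
    (hS : ∀ z ∉ latt τ, (∀ k, z - a k ∉ latt τ) → h z = deriv f z * zetSum τ γ a z)
    (l : Fin (n + 1)) :
    deriv h (a l) = critD (PeriodPair.ofTau τ) c a l *
      (γ l * ((∑ j ∈ Finset.univ.erase l, zet (a l - a j) τ) - (n + 1) * zet (a l) τ) +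
        zetSumExcept τ γ a l (a l)) := by
  have hτ := τ.im_pos
  have hal := notMem_of_crit hcrit l
  have hRA := analyticAt_cofactor (a := a) c l hal
  have hσ' : HasDerivAt (fun z => deriv (fun z => sig z τ) (z - a l)) 0 (a l) := by
    have h1 : HasDerivAt (deriv fun z => sig z τ) 0 (a l - a l) := by
      rw [sub_self]
      exact (analyticAt_sig hτ 0).deriv.differentiableAt.hasDerivAt.congr_deriv
        (deriv_deriv_sig_zero τ)
    exact h1.comp_sub_const (a l) (a l)
  -- This is `f' S` with `σ ζ` replaced by `σ'`, hence regular at `a_l`. As `σ''(0) = 0`, its polar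
  -- part contributes only the derivative of the cofactor.
  set g : ℂ → ℂ := fun z => γ l * (cofactor τ c a l z * deriv (fun z => sig z τ) (z - a l)) +
    cofactor τ c a l z * zetSumExcept τ γ a l z * sig (z - a l) τ with hg
  have hE := analyticAt_zetSumExcept hcrit γ l
  have hgd := ((hRA.differentiableAt.hasDerivAt.mul hσ').const_mul (γ l)).add
    ((hRA.differentiableAt.mul hE.differentiableAt).hasDerivAt.mul
      (hasDerivAt_sig_sub_self hτ (a l)))
  have hhg : h =ᶠ[𝓝[≠] (a l)] g := by
    have hgen : ∀ᶠ w in 𝓝[≠] (a l), ∀ k, w - a k ∉ latt τ := by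
      refine eventually_all.mpr fun k => ?_
      have ht := tendsto_add_const_nhdsNE (a l) (-a k)
      filter_upwards [ht.eventually (eventually_notMem_latt hτ (a l + -a k))] with w hw
      rwa [sub_eq_add_neg]
    filter_upwards [hgen, eventually_notMem_latt hτ (a l)] with w hw1 hw2
    simp only [hg]
    rw [hS w hw2 hw1, hf w hw2, sig_mul_cofactor c l, zetSum_eq τ γ a l,
      (hasDerivAt_sig hτ (hw1 l)).deriv]
    ring
  have hev : h =ᶠ[𝓝 (a l)] g := by
    have h0 : h (a l) = g (a l) := eq_of_eventuallyEq_nhdsNE (hh _ hal).continuousAt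
      (HasDerivAt.continuousAt (f := g) hgd) hhg
    rw [EventuallyEq, eventually_nhdsWithin_iff] at hhg
    filter_upwards [hhg] with w hw
    by_cases hw0 : w = a l
    · rw [hw0, h0]
    · exact hw hw0
  rw [hev.deriv_eq]
  refine (HasDerivAt.deriv (f := g) hgd).trans ?_
  rw [deriv_cofactor hcrit hc l, ← cofactor_self]
  simp only [sub_self, (hasDerivAt_sig_zero hτ).deriv, sig_zero]
  simp only [Pi.mul_apply]
  ring

end Variation

end WeierstrassTau

/-! ### Integrals depending on a parameter -/

theorem ContinuousOn.aestronglyMeasurable_uIoc {E : Type*} [NormedAddCommGroup E] {g : ℝ → E}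
    {a b : ℝ} (hg : ContinuousOn g (uIcc a b)) :
    MeasureTheory.AEStronglyMeasurable g (MeasureTheory.volume.restrict (Set.uIoc a b)) :=
  (intervalIntegrable_iff.mp hg.intervalIntegrable).aestronglyMeasurable

/-- Continuity of the differential along the compact segment gives, by the tube lemma, one
neighbourhood of `x₀` on which it is bounded by `bound`; then dominated differentiation applies. -/
theorem hasFDerivAt_intervalIntegral_of_contDiffAt {H E : Type*} [NormedAddCommGroup H]
    [NormedSpace ℝ H] [NormedAddCommGroup E] [NormedSpace ℝ E] [CompleteSpace E]
    {k : H → ℝ → E} {a b : ℝ} {x₀ : H}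
    (hk : ∀ θ ∈ uIcc a b, ContDiffAt ℝ 1 (fun p : H × ℝ => k p.1 p.2) (x₀, θ)) :
    ∃ L : H →L[ℝ] E, HasFDerivAt (fun x => ∫ θ in a..b, k x θ) L x₀ ∧
      ∀ v, L v = ∫ θ in a..b, fderiv ℝ (fun x => k x θ) x₀ v := by
  set K : H × ℝ → E := fun p => k p.1 p.2 with hK
  have hcont : ∀ θ ∈ uIcc a b, ContinuousAt (fderiv ℝ K) (x₀, θ) := fun θ hθ =>
    ((hk θ hθ).fderiv_right (m := 0) (by simp)).continuousAt
  have hpart : ∀ x θ, DifferentiableAt ℝ K (x, θ) →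
      HasFDerivAt (fun x => k x θ) ((fderiv ℝ K (x, θ)).comp (ContinuousLinearMap.inl ℝ H ℝ)) x :=
    fun x θ h => HasFDerivAt.comp (f := fun x => ((x, θ) : H × ℝ)) x h.hasFDerivAt
      (hasFDerivAt_prodMk_left x θ)
  have hinl : ‖ContinuousLinearMap.inl ℝ H ℝ‖ ≤ 1 := ContinuousLinearMap.norm_inl_le_one ..
  set bound : ℝ → ℝ := fun θ => ‖fderiv ℝ K (x₀, θ)‖ + 1 with hbound
  have hsec : ∀ θ ∈ uIcc a b, ContinuousAt (fun θ => ((x₀, θ) : H × ℝ)) θ := fun θ _ => by fun_prop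
  have hev : ∀ᶠ x in 𝓝 x₀, ∀ θ ∈ uIcc a b, DifferentiableAt ℝ K (x, θ) ∧
      ‖fderiv ℝ K (x, θ)‖ ≤ bound θ := by
    refine isCompact_uIcc.eventually_forall_of_forall_eventually
      (P := fun x θ => DifferentiableAt ℝ K (x, θ) ∧ ‖fderiv ℝ K (x, θ)‖ ≤ bound θ) fun θ hθ => ?_
    have h1 := (hk θ hθ).eventually (by simp)
    have h2 : ContinuousAt (fun p : H × ℝ => ‖fderiv ℝ K p‖) (x₀, θ) := (hcont θ hθ).norm
    have h3 : ContinuousAt (fun p : H × ℝ => bound p.2) (x₀, θ) := by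
      have : ContinuousAt (fun p : H × ℝ => ((x₀, p.2) : H × ℝ)) (x₀, θ) := by fun_prop
      exact (ContinuousAt.comp (f := fun p : H × ℝ => ((x₀, p.2) : H × ℝ)) (x := (x₀, θ))
        (hcont θ hθ).norm this).add continuousAt_const
    filter_upwards [h1, h2.eventually_lt h3 (by simp [hbound])] with p hp1 hp2
    exact ⟨hp1.differentiableAt (by simp), hp2.le⟩
  have hbc : ContinuousOn bound (uIcc a b) := fun θ hθ =>
    ((ContinuousAt.comp (f := fun θ => ((x₀, θ) : H × ℝ)) (hcont θ hθ).norm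
      (hsec θ hθ)).add continuousAt_const).continuousWithinAt
  have hF'c : ContinuousOn (fun θ => (fderiv ℝ K (x₀, θ)).comp (ContinuousLinearMap.inl ℝ H ℝ))
      (uIcc a b) := fun θ hθ =>
    ((ContinuousAt.comp (f := fun θ => ((x₀, θ) : H × ℝ)) (hcont θ hθ)
      (hsec θ hθ)).clm_comp continuousAt_const).continuousWithinAt
  have hkc : ∀ x, (∀ θ ∈ uIcc a b, DifferentiableAt ℝ K (x, θ)) →
      ContinuousOn (fun θ => k x θ) (uIcc a b) := fun x hx θ hθ =>
    (ContinuousAt.comp (f := fun θ => ((x, θ) : H × ℝ)) (hx θ hθ).continuousAt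
      (by fun_prop)).continuousWithinAt
  obtain ⟨s, hs, hs'⟩ := eventually_iff_exists_mem.mp hev
  have hmain := intervalIntegral.hasFDerivAt_integral_of_dominated_of_fderiv_le
    (μ := MeasureTheory.volume) (F := k) (a := a) (b := b) (bound := bound)
    (F' := fun x θ => (fderiv ℝ K (x, θ)).comp (ContinuousLinearMap.inl ℝ H ℝ)) (s := s)
    (x₀ := x₀) hs (by
      filter_upwards [hs] with x hx
      exact (hkc x fun θ hθ => (hs' x hx θ hθ).1).aestronglyMeasurable_uIoc)
    (hkc x₀ fun θ hθ => (hs' x₀ (mem_of_mem_nhds hs) θ hθ).1).intervalIntegrable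
    hF'c.aestronglyMeasurable_uIoc
    (Eventually.of_forall fun θ hθ x hx => by
      refine (ContinuousLinearMap.opNorm_comp_le _ _).trans ?_
      have := (hs' x hx θ (uIoc_subset_uIcc hθ)).2
      calc _ ≤ bound θ * 1 := by gcongr
        _ = bound θ := mul_one _)
    hbc.intervalIntegrable
    (Eventually.of_forall fun θ hθ x hx => hpart x θ (hs' x hx θ (uIoc_subset_uIcc hθ)).1)
  refine ⟨_, hmain, fun v => ?_⟩
  rw [ContinuousLinearMap.intervalIntegral_apply hF'c.intervalIntegrable]
  refine intervalIntegral.integral_congr fun θ hθ => ?_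
  rw [(hpart x₀ θ (hs' x₀ (mem_of_mem_nhds hs) θ hθ).1).fderiv]

theorem contDiffAt_cauchy_kernel {φ : ℂ → ℝ → ℂ} {z₀ z₁ : ℂ} {r t₀ : ℝ} {m : ℕ} {θ : ℝ}
    (hz₁ : z₁ ∈ Metric.ball z₀ r)
    (hφ : ContDiffAt ℝ 1 (fun p : ℂ × ℝ => φ p.1 p.2) (circleMap z₀ r θ, t₀)) :
    ContDiffAt ℝ 1 (fun p : (ℂ × ℝ) × ℝ => deriv (circleMap z₀ r) p.2 •
      (((circleMap z₀ r p.2 - p.1.1) ^ m)⁻¹ • φ (circleMap z₀ r p.2) p.1.2)) ((z₁, t₀), θ) := by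
  have hc : ContDiff ℝ 1 (circleMap z₀ r) := contDiff_circleMap z₀ r
  have hc1 : ContDiffAt ℝ 1 (fun p : (ℂ × ℝ) × ℝ => circleMap z₀ r p.2) ((z₁, t₀), θ) :=
    (hc.comp contDiff_snd).contDiffAt
  have hd : ContDiffAt ℝ 1 (fun p : (ℂ × ℝ) × ℝ => deriv (circleMap z₀ r) p.2) ((z₁, t₀), θ) := by
    simp only [deriv_circleMap]
    exact (((contDiff_circleMap 0 r).comp contDiff_snd).mul contDiff_const).contDiffAt
  have hne : circleMap z₀ r θ - z₁ ≠ 0 := by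
    rw [sub_ne_zero]
    exact circleMap_ne_mem_ball hz₁ θ
  have hz : ContDiffAt ℝ 1 (fun p : (ℂ × ℝ) × ℝ => p.1.1) ((z₁, t₀), θ) := by fun_prop
  have hi : ContDiffAt ℝ 1 (fun p : (ℂ × ℝ) × ℝ => ((circleMap z₀ r p.2 - p.1.1) ^ m)⁻¹)
      ((z₁, t₀), θ) := ((hc1.sub hz).pow m).inv (pow_ne_zero _ hne)
  have hp : ContDiffAt ℝ 1 (fun p : (ℂ × ℝ) × ℝ => φ (circleMap z₀ r p.2) p.1.2)
      ((z₁, t₀), θ) := by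
    have h2 : ContDiffAt ℝ 1 (fun p : (ℂ × ℝ) × ℝ => (circleMap z₀ r p.2, p.1.2))
        ((z₁, t₀), θ) := hc1.prodMk (by fun_prop)
    exact ContDiffAt.comp (g := fun p : ℂ × ℝ => φ p.1 p.2) ((z₁, t₀), θ) hφ h2
  exact hd.smul (hi.smul hp)

/-- Differentiability of Cauchy integrals in the point and a real parameter. -/
theorem hasFDerivAt_circleIntegral {φ : ℂ → ℝ → ℂ} {z₀ z₁ : ℂ} {r t₀ : ℝ} (m : ℕ)
    (hz₁ : z₁ ∈ Metric.ball z₀ r)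
    (hφ : ∀ w ∈ Metric.sphere z₀ r, ContDiffAt ℝ 1 (fun p : ℂ × ℝ => φ p.1 p.2) (w, t₀)) :
    ∃ L : ℂ × ℝ →L[ℝ] ℂ,
      HasFDerivAt (fun p : ℂ × ℝ => ∮ w in C(z₀, r), ((w - p.1) ^ m)⁻¹ • φ w p.2) L (z₁, t₀) ∧
      L (0, 1) = ∮ w in C(z₀, r), ((w - z₁) ^ m)⁻¹ • deriv (φ w) t₀ := by
  have hr : 0 ≤ r := (dist_nonneg.trans_lt (Metric.mem_ball.mp hz₁)).le
  have hφ' : ∀ θ, ContDiffAt ℝ 1 (fun p : ℂ × ℝ => φ p.1 p.2) (circleMap z₀ r θ, t₀) := fun θ =>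
    hφ _ (circleMap_mem_sphere z₀ hr θ)
  obtain ⟨L, hL, hLv⟩ := hasFDerivAt_intervalIntegral_of_contDiffAt (a := 0) (b := 2 * Real.pi)
    (k := fun (p : ℂ × ℝ) θ => deriv (circleMap z₀ r) θ •
      (((circleMap z₀ r θ - p.1) ^ m)⁻¹ • φ (circleMap z₀ r θ) p.2)) (x₀ := (z₁, t₀))
    fun θ _ => contDiffAt_cauchy_kernel hz₁ (hφ' θ)
  refine ⟨L, hL, ?_⟩
  rw [hLv]
  refine intervalIntegral.integral_congr fun θ _ => ?_
  have h1 : HasDerivAt (φ (circleMap z₀ r θ)) (deriv (φ (circleMap z₀ r θ)) t₀) t₀ := by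
    have h2 : DifferentiableAt ℝ (fun t : ℝ => (circleMap z₀ r θ, t)) t₀ := by fun_prop
    exact (DifferentiableAt.comp (g := fun p : ℂ × ℝ => φ p.1 p.2) t₀
      ((hφ' θ).differentiableAt (by simp)) h2).hasDerivAt
  have h3 : DifferentiableAt ℝ (fun p : ℂ × ℝ => deriv (circleMap z₀ r) θ •
      (((circleMap z₀ r θ - p.1) ^ m)⁻¹ • φ (circleMap z₀ r θ) p.2)) (z₁, t₀) := by
    have h4 := (contDiffAt_cauchy_kernel (m := m) (θ := θ) hz₁ (hφ' θ)).differentiableAt (by simp)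
    have h5 : DifferentiableAt ℝ (fun p : ℂ × ℝ => (p, θ)) (z₁, t₀) := by fun_prop
    exact DifferentiableAt.comp (f := fun p : ℂ × ℝ => (p, θ)) (z₁, t₀) h4 h5
  have h6 : HasDerivAt (fun t : ℝ => ((z₁, t) : ℂ × ℝ)) (0, 1) t₀ :=
    (hasDerivAt_const t₀ z₁).prodMk (hasDerivAt_id t₀)
  have h7 := h3.hasFDerivAt.comp_hasDerivAt t₀ h6
  have h8 := (h1.const_smul (((circleMap z₀ r θ - z₁) ^ m)⁻¹)).const_smul (deriv (circleMap z₀ r) θ)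
  exact h7.unique h8

/-- A continuous root of `F(·, t)` is differentiable in `t` where `∂F/∂z ≠ 0`. -/
theorem hasDerivAt_of_hasFDerivAt_root {F : ℂ × ℝ → ℂ} {L : ℂ × ℝ →L[ℝ] ℂ} {a : ℝ → ℂ} {t₀ : ℝ}
    {A : ℂ} (hF : HasFDerivAt F L (a t₀, t₀)) (hL : ∀ u, L (u, 0) = A * u) (hA : A ≠ 0)
    (ha : ContinuousAt a t₀) (h0 : ∀ᶠ t in 𝓝 t₀, F (a t, t) = 0) :
    HasDerivAt a (-(L (0, 1)) / A) t₀ := by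
  set b := L (0, 1) with hb
  have hLs : ∀ u s, L (u, s) = A * u + s * b := by
    intro u s
    have : ((u, s) : ℂ × ℝ) = (u, 0) + s • (0, 1) := by simp
    rw [this, map_add, map_smul, hL, real_smul]
  set X : ℝ → ℂ × ℝ := fun t => (a t - a t₀, t - t₀) with hX
  have htend : Tendsto (fun t => ((a t, t) : ℂ × ℝ)) (𝓝 t₀) (𝓝 (a t₀, t₀)) :=
    ha.prodMk_nhds continuousAt_id
  have h1 := hF.isLittleO.comp_tendsto htend
  set R : ℝ → ℂ := fun t => a t - a t₀ - (t - t₀) • (-b / A) with hR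
  have hRX : R =o[𝓝 t₀] X := by
    have h2 : (fun t => A * R t) =o[𝓝 t₀] X := by
      refine (h1.neg_left).congr' ?_ (.of_forall fun t => by simp [hX])
      filter_upwards [h0] with t ht
      have ht0 := h0.self_of_nhds
      simp only [Function.comp_apply, Prod.mk_sub_mk, ht, ht0, hLs, hR, real_smul]
      push_cast
      field_simp
      ring
    refine (h2.const_mul_left A⁻¹).congr_left fun t => ?_
    field_simp
  -- The remainder is small relative to `(Δa, Δt)`; absorbing half of that norm on the left bounds
  -- `Δa` by `Δt`.
  have hXt : X =O[𝓝 t₀] fun t => t - t₀ := by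
    have h2 : ∀ᶠ t in 𝓝 t₀, ‖R t‖ ≤ 1 / 2 * ‖X t‖ := hRX.bound (by norm_num)
    refine Asymptotics.IsBigO.of_bound (2 * (‖b / A‖ + 1)) ?_
    filter_upwards [h2] with t ht
    have h3 : a t - a t₀ = R t + (t - t₀) • (-b / A) := by simp [hR]
    have h4 : ‖a t - a t₀‖ ≤ ‖R t‖ + ‖t - t₀‖ * ‖b / A‖ := by
      rw [h3]
      refine (norm_add_le _ _).trans ?_
      rw [norm_smul, neg_div, norm_neg]
    have h5 : ‖X t‖ ≤ ‖a t - a t₀‖ + ‖t - t₀‖ := by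
      simp only [hX, Prod.norm_mk]
      exact max_le_add_of_nonneg (norm_nonneg _) (norm_nonneg _)
    nlinarith
  rw [hasDerivAt_iff_isLittleO]
  exact hRX.trans_isBigO hXt

theorem continuousAt_fderiv_snd {ψ : ℂ → ℝ → ℂ} {w : ℂ} {t₀ : ℝ}
    (h : ContDiffAt ℝ 1 (fun p : ℂ × ℝ => ψ p.1 p.2) (w, t₀)) :
    ContinuousAt (fun w => deriv (ψ w) t₀) w := by
  have h1 : ContinuousAt (fderiv ℝ fun p : ℂ × ℝ => ψ p.1 p.2) (w, t₀) :=
    (h.fderiv_right (m := 0) (by simp)).continuousAt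
  have h2 : ContinuousAt (fun w : ℂ => (w, t₀)) w := by fun_prop
  have h3 := (ContinuousAt.comp (f := fun w : ℂ => (w, t₀)) h1 h2).clm_apply
    (continuousAt_const (y := ((0, 1) : ℂ × ℝ)))
  refine h3.congr ?_
  have h4 : ∀ᶠ v in 𝓝 w, ContDiffAt ℝ 1 (fun p : ℂ × ℝ => ψ p.1 p.2) (v, t₀) :=
    h2.eventually (h.eventually (by simp))
  filter_upwards [h4] with v hv
  have h5 : HasDerivAt (fun t : ℝ => ((v, t) : ℂ × ℝ)) (0, 1) t₀ :=
    (hasDerivAt_const t₀ v).prodMk (hasDerivAt_id t₀)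
  exact ((hv.differentiableAt (by simp)).hasFDerivAt.comp_hasDerivAt t₀ h5).deriv.symm

/-- The variation in a parameter of a family of functions given by Cauchy integrals. -/
theorem exists_variation_of_cauchy {ψ Ψ : ℂ → ℝ → ℂ} {z₀ : ℂ} {r t₀ : ℝ} (hr : 0 < r)
    (hψ : ∀ w ∈ Metric.sphere z₀ r, ContDiffAt ℝ 1 (fun p : ℂ × ℝ => ψ p.1 p.2) (w, t₀))
    (h : ∀ᶠ t in 𝓝 t₀, ∀ z ∈ Metric.ball z₀ r,
      ∮ w in C(z₀, r), (w - z)⁻¹ • ψ w t = (2 * Real.pi * I : ℂ) • Ψ z t) :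
    ∃ M : ℂ → ℂ, AnalyticOnNhd ℂ M (Metric.ball z₀ r) ∧
      ∀ z ∈ Metric.ball z₀ r, HasDerivAt (Ψ z) (M z) t₀ := by
  have hpi : (2 * Real.pi * I : ℂ) ≠ 0 := two_pi_I_ne_zero
  lift r to NNReal using hr.le
  refine ⟨fun z => (2 * Real.pi * I : ℂ)⁻¹ • ∮ w in C(z₀, r), (w - z)⁻¹ • deriv (ψ w) t₀, ?_, ?_⟩
  · have hc : CircleIntegrable (fun w => deriv (ψ w) t₀) z₀ r :=
      ContinuousOn.circleIntegrable hr.le fun w hw =>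
        (continuousAt_fderiv_snd (hψ w hw)).continuousWithinAt
    have := (hasFPowerSeriesOn_cauchy_integral hc (by exact_mod_cast hr)).analyticOnNhd
    rwa [Metric.eball_coe] at this
  · intro z hz
    obtain ⟨L, hL, hL1⟩ := hasFDerivAt_circleIntegral 1 hz hψ
    have h6 : HasDerivAt (fun t : ℝ => ((z, t) : ℂ × ℝ)) (0, 1) t₀ :=
      (hasDerivAt_const t₀ z).prodMk (hasDerivAt_id t₀)
    have h7 := (hL.comp_hasDerivAt t₀ h6).const_smul (2 * Real.pi * I : ℂ)⁻¹
    simp only [pow_one] at hL1 h7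
    rw [hL1] at h7
    refine h7.congr_of_eventuallyEq ?_
    filter_upwards [h] with t ht
    show Ψ z t = (2 * Real.pi * I : ℂ)⁻¹ • ∮ w in C(z₀, r), (w - z)⁻¹ • ψ w t
    rw [ht z hz, inv_smul_smul₀ hpi]

/-! ### Regularity of the family in the parameter. -/

namespace WeierstrassTau

variable {n : ℕ} {I : Set ℝ} {f : ℂ → ℝ → ℂ} {ω₂ : ℝ → ℍ} {t₀ : ℝ}

/-- The domain of definition of the family. -/
def domain (I : Set ℝ) (ω₂ : ℝ → ℍ) : Set (ℂ × ℝ) := {p | p.2 ∈ I ∧ p.1 ∉ latt (ω₂ p.2)}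

theorem continuousAt_tau (hI : IsOpen I) (hω₂ : ContinuousOn ω₂ I) (ht : t₀ ∈ I) :
    ContinuousAt (fun t => (ω₂ t : ℂ)) t₀ :=
  UpperHalfPlane.continuous_coe.continuousAt.comp (hω₂.continuousAt (hI.mem_nhds ht))

theorem continuousAt_pair (hI : IsOpen I) (hω₂ : ContinuousOn ω₂ I) (ht : t₀ ∈ I) (z : ℂ) :
    ContinuousAt (fun p : ℂ × ℝ => ((p.1, (ω₂ p.2 : ℂ)) : ℂ × ℂ)) (z, t₀) :=
  continuousAt_fst.prodMk (ContinuousAt.comp (f := fun p : ℂ × ℝ => p.2) (x := (z, t₀))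
    (continuousAt_tau hI hω₂ ht) continuousAt_snd)

/-- Off the lattice means `σ(z; ω₂(t)) ≠ 0`, and `σ` is jointly continuous. -/
theorem isOpen_domain (hI : IsOpen I) (hω₂ : ContinuousOn ω₂ I) : IsOpen (domain I ω₂) := by
  rw [isOpen_iff_mem_nhds]
  rintro ⟨z, t⟩ ⟨ht, hz⟩
  have h1 : ContinuousAt (fun p : ℂ × ℝ => sig p.1 (ω₂ p.2)) (z, t) :=
    ContinuousAt.comp (f := fun p : ℂ × ℝ => ((p.1, (ω₂ p.2 : ℂ)) : ℂ × ℂ)) (x := (z, t))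
      (differentiableAt_sig (q := (z, ω₂ t)) (ω₂ t).im_pos).continuousAt
      (continuousAt_pair hI hω₂ ht z)
  have h2 : sig z (ω₂ t) ≠ 0 := by rwa [Ne, sig_eq_zero_iff_mem (ω₂ t).im_pos]
  filter_upwards [h1.eventually_ne h2, continuousAt_snd.eventually (hI.mem_nhds ht)] with p hp hp2
  refine ⟨hp2, fun h => hp ?_⟩
  rwa [sig_eq_zero_iff_mem (ω₂ p.2).im_pos]

theorem contDiffAt_family (hI : IsOpen I) (hω₂ : ContinuousOn ω₂ I)
    (hf : ContDiffOn ℝ 1 (fun p : ℂ × ℝ => f p.1 p.2) (domain I ω₂)) (ht : t₀ ∈ I) {z : ℂ}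
    (hz : z ∉ latt (ω₂ t₀)) : ContDiffAt ℝ 1 (fun p : ℂ × ℝ => f p.1 p.2) (z, t₀) :=
  hf.contDiffAt ((isOpen_domain hI hω₂).mem_nhds ⟨ht, hz⟩)

theorem eventually_closedBall_domain (hI : IsOpen I) (hω₂ : ContinuousOn ω₂ I) (ht : t₀ ∈ I)
    {K : Set ℂ} (hK : IsCompact K) (h : K ⊆ (latt (ω₂ t₀))ᶜ) :
    ∀ᶠ t in 𝓝 t₀, t ∈ I ∧ ∀ z ∈ K, z ∉ latt (ω₂ t) := by
  refine Filter.Eventually.and (hI.mem_nhds ht) ?_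
  refine hK.eventually_forall_of_forall_eventually (P := fun t z => z ∉ latt (ω₂ t)) fun z hz => ?_
  have h1 : ∀ᶠ p in 𝓝 (z, t₀), p ∈ domain I ω₂ :=
    (isOpen_domain hI hω₂).mem_nhds ⟨ht, h hz⟩
  have h2 : Tendsto (fun p : ℝ × ℂ => (p.2, p.1)) (𝓝 (t₀, z)) (𝓝 (z, t₀)) :=
    (continuous_snd.prodMk continuous_fst).tendsto _
  filter_upwards [h2.eventually h1] with p hp using hp.2

theorem exists_closedBall_subset (τ : ℍ) {z : ℂ} (hz : z ∉ latt τ) :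
    ∃ r > 0, Metric.closedBall z r ⊆ (latt τ)ᶜ :=
  Metric.nhds_basis_closedBall.mem_iff.mp ((isOpen_compl_latt τ.im_pos).mem_nhds hz)

theorem differentiableOn_family
    (hell : ∀ t ∈ I, IsEllipticPoleAtZero (PeriodPair.ofTau (ω₂ t)) n (fun z => f z t))
    {t : ℝ} (ht : t ∈ I) : DifferentiableOn ℂ (fun z => f z t) (latt (ω₂ t))ᶜ := fun _ hz =>
  (analyticAt_of_elliptic (hell t ht) hz).differentiableAt.differentiableWithinAt

/-- Differentiating Cauchy's formula under the integral writes `∂f/∂t` as a Cauchy integral, which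
is holomorphic in `z`. -/
theorem analyticAt_variation (hI : IsOpen I) (hω₂ : ContinuousOn ω₂ I)
    (hf : ContDiffOn ℝ 1 (fun p : ℂ × ℝ => f p.1 p.2) (domain I ω₂))
    (hell : ∀ t ∈ I, IsEllipticPoleAtZero (PeriodPair.ofTau (ω₂ t)) n (fun z => f z t))
    (ht : t₀ ∈ I) {z : ℂ} (hz : z ∉ latt (ω₂ t₀)) :
    AnalyticAt ℂ (fun z => deriv (f z) t₀) z := by
  obtain ⟨r, hr, hball⟩ := exists_closedBall_subset (ω₂ t₀) hz
  obtain ⟨M, hM, hMd⟩ := exists_variation_of_cauchy (ψ := f) (Ψ := f) hr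
    (fun w hw => contDiffAt_family hI hω₂ hf ht (hball (Metric.sphere_subset_closedBall hw))) (by
      filter_upwards [eventually_closedBall_domain hI hω₂ ht
        (isCompact_closedBall z r) hball] with t ht' w hw
      have hd := (differentiableOn_family hell ht'.1).mono (s := Metric.closedBall z r) ht'.2
      exact Complex.circleIntegral_sub_inv_smul_of_differentiable_on_off_countable countable_empty
        hw hd.continuousOn fun x hx => hd.differentiableAt (Metric.closedBall_mem_nhds_of_mem hx.1))
  refine (hM z (Metric.mem_ball_self hr)).congr ?_
  filter_upwards [Metric.ball_mem_nhds z hr] with w hw using (hMd w hw).deriv.symm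

theorem hasFDerivAt_family (hI : IsOpen I) (hω₂ : ContinuousOn ω₂ I)
    (hf : ContDiffOn ℝ 1 (fun p : ℂ × ℝ => f p.1 p.2) (domain I ω₂))
    (hell : ∀ t ∈ I, IsEllipticPoleAtZero (PeriodPair.ofTau (ω₂ t)) n (fun z => f z t))
    (ht : t₀ ∈ I) {z : ℂ} (hz : z ∉ latt (ω₂ t₀)) :
    ∃ L : ℂ × ℝ →L[ℝ] ℂ, HasFDerivAt (fun p : ℂ × ℝ => f p.1 p.2) L (z, t₀) ∧
      (∀ u, L (u, 0) = deriv (fun z => f z t₀) z * u) ∧ L (0, 1) = deriv (f z) t₀ := by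
  have h1 := ((contDiffAt_family hI hω₂ hf ht hz).differentiableAt (by simp)).hasFDerivAt
  refine ⟨_, h1, fun u => ?_, ?_⟩
  · have h2 : HasFDerivAt (fun z : ℂ => ((z, t₀) : ℂ × ℝ)) (ContinuousLinearMap.inl ℝ ℂ ℝ) z :=
      hasFDerivAt_prodMk_left z t₀
    have h3 := HasFDerivAt.comp (f := fun z : ℂ => ((z, t₀) : ℂ × ℝ)) z h1 h2
    have h4 := (analyticAt_of_elliptic (hell t₀ ht)
      hz).differentiableAt.hasDerivAt.hasFDerivAt.restrictScalars ℝ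
    have h5 := congrArg (fun L : ℂ →L[ℝ] ℂ => L u) (h3.unique h4)
    simpa [mul_comm] using! h5
  · have h6 : HasDerivAt (fun t : ℝ => ((z, t) : ℂ × ℝ)) (0, 1) t₀ :=
      (hasDerivAt_const t₀ z).prodMk (hasDerivAt_id t₀)
    exact (h1.comp_hasDerivAt t₀ h6).deriv.symm

/-- `f` is only `C¹`, but `f'` is the Cauchy integral of `f` with kernel `(w - z)⁻²` and so is again
differentiable in `(z, t)`. The same formula for `∂f/∂t` identifies the mixed derivative. -/
theorem hasFDerivAt_deriv_family (hI : IsOpen I) (hω₂ : ContinuousOn ω₂ I)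
    (hf : ContDiffOn ℝ 1 (fun p : ℂ × ℝ => f p.1 p.2) (domain I ω₂))
    (hell : ∀ t ∈ I, IsEllipticPoleAtZero (PeriodPair.ofTau (ω₂ t)) n (fun z => f z t))
    (ht : t₀ ∈ I) {z : ℂ} (hz : z ∉ latt (ω₂ t₀)) :
    ∃ L : ℂ × ℝ →L[ℝ] ℂ,
      HasFDerivAt (fun p : ℂ × ℝ => deriv (fun z => f z p.2) p.1) L (z, t₀) ∧
      (∀ u, L (u, 0) = deriv (deriv fun z => f z t₀) z * u) ∧
      L (0, 1) = deriv (fun z => deriv (f z) t₀) z := by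
  obtain ⟨r, hr, hball⟩ := exists_closedBall_subset (ω₂ t₀) hz
  obtain ⟨L, hL, hL1⟩ := hasFDerivAt_circleIntegral (φ := f) 2 (Metric.mem_ball_self hr)
    (fun w hw => contDiffAt_family hI hω₂ hf ht (hball (Metric.sphere_subset_closedBall hw)))
  have h1 := hL.const_smul (2 * Real.pi * Complex.I : ℂ)⁻¹
  have hev : (fun p : ℂ × ℝ => deriv (fun z => f z p.2) p.1) =ᶠ[𝓝 (z, t₀)]
      fun p => (2 * Real.pi * Complex.I : ℂ)⁻¹ •
        ∮ w in C(z, r), ((w - p.1) ^ 2)⁻¹ • f w p.2 := by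
    have h2 : ∀ᶠ p : ℂ × ℝ in 𝓝 (z, t₀), p.1 ∈ Metric.ball z r :=
      continuousAt_fst.eventually (Metric.ball_mem_nhds z hr)
    have hsnd : Tendsto (fun p : ℂ × ℝ => p.2) (𝓝 (z, t₀)) (𝓝 t₀) := continuousAt_snd
    have h3 := hsnd.eventually
      (eventually_closedBall_domain hI hω₂ ht (isCompact_closedBall z r) hball)
    filter_upwards [h2, h3] with p hp1 hp2
    exact (two_pi_I_inv_smul_circleIntegral_sub_sq_inv_smul_of_differentiable
      (isOpen_compl_latt (ω₂ p.2).im_pos) hp2.2 (differentiableOn_family hell hp2.1) hp1).symm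
  have h4 := h1.congr_of_eventuallyEq hev
  refine ⟨_, h4, fun u => ?_, ?_⟩
  · have h2 : HasFDerivAt (fun z : ℂ => ((z, t₀) : ℂ × ℝ)) (ContinuousLinearMap.inl ℝ ℂ ℝ) z :=
      hasFDerivAt_prodMk_left z t₀
    have h3 := HasFDerivAt.comp (f := fun z : ℂ => ((z, t₀) : ℂ × ℝ)) z h4 h2
    have h5 := (analyticAt_of_elliptic (hell t₀ ht)
      hz).deriv.differentiableAt.hasDerivAt.hasFDerivAt.restrictScalars ℝ
    have h6 := congrArg (fun L : ℂ →L[ℝ] ℂ => L u) (h3.unique h5)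
    simpa [mul_comm] using! h6
  · have h5 := two_pi_I_inv_smul_circleIntegral_sub_sq_inv_smul_of_differentiable
      (isOpen_compl_latt (ω₂ t₀).im_pos) hball (f := fun z => deriv (f z) t₀)
      (fun w hw => (analyticAt_variation hI hω₂ hf hell ht
        hw).differentiableAt.differentiableWithinAt) (Metric.mem_ball_self hr)
    rw [← h5, ← hL1]
    rfl

/-- The coefficient of `z ^ (-n)` of `f(·, t)` at the origin. -/
noncomputable def leadCoeff (n : ℕ) (f : ℂ → ℝ → ℂ) (t : ℝ) : ℂ :=
  limUnder (𝓝[≠] (0 : ℂ)) fun z => z ^ n * f z t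

theorem leadCoeff_eq {t : ℝ} {G : ℂ → ℂ} (hG : AnalyticAt ℂ G 0)
    (h : ∀ᶠ z in 𝓝[≠] 0, z ^ n * f z t = G z) : leadCoeff n f t = G 0 :=
  ((hG.continuousAt.tendsto.mono_left nhdsWithin_le_nhds).congr' (EventuallyEq.symm h)).limUnder_eq

/-- The pole of `∂f/∂t` does not grow: `z^n f` is given by a Cauchy integral over a fixed circle
around the origin, which is differentiated in `t`. -/
theorem exists_pole_variation (hn : n ≠ 0) (hI : IsOpen I) (hω₂ : ContinuousOn ω₂ I)
    (hf : ContDiffOn ℝ 1 (fun p : ℂ × ℝ => f p.1 p.2) (domain I ω₂))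
    (hell : ∀ t ∈ I, IsEllipticPoleAtZero (PeriodPair.ofTau (ω₂ t)) n (fun z => f z t))
    (ht : t₀ ∈ I) :
    ∃ M : ℂ → ℂ, AnalyticAt ℂ M 0 ∧ (∀ᶠ z in 𝓝[≠] 0, z ^ n * deriv (f z) t₀ = M z) ∧
      HasDerivAt (leadCoeff n f) (M 0) t₀ := by
  -- A disc on which `σ(z)/z` has no zero contains no lattice point but the origin; by compactness
  -- the same disc serves for all `t` near `t₀`.
  have hsD0 : ∀ᶠ z in 𝓝 (0 : ℂ), sigDiv z (ω₂ t₀) ≠ 0 :=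
    (differentiable_sigDiv (ω₂ t₀).im_pos 0).continuousAt.eventually_ne (by simp [sigDiv_zero])
  obtain ⟨r, hr, hball⟩ := Metric.nhds_basis_closedBall.mem_iff.mp hsD0
  have hnot : ∀ t, ∀ z : ℂ, z ≠ 0 → sigDiv z (ω₂ t) ≠ 0 → z ∉ latt (ω₂ t) := by
    intro t z hz0 hz h
    rw [← sig_eq_zero_iff_mem (ω₂ t).im_pos, sig] at h
    exact mul_ne_zero hz0 hz h
  have hevt : ∀ᶠ t in 𝓝 t₀, t ∈ I ∧ ∀ z ∈ Metric.closedBall (0 : ℂ) r, sigDiv z (ω₂ t) ≠ 0 := by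
    refine Filter.Eventually.and (hI.mem_nhds ht) ?_
    refine (isCompact_closedBall (0 : ℂ) r).eventually_forall_of_forall_eventually
      (P := fun t z => sigDiv z (ω₂ t) ≠ 0) fun z hz => ?_
    have h1 : ContinuousAt (fun p : ℂ × ℝ => sigDiv p.1 (ω₂ p.2)) (z, t₀) :=
      ContinuousAt.comp (f := fun p : ℂ × ℝ => ((p.1, (ω₂ p.2 : ℂ)) : ℂ × ℂ)) (x := (z, t₀))
        (differentiableAt_sigDiv (q := (z, ω₂ t₀)) (ω₂ t₀).im_pos).continuousAt
        (continuousAt_pair hI hω₂ ht z)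
    have h2 : Tendsto (fun p : ℝ × ℂ => (p.2, p.1)) (𝓝 (t₀, z)) (𝓝 (z, t₀)) :=
      (continuous_snd.prodMk continuous_fst).tendsto _
    exact h2.eventually (h1.eventually_ne (hball hz))
  set Ψ : ℂ → ℝ → ℂ := fun z t => if z = 0 then leadCoeff n f t else z ^ n * f z t with hΨ
  obtain ⟨M, hM, hMd⟩ := exists_variation_of_cauchy (ψ := fun z t => z ^ n * f z t) (Ψ := Ψ)
    (z₀ := 0) (t₀ := t₀) hr (fun w hw => by
      have hw0 : w ≠ 0 := Metric.ne_of_mem_sphere hw hr.ne'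
      have h1 := contDiffAt_family hI hω₂ hf ht
        (hnot t₀ w hw0 (hball (Metric.sphere_subset_closedBall hw)))
      have h2 : ContDiffAt ℝ 1 (fun p : ℂ × ℝ => p.1 ^ n) (w, t₀) := by fun_prop
      exact h2.mul h1) (by
      filter_upwards [hevt] with t ht' z hz
      obtain ⟨G, hG, -, hGf⟩ := exists_pole_form hn (hell t ht'.1)
      have hd : ∀ x ∈ Metric.closedBall (0 : ℂ) r, DifferentiableAt ℂ (fun z => Ψ z t) x := by
        intro x hx
        by_cases hx0 : x = 0
        · subst hx0
          refine hG.differentiableAt.congr_of_eventuallyEq ?_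
          rw [eventually_nhdsWithin_iff] at hGf
          filter_upwards [hGf] with w hw
          by_cases hw0 : w = 0
          · simp only [hΨ, hw0, if_true]
            exact leadCoeff_eq hG (eventually_nhdsWithin_iff.mpr hGf)
          · simp only [hΨ, hw0, if_false]
            exact hw hw0
        · have h1 := (analyticAt_of_elliptic (hell t ht'.1)
            (hnot t x hx0 (ht'.2 x hx))).differentiableAt
          refine ((differentiableAt_id.pow n).mul h1).congr_of_eventuallyEq ?_
          filter_upwards [isOpen_ne.mem_nhds hx0] with w hw
          simp [hΨ, show w ≠ 0 from hw]
      have h2 := Complex.circleIntegral_sub_inv_smul_of_differentiable_on_off_countable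
        countable_empty hz (fun x hx => (hd x hx).continuousAt.continuousWithinAt)
        fun x hx => hd x (Metric.ball_subset_closedBall hx.1)
      rw [← h2]
      refine circleIntegral.integral_congr hr.le fun w hw => ?_
      have hw0 : w ≠ 0 := Metric.ne_of_mem_sphere hw hr.ne'
      simp [hΨ, hw0])
  refine ⟨M, hM 0 (Metric.mem_ball_self hr), ?_, ?_⟩
  · rw [eventually_nhdsWithin_iff]
    filter_upwards [Metric.ball_mem_nhds (0 : ℂ) hr] with w hw hw0
    have hw0 : w ≠ 0 := hw0
    have h1 := hMd w hw
    simp only [hΨ, hw0, if_false] at h1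
    have h2 := contDiffAt_family hI hω₂ hf ht
      (hnot t₀ w hw0 (hball (Metric.ball_subset_closedBall hw)))
    have h3 : HasDerivAt (fun t : ℝ => ((w, t) : ℂ × ℝ)) (0, 1) t₀ :=
      (hasDerivAt_const t₀ w).prodMk (hasDerivAt_id t₀)
    have h4 := (h2.differentiableAt (by simp)).hasFDerivAt.comp_hasDerivAt t₀ h3
    exact (h4.differentiableAt.hasDerivAt.const_mul (w ^ n)).unique h1
  · simpa [hΨ] using! hMd 0 (Metric.mem_ball_self hr)

end WeierstrassTau

/-! ### Derivatives in `t` of the period, the critical data and `c`. -/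

namespace WeierstrassTau

variable {n : ℕ} {I : Set ℝ} {f : ℂ → ℝ → ℂ} {ω₂ : ℝ → ℍ} {t₀ : ℝ}

theorem periodic_family
    (hell : ∀ t ∈ I, IsEllipticPoleAtZero (PeriodPair.ofTau (ω₂ t)) n (fun z => f z t))
    {t : ℝ} (ht : t ∈ I) {z ω : ℂ} (hω : ω ∈ latt (ω₂ t)) (hz : z ∉ latt (ω₂ t)) :
    f (z + ω) t = f z t :=
  (hell t ht).periodic ω ((mem_lattice _ _).mpr hω) z fun h => hz ((mem_lattice _ _).mp h)

theorem eventually_domain (hI : IsOpen I) (hω₂ : ContinuousOn ω₂ I) (ht : t₀ ∈ I) {z : ℂ}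
    (hz : z ∉ latt (ω₂ t₀)) : ∀ᶠ t in 𝓝 t₀, t ∈ I ∧ z ∉ latt (ω₂ t) := by
  have h := eventually_closedBall_domain hI hω₂ ht (isCompact_singleton (x := z))
    (singleton_subset_iff.mpr hz)
  simpa using h

theorem variation_add_one (hI : IsOpen I) (hω₂ : ContinuousOn ω₂ I)
    (hell : ∀ t ∈ I, IsEllipticPoleAtZero (PeriodPair.ofTau (ω₂ t)) n (fun z => f z t))
    (ht : t₀ ∈ I) {z : ℂ} (hz : z ∉ latt (ω₂ t₀)) : deriv (f (z + 1)) t₀ = deriv (f z) t₀ := by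
  refine Filter.EventuallyEq.deriv_eq ?_
  filter_upwards [eventually_domain hI hω₂ ht hz] with t h
  exact periodic_family hell h.1 (one_mem_latt _) h.2

theorem hasDerivAt_variation (hI : IsOpen I) (hω₂ : ContinuousOn ω₂ I)
    (hf : ContDiffOn ℝ 1 (fun p : ℂ × ℝ => f p.1 p.2) (domain I ω₂)) (ht : t₀ ∈ I) {z : ℂ}
    (hz : z ∉ latt (ω₂ t₀)) : HasDerivAt (f z) (deriv (f z) t₀) t₀ := by
  have h6 : HasDerivAt (fun t : ℝ => ((z, t) : ℂ × ℝ)) (0, 1) t₀ :=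
    (hasDerivAt_const t₀ z).prodMk (hasDerivAt_id t₀)
  exact (((contDiffAt_family hI hω₂ hf ht hz).differentiableAt
    (by simp)).hasFDerivAt.comp_hasDerivAt t₀ h6).differentiableAt.hasDerivAt

/-- `z + ω₂(t)` is a continuous root `w` of `f(w, t) - f(z, t)`, simple because `f'(z) ≠ 0`. -/
theorem hasDerivAt_tau (hI : IsOpen I) (hω₂ : ContinuousOn ω₂ I)
    (hf : ContDiffOn ℝ 1 (fun p : ℂ × ℝ => f p.1 p.2) (domain I ω₂))
    (hell : ∀ t ∈ I, IsEllipticPoleAtZero (PeriodPair.ofTau (ω₂ t)) n (fun z => f z t))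
    (ht : t₀ ∈ I) {z : ℂ} (hz : z ∉ latt (ω₂ t₀)) (hz' : deriv (fun z => f z t₀) z ≠ 0) :
    HasDerivAt (fun t => (ω₂ t : ℂ))
      (-(deriv (f (z + ω₂ t₀)) t₀ - deriv (f z) t₀) / deriv (fun z => f z t₀) z) t₀ := by
  have hzτ : z + ω₂ t₀ ∉ latt (ω₂ t₀) := by rwa [add_mem_latt_iff (tau_mem_latt _)]
  obtain ⟨L, hL, hL1, hL2⟩ := hasFDerivAt_family hI hω₂ hf hell ht hzτ
  have h1 := HasFDerivAt.comp ((z + ω₂ t₀, t₀) : ℂ × ℝ)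
    (hasDerivAt_variation hI hω₂ hf ht hz).hasFDerivAt (hasFDerivAt_snd (𝕜 := ℝ))
  have h2 := hasDerivAt_of_hasFDerivAt_root (a := fun t => z + ω₂ t)
    (A := deriv (fun z => f z t₀) z) (hL.sub h1) (fun u => by
      simp [hL1, deriv_add_of_elliptic (hell t₀ ht) hz (tau_mem_latt _)]) hz'
    (continuousAt_const.add (continuousAt_tau hI hω₂ ht)) (by
      filter_upwards [eventually_domain hI hω₂ ht hz] with t h
      simp [periodic_family hell h.1 (tau_mem_latt _) h.2])
  have h3 := h2.sub_const z
  simpa [hL2] using! h3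

theorem hasDerivAt_crit (hI : IsOpen I) (hω₂ : ContinuousOn ω₂ I)
    (hf : ContDiffOn ℝ 1 (fun p : ℂ × ℝ => f p.1 p.2) (domain I ω₂))
    (hell : ∀ t ∈ I, IsEllipticPoleAtZero (PeriodPair.ofTau (ω₂ t)) n (fun z => f z t))
    (ht : t₀ ∈ I) {b : ℝ → ℂ} (hb : ContinuousAt b t₀) (hbl : b t₀ ∉ latt (ω₂ t₀))
    (hb0 : ∀ t ∈ I, deriv (fun z => f z t) (b t) = 0)
    (hb2 : deriv (deriv fun z => f z t₀) (b t₀) ≠ 0) :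
    HasDerivAt b (-(deriv (fun z => deriv (f z) t₀) (b t₀)) /
      deriv (deriv fun z => f z t₀) (b t₀)) t₀ := by
  obtain ⟨L, hL, hL1, hL2⟩ := hasFDerivAt_deriv_family hI hω₂ hf hell ht hbl
  have := hasDerivAt_of_hasFDerivAt_root hL hL1 hb2 hb (by
    filter_upwards [hI.mem_nhds ht] with t h using hb0 t h)
  rwa [hL2] at this

/-- The motion of the critical point does not contribute, since `f'` vanishes there. -/
theorem hasDerivAt_critValue (hI : IsOpen I) (hω₂ : ContinuousOn ω₂ I)
    (hf : ContDiffOn ℝ 1 (fun p : ℂ × ℝ => f p.1 p.2) (domain I ω₂))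
    (hell : ∀ t ∈ I, IsEllipticPoleAtZero (PeriodPair.ofTau (ω₂ t)) n (fun z => f z t))
    (ht : t₀ ∈ I) {b : ℝ → ℂ} {b' : ℂ} (hb : HasDerivAt b b' t₀) (hbl : b t₀ ∉ latt (ω₂ t₀))
    (hb0 : deriv (fun z => f z t₀) (b t₀) = 0) :
    HasDerivAt (fun t => f (b t) t) (deriv (f (b t₀)) t₀) t₀ := by
  obtain ⟨L, hL, hL1, hL2⟩ := hasFDerivAt_family hI hω₂ hf hell ht hbl
  have h1 : HasDerivAt (fun t : ℝ => ((b t, t) : ℂ × ℝ)) (b', 1) t₀ := hb.prodMk (hasDerivAt_id t₀)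
  have h2 := HasFDerivAt.comp_hasDerivAt (f := fun t : ℝ => ((b t, t) : ℂ × ℝ)) t₀ hL h1
  have h3 : L (b', 1) = deriv (f (b t₀)) t₀ := by
    have : ((b', 1) : ℂ × ℝ) = (b', 0) + (0, 1) := by simp
    rw [this, map_add, hL1, hL2, hb0, zero_mul, zero_add]
  rwa [h3] at h2

theorem hasDerivAt_sig_path {b : ℝ → ℂ} {b' ω' : ℂ} (hb : HasDerivAt b b' t₀)
    (hω : HasDerivAt (fun t => (ω₂ t : ℂ)) ω' t₀) (hbl : b t₀ ∉ latt (ω₂ t₀)) :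
    HasDerivAt (fun t => sig (b t) (ω₂ t)) (sig (b t₀) (ω₂ t₀) *
      (zet (b t₀) (ω₂ t₀) * b' + ω' * dtau (b t₀) (ω₂ t₀))) t₀ := by
  have h := (hasFDerivAt_sig (q := (b t₀, (ω₂ t₀ : ℂ))) (ω₂ t₀).im_pos
    (notMem_latt_iff.mp hbl)).restrictScalars ℝ
  have h2 := HasFDerivAt.comp_hasDerivAt (f := fun t => ((b t, (ω₂ t : ℂ)) : ℂ × ℂ)) t₀ h
    (hb.prodMk hω)
  refine h2.congr_deriv ?_
  simp
  ring

/-- A point outside the lattice that is not critical. -/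
theorem exists_deriv_ne_zero {τ : ℍ} {g : ℂ → ℂ} {a : Fin (n + 1) → ℂ}
    (hcrit : IsSimpleCriticalSystem (PeriodPair.ofTau τ) g a) :
    ∃ z ∉ latt τ, deriv g z ≠ 0 := by
  have h : ∀ᶠ w in 𝓝[≠] (0 : ℂ), w ∉ latt τ ∧ ∀ k, w - a k ∉ latt τ := by
    refine (eventually_notMem_latt τ.im_pos 0).and (eventually_all.mpr fun k => ?_)
    have ht := tendsto_add_const_nhdsNE 0 (-a k)
    filter_upwards [ht.eventually (eventually_notMem_latt τ.im_pos (0 + -a k))] with w hw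
    rwa [sub_eq_add_neg]
  obtain ⟨z, hz, hk⟩ := h.exists
  refine ⟨z, hz, fun h0 => ?_⟩
  obtain ⟨k, hk'⟩ := (hcrit.deriv_eq_zero_iff z fun h => hz ((mem_lattice τ z).mp h)).mp h0
  exact hk k ((mem_lattice τ _).mp hk')

/-- The constant in the product formula for the derivative. -/
noncomputable def prodCoeff (n : ℕ) (f : ℂ → ℝ → ℂ) (ω₂ : ℝ → ℍ) (a : Fin (n + 1) → ℝ → ℂ)
    (t : ℝ) : ℂ :=
  -(n * leadCoeff n f t) / ∏ k, sig (-a k t) (ω₂ t)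

theorem hasDerivAt_sigma_tau (τ : ℍ) {z : ℂ} (hz : z ∉ latt τ) :
    HasDerivAt (fun w : ℂ => (PeriodPair.ofTau (UpperHalfPlane.ofComplex w)).weierstrassSigma z)
      ((PeriodPair.ofTau τ).weierstrassSigma z * (PeriodPair.ofTau τ).dLnSigma₂ z) (τ : ℂ) := by
  rw [sigma_eq, ← dtau_eq_dLnSigma₂ τ hz]
  refine (hasDerivAt_sig_tau τ.im_pos hz).congr_of_eventuallyEq ?_
  filter_upwards [UpperHalfPlane.isOpen_upperHalfPlaneSet.mem_nhds τ.im_pos] with w hw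
  rw [sigma_eq, UpperHalfPlane.ofComplex_apply_of_im_pos hw]

/-- `c` is a quotient with known logarithmic derivatives: `n S` from the leading coefficient, and
those of `σ(-a_k)`, equal to those of `σ(a_k)` by oddness. -/
theorem logDeriv_prodCoeff {a : Fin (n + 1) → ℝ → ℂ} {a' : Fin (n + 1) → ℂ} {ω' S lead' : ℂ}
    (hn : n ≠ 0) (hω : HasDerivAt (fun t => (ω₂ t : ℂ)) ω' t₀)
    (ha : ∀ k, HasDerivAt (a k) (a' k) t₀) (hal : ∀ k, a k t₀ ∉ latt (ω₂ t₀))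
    (hlead : HasDerivAt (leadCoeff n f) lead' t₀) (h0 : leadCoeff n f t₀ ≠ 0)
    (hS : lead' = n * leadCoeff n f t₀ * S) :
    DifferentiableAt ℝ (prodCoeff n f ω₂ a) t₀ ∧
    deriv (prodCoeff n f ω₂ a) t₀ / prodCoeff n f ω₂ a t₀ =
      -(∑ k, (zet (a k t₀) (ω₂ t₀) * a' k + ω' * dtau (a k t₀) (ω₂ t₀))) + n * S := by
  have hn' : (n : ℂ) ≠ 0 := by exact_mod_cast hn
  have hs : ∀ k, sig (-a k t₀) (ω₂ t₀) ≠ 0 := fun k => by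
    rw [sig_neg, neg_ne_zero, Ne, sig_eq_zero_iff_mem (ω₂ t₀).im_pos]
    exact hal k
  have h1 : ∀ k, HasDerivAt (fun t => sig (-a k t) (ω₂ t)) (sig (-a k t₀) (ω₂ t₀) *
      (zet (a k t₀) (ω₂ t₀) * a' k + ω' * dtau (a k t₀) (ω₂ t₀))) t₀ := by
    intro k
    simp only [sig_neg, neg_mul]
    exact (hasDerivAt_sig_path (ha k) hω (hal k)).neg
  have hprod0 : ∏ k, sig (-a k t₀) (ω₂ t₀) ≠ 0 := Finset.prod_ne_zero_iff.mpr fun k _ => hs k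
  have hprodd : DifferentiableAt ℝ (fun t => ∏ k, sig (-a k t) (ω₂ t)) t₀ :=
    DifferentiableAt.fun_finsetProd fun k _ => (h1 k).differentiableAt
  have hN : HasDerivAt (fun t => -(n * leadCoeff n f t)) (-(n * lead')) t₀ :=
    (hlead.const_mul (n : ℂ)).neg
  have hN0 : -(n * leadCoeff n f t₀) ≠ 0 := neg_ne_zero.mpr (mul_ne_zero hn' h0)
  refine ⟨hN.differentiableAt.div hprodd hprod0, ?_⟩
  have h2 := logDeriv_div (f := fun t => -(n * leadCoeff n f t))
    (g := fun t => ∏ k, sig (-a k t) (ω₂ t)) t₀ hN0 hprod0 hN.differentiableAt hprodd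
  have h3 := logDeriv_prod (s := Finset.univ) (f := fun k t => sig (-a k t) (ω₂ t)) (x := t₀)
    (fun k _ => hs k) (fun k _ => (h1 k).differentiableAt)
  have h4 : ∀ k, logDeriv (fun t => sig (-a k t) (ω₂ t)) t₀ =
      zet (a k t₀) (ω₂ t₀) * a' k + ω' * dtau (a k t₀) (ω₂ t₀) := fun k => by
    rw [logDeriv_apply, (h1 k).deriv, mul_div_cancel_left₀ _ (hs k)]
  have h5 : logDeriv (fun t => -(n * leadCoeff n f t)) t₀ = n * S := by
    rw [logDeriv_apply, hN.deriv, hS]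
    field_simp
  rw [h5, h3] at h2
  simp only [h4] at h2
  refine h2.trans ?_
  ring

end WeierstrassTau

namespace WeierstrassTau

variable {n : ℕ} {I : Set ℝ} {f : ℂ → ℝ → ℂ} {ω₂ : ℝ → ℍ} {t₀ : ℝ}

/-- The equation for a critical point, written through `zetSumExcept`. -/
theorem crit_equation {τ : ℍ} {a γ : Fin (n + 1) → ℂ} {d D : ℂ} (l : Fin n) (hD : D ≠ 0)
    (hγ : γ 0 = 0)
    (hd : d = D * (γ l.succ * ((∑ j ∈ Finset.univ.erase l.succ, zet (a l.succ - a j) τ) -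
      (n + 1) * zet (a l.succ) τ) + zetSumExcept τ γ a l.succ (a l.succ))) :
    -d / D = (∑ k ∈ Finset.univ.erase l, γ k.succ * (zet (a k.succ - a l.succ) τ -
        zet (a k.succ) τ + 2 * zet (1 / 2) τ * a l.succ)) +
      γ l.succ * ((∑ s ∈ Finset.univ.erase l.succ, zet (a s - a l.succ) τ) +
        2 * zet (1 / 2) τ * a l.succ + n * zet (a l.succ) τ) := by
  have h1 : ∀ s, zet (a s - a l.succ) τ = -zet (a l.succ - a s) τ := fun s => by
    rw [← zet_neg, neg_sub]
  -- The index `0` drops out of sums weighted by `γ`, but remains in the sum over `s`. The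
  -- coefficient `n` of `ζ(a_l)` is `n + 1` from the cofactor minus `1` from `zetSumExcept`.
  have h2 : ∀ F : Fin (n + 1) → ℂ, F 0 = 0 →
      ∑ k ∈ Finset.univ.erase l.succ, F k = ∑ k ∈ Finset.univ.erase l, F k.succ := by
    intro F hF
    rw [Finset.sum_erase_eq_sub (Finset.mem_univ _), Finset.sum_erase_eq_sub (Finset.mem_univ _),
      Fin.sum_univ_succ, hF, zero_add]
  have h3 : ∑ k, γ k = (∑ k ∈ Finset.univ.erase l, γ k.succ) + γ l.succ := by
    rw [Fin.sum_univ_succ, hγ, zero_add, Finset.sum_erase_add _ _ (Finset.mem_univ _)]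
  rw [hd, neg_div, mul_div_cancel_left₀ _ hD, zetSumExcept, h3,
    h2 (fun k => γ k * (zet (a l.succ - a k) τ + zet (a k) τ)) (by simp [hγ])]
  have h4 : ∀ k : Fin n, γ k.succ * (zet (a k.succ - a l.succ) τ - zet (a k.succ) τ +
      2 * zet (1 / 2) τ * a l.succ) =
      -(γ k.succ * (zet (a l.succ - a k.succ) τ + zet (a k.succ) τ)) +
        2 * zet (1 / 2) τ * a l.succ * γ k.succ := fun k => by
    rw [h1]; ring
  simp only [h4, Finset.sum_add_distrib, Finset.sum_neg_distrib, ← Finset.mul_sum]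
  simp only [h1, Finset.sum_neg_distrib]
  ring

end WeierstrassTau
end

/-! ### Assembly of the system. -/

open WeierstrassTau

theorem mainTheorem2 (n : ℕ) (hn : 2 ≤ n) (I : Set ℝ) (hI : IsOpen I)
    (f : ℂ → ℝ → ℂ) (ω₂ : ℝ → ℍ) (a : Fin (n + 1) → ℝ → ℂ)
    (hω₂ : ContinuousOn ω₂ I)
    (ha : ∀ k, ContinuousOn (a k) I)
    (hf : ContDiffOn ℝ 1 (fun p : ℂ × ℝ => f p.1 p.2)
      {p : ℂ × ℝ | p.2 ∈ I ∧ p.1 ∉ (PeriodPair.ofTau (ω₂ p.2)).lattice})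
    (hell : ∀ t ∈ I, IsEllipticPoleAtZero (PeriodPair.ofTau (ω₂ t)) n (fun z => f z t))
    (hcrit : ∀ t ∈ I,
      IsSimpleCriticalSystem (PeriodPair.ofTau (ω₂ t)) (fun z => f z t) (fun k => a k t))
    (hA₀ : ∀ t ∈ I, f (a 0 t) t = 0) :
    ∃ c : ℝ → ℂ, ∀ t ∈ I,
      let L : ℝ → PeriodPair := fun s => PeriodPair.ofTau (ω₂ s)
      let σ : ℂ → ℂ := (L t).weierstrassSigma
      let ζ : ℂ → ℂ := (L t).weierstrassZeta
      let P : ℂ → ℂ := (L t).weierstrassP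
      let η₁ : ℂ := (L t).eta₁
      let γ : Fin (n + 1) → ℂ := fun k => critGamma L f c a k t
      -- the definition of `c`, and the values `D_k`
      c t ≠ 0 ∧
      (∀ z ∉ (L t).lattice,
        deriv (fun w => f w t) z = c t * (∏ k, σ (z - a k t)) / σ z ^ (n + 1)) ∧
      (∀ k, deriv (deriv (fun w => f w t)) (a k t) = critD (L t) (c t) (fun j => a j t) k) ∧
      -- the functions of `t` occurring in the system are differentiable
      (∀ k, DifferentiableAt ℝ (a k) t) ∧
      (∀ k, DifferentiableAt ℝ (fun s => f (a k s) s) t) ∧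
      DifferentiableAt ℝ c t ∧
      DifferentiableAt ℝ (fun s => (ω₂ s : ℂ)) t ∧
      -- the equations for the critical points
      (∀ l : Fin n, deriv (a l.succ) t =
        (∑ k ∈ Finset.univ.erase l,
          γ k.succ * (ζ (a k.succ t - a l.succ t) - ζ (a k.succ t) + η₁ * a l.succ t))
        + γ l.succ * ((∑ s ∈ Finset.univ.erase l.succ, ζ (a s t - a l.succ t))
            + η₁ * a l.succ t + n * ζ (a l.succ t))) ∧
      -- the equation for `c`, with the partial derivative `∂ ln σ / ∂ω₂`
      (∀ k, HasDerivAt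
        (fun w : ℂ => (PeriodPair.ofTau (UpperHalfPlane.ofComplex w)).weierstrassSigma (a k t))
        (σ (a k t) * (L t).dLnSigma₂ (a k t)) (ω₂ t : ℂ)) ∧
      deriv c t / c t =
        -(∑ j, (ζ (a j t) * deriv (a j) t
            + deriv (fun s => (ω₂ s : ℂ)) t * (L t).dLnSigma₂ (a j t)))
        + n * ∑ k : Fin n, γ k.succ * (P (a k.succ t) + η₁) ∧
      -- the equation for the period
      deriv (fun s => (ω₂ s : ℂ)) t = 2 * Real.pi * Complex.I * ∑ k : Fin n, γ k.succ := by
  have hn0 : n ≠ 0 := by omega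
  have hf' : ContDiffOn ℝ 1 (fun p : ℂ × ℝ => f p.1 p.2) (domain I ω₂) := by
    refine hf.mono ?_
    rintro p ⟨hp1, hp2⟩
    exact ⟨hp1, fun h => hp2 ((mem_lattice _ _).mp h)⟩
  refine ⟨prodCoeff n f ω₂ a, fun t ht => ?_⟩
  intro L σ ζ P η₁ γ
  have hτ := (ω₂ t).im_pos
  have hcr := hcrit t ht
  have hal : ∀ k, a k t ∉ latt (ω₂ t) := fun k => notMem_of_crit hcr k
  obtain ⟨G, hG, hG0, hGf⟩ := exists_pole_form hn0 (hell t ht)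
  have hlead := leadCoeff_eq hG hGf
  obtain ⟨Q, hQ, hQ0, hQf⟩ := exists_deriv_pole_form (hell t ht) hG hGf
  obtain ⟨M, hM, hMh, hMd⟩ := exists_pole_variation hn0 hI hω₂ hf' hell ht
  have hs0 : ∏ k, sig (-a k t) (ω₂ t) ≠ 0 := Finset.prod_ne_zero_iff.mpr fun k _ => by
    rw [sig_neg, neg_ne_zero]
    exact sig_crit_ne_zero hcr k
  have hQne : Q 0 ≠ 0 := by
    rw [hQ0, neg_ne_zero]
    exact mul_ne_zero (by exact_mod_cast hn0) hG0
  have hc : prodCoeff n f ω₂ a t ≠ 0 := by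
    rw [prodCoeff, hlead, ← hQ0]
    exact div_ne_zero hQne hs0
  have hform : ∀ z ∉ latt (ω₂ t), deriv (fun w => f w t) z =
      prodCoeff n f ω₂ a t * (∏ k, sig (z - a k t) (ω₂ t)) / sig z (ω₂ t) ^ (n + 1) := by
    intro z hz
    rw [prodCoeff, hlead]
    exact deriv_eq_prod_sig (hell t ht) hcr hG hGf hz
  have hD := deriv_deriv_eq_critD hcr hform
  have hDne : ∀ k, critD (L t) (prodCoeff n f ω₂ a t) (fun j => a j t) k ≠ 0 := fun k => by
    rw [← hD]
    exact hcr.simple k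
  have hh : ∀ z ∉ latt (ω₂ t), AnalyticAt ℂ (fun z => deriv (f z) t) z := fun z hz =>
    analyticAt_variation hI hω₂ hf' hell ht hz
  obtain ⟨z₁, hz₁, hz₁'⟩ := exists_deriv_ne_zero hcr
  obtain ⟨ω', hω⟩ : ∃ ω', HasDerivAt (fun s => (ω₂ s : ℂ)) ω' t :=
    ⟨_, hasDerivAt_tau hI hω₂ hf' hell ht hz₁ hz₁'⟩
  have ha0 : ∀ k, ∀ s ∈ I, deriv (fun z => f z s) (a k s) = 0 := fun k s hs =>
    ((hcrit s hs).deriv_eq_zero_iff _ ((hcrit s hs).notMem k)).mpr ⟨k, by simp⟩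
  have had := fun k => hasDerivAt_crit hI hω₂ hf' hell ht ((ha k).continuousAt (hI.mem_nhds ht))
    (hal k) (ha0 k) (hcr.simple k)
  have hAd := fun k => hasDerivAt_critValue hI hω₂ hf' hell ht (had k) (hal k) (ha0 k t ht)
  have hγ : ∀ k, γ k = deriv (f (a k t)) t / critD (L t) (prodCoeff n f ω₂ a t)
      (fun j => a j t) k := fun k => by
    simp only [γ, critGamma]
    rw [(hAd k).deriv]
  -- The normalisation `A₀ ≡ 0` is what lets the sums start at `k = 1`.
  have hγ0 : γ 0 = 0 := by
    have h1 : (fun s => f (a 0 s) s) =ᶠ[nhds t] fun _ => 0 := by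
      filter_upwards [hI.mem_nhds ht] with s hs using hA₀ s hs
    simp only [γ, critGamma]
    rw [h1.deriv_eq, deriv_const, zero_div]
  obtain ⟨hS, hω'⟩ := eq_deriv_mul_zetSum (ω' := ω') (hell t ht) hcr hc hform hh
    (fun z hz _ => variation_add_one hI hω₂ hell ht hz)
    -- The formula for `ω₂'` holds at every noncritical `z`; by uniqueness of the derivative it
    -- becomes the increment of `∂f/∂t` along `ω₂`.
    (fun z hz hz' => by
      rw [hω.unique (hasDerivAt_tau hI hω₂ hf' hell ht hz hz')]
      field_simp
      ring) hM hMh hQ hQne hQf hγ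
  have hM0 := leading_coeff_eq hcr hS hM hMh hQ hQf
  have hsum : ∀ F : Fin (n + 1) → ℂ, ∑ k, γ k * F k = ∑ k : Fin n, γ k.succ * F k.succ := by
    intro F
    rw [Fin.sum_univ_succ, hγ0, zero_mul, zero_add]
  have hη : η₁ = 2 * zet (1 / 2) (ω₂ t) := eta₁_eq (ω₂ t)
  have hζ : ∀ k, ζ (a k t) = zet (a k t) (ω₂ t) := fun k => zeta_eq _ _ (hal k)
  have hζ' : ∀ j k, j ≠ k → ζ (a j t - a k t) = zet (a j t - a k t) (ω₂ t) := fun j k hjk =>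
    zeta_eq _ _ fun h => hcr.incongruent j k hjk ((mem_lattice _ _).mpr h)
  rw [hQ0, ← hlead, hsum] at hM0
  obtain ⟨hcd, hceq⟩ := logDeriv_prodCoeff hn0 hω had hal hMd (hlead ▸ hG0)
    (S := ∑ k : Fin n, γ k.succ * ((L t).weierstrassP (a k.succ t) + 2 * zet (1 / 2) (ω₂ t)))
    (by rw [hM0]; ring)
  refine ⟨hc, ?_, hD, fun k => (had k).differentiableAt, fun k => (hAd k).differentiableAt, hcd,
    hω.differentiableAt, fun l => ?_, fun k => hasDerivAt_sigma_tau _ (hal k), ?_, ?_⟩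
  · intro z hz
    simp only [σ, L, sigma_eq]
    exact hform z fun h => hz ((mem_lattice _ _).mpr h)
  · have h1 := deriv_variation_eq hcr hc hform hh hS l.succ
    rw [(had l.succ).deriv, hD, crit_equation (a := fun k => a k t) l (hDne l.succ) hγ0 h1, hη]
    congr 1
    · refine Finset.sum_congr rfl fun k hk => ?_
      rw [hζ, hζ' _ _ fun h => Finset.ne_of_mem_erase hk (Fin.succ_injective n h)]
    · rw [hζ, Finset.sum_congr rfl fun s hs => hζ' s l.succ (Finset.ne_of_mem_erase hs)]
  · rw [hceq, hη, hω.deriv]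
    simp only [hζ, (had _).deriv, P]
    congr 2
    exact Finset.sum_congr rfl fun k _ => by rw [dtau_eq_dLnSigma₂ _ (hal k)]
  · have h1 := hsum fun _ => 1
    simp only [mul_one] at h1
    rw [hω.deriv, hω', h1]
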